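/- Let $\Gamma\subset \mathrm{SL}_2(\mathbb R)$ be a Fuchsian group of the first kind (discrete, with $\Gamma\backslash\mathbb H$ of finite hyperbolic volume), acting on $\mathbb H\cup\mathbb R\cup\{\infty\}$ by linear fractional transformations, and let $k\ge 4$ be an even integer. Put $(f|_k\gamma)(z)=(cz+d)^{-k}f(\gamma z)$ for $\gamma=\left(\begin{smallmatrix}a&b\\c&d\end{smallmatrix}\right)$. Powers $z^s=e^{s\log z}$ and logarithms are principal ($-\pi<\arg z\le\pi$), and $\mathbf e(z)=e^{2\pi i z}$. Let $\eta=(\eta_1,\eta_2)$ and $\eta'=(\eta_1',\eta_2')$ be ordered hyperbolic fixed pairs for $\Gamma$: pairs of distinct points of $\mathbb R\cup\{\infty\}$, each pair fixed pointwise by some hyperbolic element of $\Gamma$. Let $\Gamma_\eta$ be the subgroup of $\Gamma$ fixing $\eta_1$ and $\eta_2$, let $\sigma_\eta\in \mathrm{SL}_2(\mathbb R)$ satisfy $\sigma_\eta 0=\eta_1$, $\sigma_\eta\infty=\eta_2$, and let $\ell_\eta>0$ be the translation length of a generator of $\Gamma_\eta$ modulo $\pm I$, so that $\sigma_\eta^{-1}\Gamma_\eta\sigma_\eta$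 equals $\{\pm\mathrm{diag}(e^{j\ell_\eta/2},e^{-j\ell_\eta/2}) : j\in\mathbb Z\}$ modulo $\pm I$; similarly for $\eta'$. Write $\eta^*=(\eta_2,\eta_1)$, and $\eta'\equiv\eta \bmod \Gamma$ if $\gamma\eta'=\eta$ (as ordered pairs) for some $\gamma\in\Gamma$. For $m\in\mathbb Z$ the hyperbolic Poincaré series of weight $k$ is $$P_{\eta,m}(z)=\sum_{\gamma\in\Gamma_\eta\backslash\Gamma}\left(z^{-k/2+2\pi i m/\ell_\eta}\right)\big|_k\,\sigma_\eta^{-1}\gamma ,$$ and the hyperbolic Fourier coefficients $c_{\eta'}(n;f)$ are defined by the expansion $$(f|_k\sigma_{\eta'})(z)=\sum_{n\in\mathbb Z}c_{\eta'}(n;f)\,z^{-k/2+2\pi i n/\ell_{\eta'}}\qquad(z\in\mathbb H).$$ Let $C_{\eta\eta'}=\{ad : \left(\begin{smallmatrix}a&b\\c&d\end{smallmatrix}\right)\in\sigma_\eta^{-1}\Gamma\sigma_{\eta'},\ abcd\ne0\}$ and, for $C\in C_{\eta\eta'}$ and $\alpha=\pm1$, $$S^\star_{\eta\eta'}(m,n;C,\alpha)=\sum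 \mathbf e\!\left(\frac m{\ell_\eta}\log\frac ac+\frac n{\ell_{\eta'}}\log\Big(-\frac cd\Big)\right),$$ the sum being over representatives $\gamma$ of the double cosets in $\Gamma_\eta\backslash\Gamma/\Gamma_{\eta'}$ such that $\left(\begin{smallmatrix}a&b\\c&d\end{smallmatrix}\right)=\sigma_\eta^{-1}\gamma\sigma_{\eta'}$ has $ad=C$ and $\mathrm{sgn}(ac)=\alpha$. Let $B(u,v)=\Gamma(u)\Gamma(v)/\Gamma(u+v)$ (here $\Gamma$ is the gamma function). Let ${}_2F_1(\cdot,\cdot;\cdot;x)$ denote the principal branch of the hypergeometric function, with $-\pi<\arg(1-x)\le\pi$; thus for real $x>1$ it is the limit from the lower half-plane in $x$ of the analytic continuation of the Gauss series to $\mathbb C\setminus[1,\infty)$. **Theorem.** The series $P_{\eta,m}$ converges absolutely on $\mathbb H$ for every $m\in\mathbb Z$, the sums $S^\star_{\eta\eta'}$ are finite, and $P_{\eta,m}$ has a unique hyperbolic expansion at $\eta'$. There exist nonzero real numbers $a,b$ such that $\sigma_\eta\left(\begin{smallmatrix}a&0\\0&1/a\end{smallmatrix}\right)\sigma_{\eta'}^{-1}\in\Gamma$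 if $\eta'\equiv\eta\bmod\Gamma$, and $\sigma_\eta\left(\begin{smallmatrix}0&b\\-1/b&0\end{smallmatrix}\right)\sigma_{\eta'}^{-1}\in\Gamma$ if $\eta'\equiv\eta^*\bmod\Gamma$; and for any such $a,b$ and all $m,n\in\mathbb Z$, $$c_{\eta'}(n;P_{\eta,m})=\frac{e^{2\pi^2n/\ell_{\eta'}}}{\ell_{\eta'}}\,B\!\left(\frac k2-\frac{2\pi i n}{\ell_{\eta'}},\frac k2+\frac{2\pi i n}{\ell_{\eta'}}\right)\left(\Sigma_1+\Sigma_2+\Sigma_3\right)+E_1+E_2,$$ where $$\Sigma_1=\sum_{C\in C_{\eta\eta'},\ C\notin(0,1)}{}_2F_1\!\left(\frac k2-\frac{2\pi i m}{\ell_\eta},\frac k2+\frac{2\pi i n}{\ell_{\eta'}};k;\frac1C\right)\frac{S^\star_{\eta\eta'}(m,n;C,1)+S^\star_{\eta\eta'}(m,n;C,-1)}{C^{k/2}},$$ $$\Sigma_2=\sum_{C\in C_{\eta\eta'}\cap(0,1)}{}_2F_1\!\left(\frac k2-\frac{2\pi i m}{\ell_\eta},\frac k2+\frac{2\pi i n}{\ell_{\eta'}};k;\frac1C\right)\frac{S^\star_{\eta\eta'}(m,n;C,1)}{C^{k/2}},$$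 $$\Sigma_3=\sum_{C\in C_{\eta\eta'}\cap(0,1)}\left(\frac C{C-1}\right)^{2\pi i n/\ell_{\eta'}}{}_2F_1\!\left(\frac k2+\frac{2\pi i m}{\ell_\eta},\frac k2+\frac{2\pi i n}{\ell_{\eta'}};k;\frac{-1}{C-1}\right)\frac{S^\star_{\eta\eta'}(m,n;C,-1)}{(C-1)^{k/2}},$$ $E_1=(a^2)^{2\pi i n/\ell_{\eta'}}$ if $\eta'\equiv\eta\bmod\Gamma$ and $n=m$, and $E_1=0$ otherwise; $E_2=(-1)^{k/2}e^{2\pi^2n/\ell_{\eta'}}(b^2)^{-2\pi i n/\ell_{\eta'}}$ if $\eta'\equiv\eta^*\bmod\Gamma$ and $n=-m$, and $E_2=0$ otherwise. The sum $\Sigma_1$ converges absolutely, and $C_{\eta\eta'}\cap(0,1)$ is finite, so $\Sigma_2$ and $\Sigma_3$ are finite sums. -/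

import Mathlib

open Complex Set Filter Topology MeasureTheory
open scoped MatrixGroups UpperHalfPlane Real

noncomputable section

namespace HypFourier

/-! ### Fuchsian groups and hyperbolic fixed pairs -/

/-- A Fuchsian group of the first kind: a discrete subgroup `Γ` of `SL(2, ℝ)` such that `Γ \ ℍ` has
finite volume for the hyperbolic measure `dx dy / y ^ 2` (which is `volume` on `ℍ`). Finite volume
of the quotient is expressed by a measurable set of finite measure meeting every `Γ`-orbit (such as
a fundamental domain). -/
structure IsFuchsianFirstKind (Γ : Subgroup SL(2, ℝ)) : Prop where
  discrete : DiscreteTopology Γ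
  finite_volume : ∃ F : Set ℍ, MeasurableSet F ∧ (∀ z : ℍ, ∃ γ ∈ Γ, γ • z ∈ F) ∧
    volume F < ⊤

/-- The action of `SL(2, ℝ)` on `ℝ ∪ {∞}` by linear fractional transformations (Mathlib has it for
`GL(2, ℝ)`). -/
def bdAct (γ : SL(2, ℝ)) (x : OnePoint ℝ) : OnePoint ℝ :=
  (γ : GL (Fin 2) ℝ) • x

/-- `η = (η₁, η₂)` is an ordered hyperbolic fixed pair for `Γ`: the two points are distinct and both
are fixed by one hyperbolic element of `Γ`. -/
def IsHyperbolicPair (Γ : Subgroup SL(2, ℝ)) (η : OnePoint ℝ × OnePoint ℝ) : Prop :=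
  η.1 ≠ η.2 ∧ ∃ γ ∈ Γ, (γ : Matrix (Fin 2) (Fin 2) ℝ).IsHyperbolic ∧
    bdAct γ η.1 = η.1 ∧ bdAct γ η.2 = η.2

/-- The subgroup `Γ_η` of the elements of `Γ` fixing both points of the pair `η`. -/
def pairStab (Γ : Subgroup SL(2, ℝ)) (η : OnePoint ℝ × OnePoint ℝ) : Subgroup Γ :=
  ((MulAction.stabilizer (GL (Fin 2) ℝ) η.1 ⊓ MulAction.stabilizer (GL (Fin 2) ℝ) η.2).comap
    Matrix.SpecialLinearGroup.toGL).subgroupOf Γ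

/-- `σ` is a scaling matrix for the pair `η`: `σ 0 = η₁` and `σ ∞ = η₂`. -/
def IsScaling (η : OnePoint ℝ × OnePoint ℝ) (σ : SL(2, ℝ)) : Prop :=
  bdAct σ ((0 : ℝ) : OnePoint ℝ) = η.1 ∧ bdAct σ OnePoint.infty = η.2

/-- The length `ℓ_η`: the least translation length of a hyperbolic element of `Γ_η`, that is, the
translation length of a generator of `Γ_η` modulo `± I`. (A hyperbolic `γ` translates by the `ℓ > 0`
with `|tr γ| = 2 cosh (ℓ / 2)`, being conjugate to `± diag (e ^ (ℓ / 2), e ^ (-ℓ / 2))`.) -/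
def pairLength (Γ : Subgroup SL(2, ℝ)) (η : OnePoint ℝ × OnePoint ℝ) : ℝ :=
  sInf {ℓ : ℝ | 0 < ℓ ∧ ∃ γ ∈ pairStab Γ η,
    |Matrix.trace ((γ : SL(2, ℝ)) : Matrix (Fin 2) (Fin 2) ℝ)| = 2 * Real.cosh (ℓ / 2)}

/-- `η' ≡ η mod Γ` for ordered pairs. -/
def PairEquiv (Γ : Subgroup SL(2, ℝ)) (η' η : OnePoint ℝ × OnePoint ℝ) : Prop :=
  ∃ γ ∈ Γ, bdAct γ η'.1 = η.1 ∧ bdAct γ η'.2 = η.2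

/-! ### Hyperbolic Fourier expansions and hyperbolic Poincaré series -/

/-- The function `z ^ (-k/2 + 2 π i m / ℓ)` on `ℍ`, with the principal branch. -/
def hypMonomial (k : ℕ) (ℓ : ℝ) (m : ℤ) (z : ℍ) : ℂ :=
  (z : ℂ) ^ (-(k : ℂ) / 2 + 2 * π * I * m / ℓ)

/-- `c : ℤ → ℂ` is the sequence of coefficients of the hyperbolic Fourier expansion of weight `k` of
`f` at a pair with scaling matrix `σ` and length `ℓ`:
`(f |_k σ)(z) = ∑_{n ∈ ℤ} c n z ^ (-k/2 + 2 π i n / ℓ)` for all `z ∈ ℍ`. Here `f |_k γ`, the function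
`z ↦ (c z + d) ^ (-k) f (γ z)` for `γ = (a b; c d)` of determinant one, is Mathlib's slash action
`SlashAction.map k γ f`. -/
def IsHypExpansion (k : ℕ) (ℓ : ℝ) (σ : SL(2, ℝ)) (f : ℍ → ℂ) (c : ℤ → ℂ) : Prop :=
  ∀ z : ℍ, HasSum (fun n : ℤ => c n * hypMonomial k ℓ n z)
    (SlashAction.map (k : ℤ) (σ : GL (Fin 2) ℝ) f z)

/-- The coset space `Γ_η \ Γ`. -/
abbrev RightCosets (Γ : Subgroup SL(2, ℝ)) (η : OnePoint ℝ × OnePoint ℝ) : Type :=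
  Quotient (QuotientGroup.rightRel (pairStab Γ η))

/-- The term `(z ^ (-k/2 + 2 π i m / ℓ_η) |_k σ_η⁻¹ γ)(z)` of the hyperbolic Poincaré series, for a
representative `γ` of a coset in `Γ_η \ Γ` (for even `k` it does not depend on the
representative). -/
def poincareTerm (k : ℕ) (Γ : Subgroup SL(2, ℝ)) (η : OnePoint ℝ × OnePoint ℝ) (σ : SL(2, ℝ))
    (m : ℤ) (z : ℍ) (q : RightCosets Γ η) : ℂ :=
  SlashAction.map (k : ℤ) ((σ⁻¹ * (q.out : SL(2, ℝ)) : SL(2, ℝ)) : GL (Fin 2) ℝ)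
    (hypMonomial k (pairLength Γ η) m) z

/-- The hyperbolic Poincaré series `P_{η,m}` of weight `k`. -/
def hypPoincare (k : ℕ) (Γ : Subgroup SL(2, ℝ)) (η : OnePoint ℝ × OnePoint ℝ) (σ : SL(2, ℝ))
    (m : ℤ) (z : ℍ) : ℂ :=
  ∑' q : RightCosets Γ η, poincareTerm k Γ η σ m z q

/-! ### The principal branch of the hypergeometric function and the beta function -/

open Classical in
/-- The analytic continuation of the Gauss series `₂F₁(a, b; c; x)`, `|x| < 1`, to the plane cut
along `[1, ∞)`. -/
def hyp2F1Cut (a b c : ℂ) : ℂ → ℂ :=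
  if h : ∃ F : ℂ → ℂ, AnalyticOnNhd ℂ F {x | 1 - x ∈ slitPlane} ∧
      ∀ x : ℂ, ‖x‖ < 1 → F x = ₂F₁ a b c x
  then h.choose else 0

open Classical in
/-- The principal value of `₂F₁(a, b; c; x)`, with the convention `-π < arg (1 - x) ≤ π`: the
continuation of the Gauss series off the cut, and on the cut the boundary value for which
`arg (1 - x)` tends to `π`, i.e. the limit from the lower half-plane in the variable `x`. -/
def hyp2F1 (a b c x : ℂ) : ℂ :=
  if 1 - x ∈ slitPlane then hyp2F1Cut a b c x
  else limUnder (𝓝[{w : ℂ | w.im < 0}] x) (hyp2F1Cut a b c)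

/-- The beta function. -/
def betaFn (u v : ℂ) : ℂ := Gamma u * Gamma v / Gamma (u + v)

/-! ### Kloosterman sums -/

/-- The double coset space `Γ_η \ Γ / Γ_η'`. -/
abbrev DblCosets (Γ : Subgroup SL(2, ℝ)) (η η' : OnePoint ℝ × OnePoint ℝ) : Type :=
  DoubleCoset.Quotient (pairStab Γ η : Set Γ) (pairStab Γ η' : Set Γ)

/-- The matrix `σ_η⁻¹ γ σ_η'` for a representative `γ` of a double coset. -/
def dblMatrix {Γ : Subgroup SL(2, ℝ)} {η η' : OnePoint ℝ × OnePoint ℝ} (σ σ' : SL(2, ℝ))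
    (q : DblCosets Γ η η') : Matrix (Fin 2) (Fin 2) ℝ :=
  ((σ⁻¹ * ((Quotient.out q : Γ) : SL(2, ℝ)) * σ' : SL(2, ℝ)) : Matrix (Fin 2) (Fin 2) ℝ)

/-- The set `C_{ηη'}` of the products `ad` for `(a b; c d) ∈ σ_η⁻¹ Γ σ_η'` with `abcd ≠ 0`. -/
def cSet (Γ : Subgroup SL(2, ℝ)) (σ σ' : SL(2, ℝ)) : Set ℝ :=
  {C | ∃ γ ∈ Γ, ∃ a b c d : ℝ,
    ((σ⁻¹ * γ * σ' : SL(2, ℝ)) : Matrix (Fin 2) (Fin 2) ℝ) = !![a, b; c, d] ∧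
    a * b * c * d ≠ 0 ∧ C = a * d}

/-- The double cosets contributing to the Kloosterman sum: `ad = C` and `sgn (ac) = α`. (Both
conditions are independent of the representative.) -/
def kloosterIndex (Γ : Subgroup SL(2, ℝ)) (η η' : OnePoint ℝ × OnePoint ℝ) (σ σ' : SL(2, ℝ))
    (C : ℝ) (α : SignType) : Set (DblCosets Γ η η') :=
  {q | dblMatrix σ σ' q 0 0 * dblMatrix σ σ' q 1 1 = C ∧
    SignType.sign (dblMatrix σ σ' q 0 0 * dblMatrix σ σ' q 1 0) = α}

/-- The Kloosterman sum `S*_{ηη'}(m, n; C, α)`: the sum over the double cosets above, with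
`(a b; c d) = σ_η⁻¹ γ σ_η'`, of `e ((m / ℓ_η) log (a / c) + (n / ℓ_η') log (-c / d))`, where
`e (z) = exp (2 π i z)` and the logarithms are principal. (Each term is independent of the
representative `γ`.) -/
def kloosterman (Γ : Subgroup SL(2, ℝ)) (η η' : OnePoint ℝ × OnePoint ℝ) (σ σ' : SL(2, ℝ))
    (m n : ℤ) (C : ℝ) (α : SignType) : ℂ :=
  ∑ᶠ q ∈ kloosterIndex Γ η η' σ σ' C α,
    Complex.exp (2 * π * I *
      ((m : ℂ) / (pairLength Γ η : ℂ) *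
          Complex.log ((dblMatrix σ σ' q 0 0 / dblMatrix σ σ' q 1 0 : ℝ) : ℂ) +
        (n : ℂ) / (pairLength Γ η' : ℂ) *
          Complex.log ((-dblMatrix σ σ' q 1 0 / dblMatrix σ σ' q 1 1 : ℝ) : ℂ)))

/-! ### The three sums -/

/-- The summand of the first sum. -/
def term₁ (k : ℕ) (Γ : Subgroup SL(2, ℝ)) (η η' : OnePoint ℝ × OnePoint ℝ) (σ σ' : SL(2, ℝ))
    (m n : ℤ) (C : ℝ) : ℂ :=
  hyp2F1 ((k : ℂ) / 2 - 2 * π * I * m / pairLength Γ η)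
      ((k : ℂ) / 2 + 2 * π * I * n / pairLength Γ η') k (1 / (C : ℂ)) *
    ((kloosterman Γ η η' σ σ' m n C 1 + kloosterman Γ η η' σ σ' m n C (-1)) /
      (C : ℂ) ^ (k / 2))

/-- The summand of the second sum. -/
def term₂ (k : ℕ) (Γ : Subgroup SL(2, ℝ)) (η η' : OnePoint ℝ × OnePoint ℝ) (σ σ' : SL(2, ℝ))
    (m n : ℤ) (C : ℝ) : ℂ :=
  hyp2F1 ((k : ℂ) / 2 - 2 * π * I * m / pairLength Γ η)
      ((k : ℂ) / 2 + 2 * π * I * n / pairLength Γ η') k (1 / (C : ℂ)) *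
    (kloosterman Γ η η' σ σ' m n C 1 / (C : ℂ) ^ (k / 2))

/-- The summand of the third sum. -/
def term₃ (k : ℕ) (Γ : Subgroup SL(2, ℝ)) (η η' : OnePoint ℝ × OnePoint ℝ) (σ σ' : SL(2, ℝ))
    (m n : ℤ) (C : ℝ) : ℂ :=
  ((C / (C - 1) : ℝ) : ℂ) ^ (2 * π * I * n / pairLength Γ η') *
    hyp2F1 ((k : ℂ) / 2 + 2 * π * I * m / pairLength Γ η)
      ((k : ℂ) / 2 + 2 * π * I * n / pairLength Γ η') k (-1 / ((C : ℂ) - 1)) *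
    (kloosterman Γ η η' σ σ' m n C (-1) / ((C : ℂ) - 1) ^ (k / 2))

/-- The sum over `C ∈ C_{ηη'}`, `C ∉ (0, 1)`. -/
def sum₁ (k : ℕ) (Γ : Subgroup SL(2, ℝ)) (η η' : OnePoint ℝ × OnePoint ℝ) (σ σ' : SL(2, ℝ))
    (m n : ℤ) : ℂ :=
  ∑' C : ↥(cSet Γ σ σ' \ Ioo 0 1), term₁ k Γ η η' σ σ' m n C

/-- The finite sum over `C ∈ C_{ηη'} ∩ (0, 1)` with sign `1`. -/
def sum₂ (k : ℕ) (Γ : Subgroup SL(2, ℝ)) (η η' : OnePoint ℝ × OnePoint ℝ) (σ σ' : SL(2, ℝ))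
    (m n : ℤ) : ℂ :=
  ∑ᶠ C ∈ cSet Γ σ σ' ∩ Ioo 0 1, term₂ k Γ η η' σ σ' m n C

/-- The finite sum over `C ∈ C_{ηη'} ∩ (0, 1)` with sign `-1`. -/
def sum₃ (k : ℕ) (Γ : Subgroup SL(2, ℝ)) (η η' : OnePoint ℝ × OnePoint ℝ) (σ σ' : SL(2, ℝ))
    (m n : ℤ) : ℂ :=
  ∑ᶠ C ∈ cSet Γ σ σ' ∩ Ioo 0 1, term₃ k Γ η η' σ σ' m n C

/-! ### The extra terms -/

/-- The nonzero real numbers `a` and `b` record the degenerate double cosets: if `η' ≡ η mod Γ` then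
`σ_η (a 0; 0 1/a) σ_η'⁻¹ ∈ Γ`, and if `η' ≡ η* mod Γ` then `σ_η (0 b; -1/b 0) σ_η'⁻¹ ∈ Γ`, where
`η* = (η₂, η₁)`. -/
structure IsTransition (Γ : Subgroup SL(2, ℝ)) (η η' : OnePoint ℝ × OnePoint ℝ)
    (σ σ' : SL(2, ℝ)) (a b : ℝ) : Prop where
  a_ne_zero : a ≠ 0
  b_ne_zero : b ≠ 0
  diag : PairEquiv Γ η' η → ∃ γ ∈ Γ,
    ((σ⁻¹ * γ * σ' : SL(2, ℝ)) : Matrix (Fin 2) (Fin 2) ℝ) = !![a, 0; 0, 1 / a]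
  antidiag : PairEquiv Γ η' η.swap → ∃ γ ∈ Γ,
    ((σ⁻¹ * γ * σ' : SL(2, ℝ)) : Matrix (Fin 2) (Fin 2) ℝ) = !![0, b; -1 / b, 0]

open Classical in
/-- The extra term for `η' ≡ η mod Γ` and `n = m`. -/
def extraDiag (Γ : Subgroup SL(2, ℝ)) (η η' : OnePoint ℝ × OnePoint ℝ) (a : ℝ) (m n : ℤ) : ℂ :=
  if PairEquiv Γ η' η ∧ n = m then
    ((a ^ 2 : ℝ) : ℂ) ^ (2 * π * I * n / pairLength Γ η') else 0

open Classical in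
/-- The extra term for `η' ≡ η* mod Γ` and `n = -m`. -/
def extraAntidiag (k : ℕ) (Γ : Subgroup SL(2, ℝ)) (η η' : OnePoint ℝ × OnePoint ℝ) (b : ℝ)
    (m n : ℤ) : ℂ :=
  if PairEquiv Γ η' η.swap ∧ n = -m then
    (-1) ^ (k / 2) * Complex.exp (2 * π ^ 2 * n / pairLength Γ η') *
      ((b ^ 2 : ℝ) : ℂ) ^ (-(2 * π * I * n / pairLength Γ η')) else 0

end HypFourier

end

open Complex Set Filter Topology MeasureTheory
open scoped MatrixGroups UpperHalfPlane Real

noncomputable section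

namespace HypFourier

/-! Write k = 2j. In the coordinate z = e^w the upper half-plane becomes the strip 0 < im w < π,
multiplication by z^j removes the weight, and Γ_η' acts by translations through multiples of ℓ_η'. A
hyperbolic expansion is thus the ordinary Fourier expansion of a periodic holomorphic function on
the strip (`hasSum_stripCoeff`, `stripCoeff_unique`), and its coefficients are integrals over one
period of the line im w = π/2.

Convergence comes from discreteness. The translates of a ball overlap with bounded multiplicity, so
∑ ‖γ‖⁻⁴ converges (`summable_inv_sqSum_sq`); balancing the two rows of a coset representative turns
this into a summable majorant on Γ_η \ Γ (`summable_inv_rowProd`), which dominates the terms because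
j ≥ 2. The series may therefore be integrated term by term (`hasSum_stripCoeff_hypTerm`).

Discreteness also prevents two hyperbolic fixed pairs from sharing exactly one point, so a matrix of
σ_η⁻¹ Γ σ_η' has only nonzero entries, or is diagonal, or is antidiagonal (`entries_trichotomy`).
The last two kinds fill at most one coset each and contribute a single exponential: these are E₁ and
E₂. For nonzero entries, Γ_η' modulo ± I acts freely on the cosets inside a double coset, and the
period integrals join into an integral over the whole line (`tsum_rightCosets`,
`tsum_stripCoeff_right`).

After a translation w = v + δ this is Euler's integral for ₂F₁ in the variable t = 1 / (1 + e^v).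
The choice e^δ = d/c gives the argument 1/(ad), on the line im v = π/2 or -π/2 according to the sign
of c/d. If 1/(ad) < 1, either line can be moved to the real axis. If 0 < ad < 1, the argument is on
the cut; the upper line, which occurs for ac > 0, gives the limit from the lower half-plane, that
is, the principal value. For ac < 0 the choice e^δ = b/a is made instead: it keeps the upper line
and gives the argument -1/(ad - 1). This is why the sum splits into three (`lineIntegral_eq_right`,
`lineIntegral_eq_left`). Grouping double cosets by ad and sgn(ac) then produces the Kloosterman sums
(`tsum_nondegCosets`, `fiberTerm_eq`). -/

/-! ### Discrete subgroups of `SL(2, ℝ)` -/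

/-- The sum of the squares of the entries of a matrix. -/
def sqSum (g : SL(2, ℝ)) : ℝ := g 0 0 ^ 2 + g 0 1 ^ 2 + g 1 0 ^ 2 + g 1 1 ^ 2

lemma det_entries (g : SL(2, ℝ)) : g 0 0 * g 1 1 - g 0 1 * g 1 0 = 1 := by
  have := g.det_coe
  rwa [Matrix.det_fin_two] at this

lemma mul_entries (g h : SL(2, ℝ)) (i j : Fin 2) :
    (g * h) i j = g i 0 * h 0 j + g i 1 * h 1 j := by
  simp [Matrix.SpecialLinearGroup.coe_mul, Matrix.mul_apply, Fin.sum_univ_two]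

lemma inv_entries (g : SL(2, ℝ)) :
    g⁻¹ 0 0 = g 1 1 ∧ g⁻¹ 0 1 = -g 0 1 ∧ g⁻¹ 1 0 = -g 1 0 ∧ g⁻¹ 1 1 = g 0 0 := by
  simp [Matrix.SpecialLinearGroup.coe_inv, Matrix.adjugate_fin_two]

/-- Cauchy–Schwarz, applied to each entry of the product. -/
lemma sqSum_mul_le (g h : SL(2, ℝ)) : sqSum (g * h) ≤ sqSum g * sqSum h := by
  simp only [sqSum, mul_entries]
  nlinarith [sq_nonneg (g 0 0 * h 1 0 - g 0 1 * h 0 0), sq_nonneg (g 0 0 * h 1 1 - g 0 1 * h 0 1),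
    sq_nonneg (g 1 0 * h 1 0 - g 1 1 * h 0 0), sq_nonneg (g 1 0 * h 1 1 - g 1 1 * h 0 1)]

lemma sqSum_inv (g : SL(2, ℝ)) : sqSum g⁻¹ = sqSum g := by
  obtain ⟨h1, h2, h3, h4⟩ := inv_entries g
  simp only [sqSum, h1, h2, h3, h4]
  ring

lemma two_le_sqSum (g : SL(2, ℝ)) : 2 ≤ sqSum g := by
  have := det_entries g
  unfold sqSum
  nlinarith [sq_nonneg (g 0 0 - g 1 1), sq_nonneg (g 0 1 + g 1 0)]

lemma sqSum_pos (g : SL(2, ℝ)) : 0 < sqSum g := by linarith [two_le_sqSum g]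

/-! ### Packing the upper half-plane by translates of a ball -/

/-- The function `(y / (1 + |z|²))²` on the upper half-plane. -/
def coshWeight (z : ℍ) : ℝ := (z.im / (1 + ‖(z : ℂ)‖ ^ 2)) ^ 2

/-- If d is the hyperbolic distance from i to z, then (1 + |z|²) / y = 2 cosh d, and for z = g i
this is the squared Frobenius norm of g. -/
lemma coshWeight_smul_I (g : SL(2, ℝ)) :
    coshWeight (g • UpperHalfPlane.I) = (sqSum g ^ 2)⁻¹ := by
  have hd := det_entries g
  have hz : ((g • UpperHalfPlane.I : ℍ) : ℂ) =
      (g 0 0 * Complex.I + g 0 1) / (g 1 0 * Complex.I + g 1 1) := by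
    rw [UpperHalfPlane.coe_specialLinearGroup_apply]; simp
  have hn : ∀ a b : ℝ, ‖(a * Complex.I + b : ℂ)‖ ^ 2 = a ^ 2 + b ^ 2 := by
    intro a b
    rw [← Complex.normSq_eq_norm_sq, Complex.normSq_apply]; simp; ring
  have hcd : 0 < g 1 0 ^ 2 + g 1 1 ^ 2 := by
    by_contra h
    have h1 : g 1 0 = 0 := by nlinarith [sq_nonneg (g 1 0), sq_nonneg (g 1 1)]
    have h2 : g 1 1 = 0 := by nlinarith [sq_nonneg (g 1 0), sq_nonneg (g 1 1)]
    rw [h1, h2] at hd; norm_num at hd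
  have him : (g • UpperHalfPlane.I : ℍ).im = 1 / (g 1 0 ^ 2 + g 1 1 ^ 2) := by
    change ((g • UpperHalfPlane.I : ℍ) : ℂ).im = _
    rw [hz, Complex.div_im]
    have h3 : Complex.normSq (g 1 0 * Complex.I + g 1 1 : ℂ) = g 1 0 ^ 2 + g 1 1 ^ 2 := by
      rw [Complex.normSq_apply]; simp; ring
    rw [h3]; simp
    field_simp
    linarith
  have hq : ‖((g • UpperHalfPlane.I : ℍ) : ℂ)‖ ^ 2 =
      (g 0 0 ^ 2 + g 0 1 ^ 2) / (g 1 0 ^ 2 + g 1 1 ^ 2) := by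
    rw [hz, norm_div, div_pow, hn, hn]
  rw [coshWeight, him, hq, ← inv_pow]
  congr 1
  unfold sqSum
  have : g 0 0 ^ 2 + g 0 1 ^ 2 + g 1 0 ^ 2 + g 1 1 ^ 2 ≠ 0 := (sqSum_pos g).ne'
  field_simp
  ring

/-- The density y⁻² of the hyperbolic measure cancels the numerator y², leaving (1 + |z|²)⁻², which
is integrable over the plane. -/
lemma lintegral_coshWeight_lt_top :
    ∫⁻ z : ℍ, ENNReal.ofReal (coshWeight z) < ⊤ := by
  have key : ∀ z : ℍ, ENNReal.ofReal (coshWeight z) * ((1 / NNReal.mk z.im z.im_pos.le : NNReal) ^ 2 : NNReal)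
      = ENNReal.ofReal ((1 + ‖(z : ℂ)‖ ^ 2) ^ (-(4 : ℝ) / 2)) := by
    intro z
    have hz := z.im_pos
    rw [show (((1 / NNReal.mk z.im z.im_pos.le : NNReal) ^ 2 : NNReal) : ENNReal)
      = ENNReal.ofReal ((1 / z.im) ^ 2) by
        rw [ENNReal.ofReal, Real.toNNReal_of_nonneg (by positivity)]; congr 1,
      ← ENNReal.ofReal_mul (by unfold coshWeight; positivity)]
    congr 1
    rw [show (-(4 : ℝ) / 2) = ((-2 : ℤ) : ℝ) by norm_num, Real.rpow_intCast, zpow_neg]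
    unfold coshWeight
    have : (1 + ‖(z : ℂ)‖ ^ 2) ≠ 0 := by positivity
    field_simp
  have hm : Measurable fun z : ℍ =>
      (((1 / NNReal.mk z.im z.im_pos.le : NNReal) ^ 2 : NNReal) : ENNReal) := by
    have : Measurable fun z : ℍ => ENNReal.ofReal ((1 / z.im) ^ 2) := by
      have h1 : Measurable fun z : ℍ => z.im := UpperHalfPlane.continuous_im.measurable
      fun_prop
    convert this using 2 with z
    rw [ENNReal.ofReal, Real.toNNReal_of_nonneg (by positivity)]; congr 1
  have hm2 : Measurable fun z : ℍ => ENNReal.ofReal (coshWeight z) := by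
    have h1 : Measurable fun z : ℍ => z.im := UpperHalfPlane.continuous_im.measurable
    have h2 := UpperHalfPlane.measurable_coe
    unfold coshWeight
    fun_prop
  rw [UpperHalfPlane.volume_def, lintegral_withDensity_eq_lintegral_mul _ hm hm2]
  have : ∀ z : ℍ, ((fun z : ℍ => (((1 / NNReal.mk z.im z.im_pos.le : NNReal) ^ 2 : NNReal) : ENNReal)) *
      fun z : ℍ => ENNReal.ofReal (coshWeight z)) z
      = (fun w : ℂ => ENNReal.ofReal ((1 + ‖w‖ ^ 2) ^ (-(4 : ℝ) / 2))) z := by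
    intro z
    rw [Pi.mul_apply, mul_comm]
    exact key z
  rw [lintegral_congr this, ← UpperHalfPlane.measurableEmbedding_coe.lintegral_map
      (fun w : ℂ => ENNReal.ofReal ((1 + ‖w‖ ^ 2) ^ (-(4 : ℝ) / 2))),
    UpperHalfPlane.measurableEmbedding_coe.map_comap]
  refine (setLIntegral_le_lintegral _ _).trans_lt ?_
  have := integrable_rpow_neg_one_add_norm_sq (E := ℂ) (μ := volume) (r := 4)
    (by rw [Complex.finrank_real_complex]; norm_num)
  exact this.lintegral_lt_top

lemma volume_closedBall_pos : 0 < volume (Metric.closedBall UpperHalfPlane.I 1) := by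
  have ho : IsOpen (UpperHalfPlane.coe '' Metric.ball UpperHalfPlane.I 1) :=
    UpperHalfPlane.isOpenEmbedding_coe.isOpenMap _ Metric.isOpen_ball
  refine lt_of_lt_of_le ?_ (measure_mono Metric.ball_subset_closedBall)
  rw [UpperHalfPlane.volume_eq_lintegral, pos_iff_ne_zero]
  intro h
  rw [lintegral_eq_zero_iff (by fun_prop)] at h
  have h2 : (volume.restrict (UpperHalfPlane.coe '' Metric.ball UpperHalfPlane.I 1)) univ = 0 := by
    refine measure_mono_null ?_
      (show _ = (0 : ENNReal) from measure_union_null (ae_iff.mp h)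
        (ae_iff.mp (ae_restrict_mem ho.measurableSet)))
    intro z _
    by_cases hz : z ∈ UpperHalfPlane.coe '' Metric.ball UpperHalfPlane.I 1
    · left
      obtain ⟨w, -, rfl⟩ := hz
      have := w.im_pos
      simp [this.ne']
    · right; exact hz
  rw [Measure.restrict_apply_univ] at h2
  exact (ho.measure_pos volume ⟨_, UpperHalfPlane.I, by simp, rfl⟩).ne' h2

variable {Γ : Subgroup SL(2, ℝ)}

/-- Write w = h i. Submultiplicativity of the norm compares the weights at g h i and g i up to the
weight at w, whose minimum over the compact ball is the constant. -/
lemma exists_coshWeight_ge : ∃ A : ℝ, 0 < A ∧ ∀ w ∈ Metric.closedBall UpperHalfPlane.I 1,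
    ∀ g : SL(2, ℝ), A * (sqSum g ^ 2)⁻¹ ≤ coshWeight (g • w) := by
  have hc : Continuous coshWeight := by
    have := UpperHalfPlane.continuous_im
    have := UpperHalfPlane.continuous_coe
    unfold coshWeight
    refine ((by fun_prop : Continuous fun z : ℍ => z.im).div (by fun_prop) fun z => ?_).pow 2
    positivity
  obtain ⟨w₀, -, hw₀⟩ := (isCompact_closedBall UpperHalfPlane.I 1).exists_isMinOn
    ⟨_, Metric.mem_closedBall_self zero_le_one⟩ hc.continuousOn
  have hpos : 0 < coshWeight w₀ := by
    have := w₀.im_pos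
    unfold coshWeight; positivity
  refine ⟨_, hpos, fun w hw g => ?_⟩
  have h1 : coshWeight w₀ ≤ coshWeight w := hw₀ hw
  have h2 : coshWeight w = (sqSum w.toSL2R ^ 2)⁻¹ := by
    rw [← coshWeight_smul_I, UpperHalfPlane.toSL2R_smul_I]
  have h3 : coshWeight (g • w) = (sqSum (g * w.toSL2R) ^ 2)⁻¹ := by
    rw [← coshWeight_smul_I, mul_smul, UpperHalfPlane.toSL2R_smul_I]
  rw [h3]
  calc coshWeight w₀ * (sqSum g ^ 2)⁻¹ ≤ coshWeight w * (sqSum g ^ 2)⁻¹ := by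
        gcongr
    _ = ((sqSum g * sqSum w.toSL2R) ^ 2)⁻¹ := by rw [h2, mul_pow, mul_inv, mul_comm]
    _ ≤ _ := by
        have := sqSum_mul_le g w.toSL2R
        have := sqSum_pos (g * w.toSL2R)
        gcongr

/-- The series `∑ ‖γ‖⁻⁴` converges for a discrete subgroup of `SL(2, ℝ)`. -/
theorem summable_inv_sqSum_sq [DiscreteTopology Γ] :
    Summable fun γ : Γ => (sqSum (γ : SL(2, ℝ)) ^ 2)⁻¹ := by
  obtain ⟨A, hA, hAw⟩ := exists_coshWeight_ge
  set B := Metric.closedBall UpperHalfPlane.I 1 with hB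
  have hBc : IsCompact B := isCompact_closedBall _ _
  have hBm : MeasurableSet B := Metric.isClosed_closedBall.measurableSet
  have : Countable Γ := by
    have : SecondCountableTopology (Matrix (Fin 2) (Fin 2) ℝ) :=
      inferInstanceAs (SecondCountableTopology (Fin 2 → Fin 2 → ℝ))
    have : SecondCountableTopology SL(2, ℝ) :=
      Topology.IsEmbedding.secondCountableTopology
        Matrix.SpecialLinearGroup.isClosedEmbedding_val.isEmbedding
    exact countable_of_Lindelof_of_discrete
  have hfin : {γ : Γ | ((γ • ·) '' B ∩ B).Nonempty}.Finite := by
    have := ProperlyDiscontinuousSMul.finite_disjoint_inter_image (Γ := Γ) hBc hBc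
    simpa [Set.nonempty_iff_ne_empty] using this
  set n := hfin.toFinset.card
  have hmeas : ∀ γ : Γ, MeasurableEmbedding (fun z : ℍ => γ • z) := fun γ =>
    (Homeomorph.smul γ).measurableEmbedding
  have hmp : ∀ γ : Γ, MeasurePreserving (fun z : ℍ => γ • z) volume volume := fun γ => by
    exact measurePreserving_smul ((γ : SL(2, ℝ)) : GL (Fin 2) ℝ) (volume : Measure ℍ)
  have hW : Measurable fun z : ℍ => ENNReal.ofReal (coshWeight z) := by
    have h1 : Measurable fun z : ℍ => z.im := UpperHalfPlane.continuous_im.measurable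
    have h2 := UpperHalfPlane.measurable_coe
    unfold coshWeight
    fun_prop
  -- Each term is controlled by the integral of the weight over the translate γB.
  have hle : ∀ γ : Γ, ENNReal.ofReal (A * (sqSum (γ : SL(2, ℝ)) ^ 2)⁻¹) * volume B ≤
      ∫⁻ z, ((fun z : ℍ => γ • z) '' B).indicator (fun z => ENNReal.ofReal (coshWeight z)) z := by
    intro γ
    have him : MeasurableSet ((fun z : ℍ => γ • z) '' B) := (hmeas γ).measurableSet_image.2 hBm
    rw [lintegral_indicator him, ← (hmp γ).setLIntegral_comp_preimage_emb (hmeas γ),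
      Set.preimage_image_eq _ (hmeas γ).injective, ← setLIntegral_const]
    refine setLIntegral_mono' hBm fun w hw => ENNReal.ofReal_le_ofReal (hAw w hw γ)
  -- Bounded multiplicity: if γ₀B and γB both contain z, then γ₀⁻¹γ is one of the finitely many
  -- elements moving B to a set that meets B.
  have hcount : ∀ z : ℍ, ∑' γ : Γ, ((fun z : ℍ => γ • z) '' B).indicator
      (fun z => ENNReal.ofReal (coshWeight z)) z ≤ n * ENNReal.ofReal (coshWeight z) := by
    intro z
    have hsub : {γ : Γ | z ∈ (fun z : ℍ => γ • z) '' B}.Finite ∧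
        {γ : Γ | z ∈ (fun z : ℍ => γ • z) '' B}.ncard ≤ n := by
      rcases Set.eq_empty_or_nonempty {γ : Γ | z ∈ (fun z : ℍ => γ • z) '' B} with h | ⟨γ₀, hγ₀⟩
      · rw [h]; simp
      · have hmaps : Set.MapsTo (fun γ : Γ => γ₀⁻¹ * γ) {γ : Γ | z ∈ (fun z : ℍ => γ • z) '' B}
            {γ : Γ | ((γ • ·) '' B ∩ B).Nonempty} := by
          rintro γ ⟨w, hw, hwz⟩
          obtain ⟨w₀, hw₀, hwz₀⟩ := hγ₀
          refine ⟨w₀, ⟨w, hw, ?_⟩, hw₀⟩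
          simp only [mul_smul] at *
          rw [hwz, ← hwz₀, inv_smul_smul]
        have hinj : Set.InjOn (fun γ : Γ => γ₀⁻¹ * γ) {γ : Γ | z ∈ (fun z : ℍ => γ • z) '' B} :=
          fun a _ b _ h => mul_left_cancel h
        refine ⟨Set.Finite.of_injOn hmaps hinj hfin, ?_⟩
        rw [show n = {γ : Γ | ((γ • ·) '' B ∩ B).Nonempty}.ncard from
          (Set.ncard_eq_toFinset_card _ hfin).symm]
        exact Set.ncard_le_ncard_of_injOn _ hmaps hinj hfin
    obtain ⟨hf, hn⟩ := hsub
    rw [tsum_eq_sum (s := hf.toFinset) (fun γ hγ => by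
      rw [Set.indicator_of_notMem]; simpa using hγ)]
    calc _ ≤ ∑ γ ∈ hf.toFinset, ENNReal.ofReal (coshWeight z) :=
          Finset.sum_le_sum fun γ _ => Set.indicator_le_self
            ((fun z : ℍ => γ • z) '' B) (fun z => ENNReal.ofReal (coshWeight z)) z
      _ = (hf.toFinset.card : ENNReal) * ENNReal.ofReal (coshWeight z) := by
          rw [Finset.sum_const, nsmul_eq_mul]
      _ ≤ _ := by
          gcongr
          exact (Set.ncard_eq_toFinset_card _ hf).symm.trans_le hn
  have htot : ∑' γ : Γ, ENNReal.ofReal (A * (sqSum (γ : SL(2, ℝ)) ^ 2)⁻¹) * volume B < ⊤ := by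
    calc _ ≤ ∑' γ : Γ, ∫⁻ z, ((fun z : ℍ => γ • z) '' B).indicator
            (fun z => ENNReal.ofReal (coshWeight z)) z := ENNReal.tsum_le_tsum hle
      _ = ∫⁻ z, ∑' γ : Γ, ((fun z : ℍ => γ • z) '' B).indicator
            (fun z => ENNReal.ofReal (coshWeight z)) z := by
          rw [lintegral_tsum]
          exact fun γ => (hW.indicator ((hmeas γ).measurableSet_image.2 hBm)).aemeasurable
      _ ≤ ∫⁻ z, n * ENNReal.ofReal (coshWeight z) := lintegral_mono hcount
      _ = n * ∫⁻ z, ENNReal.ofReal (coshWeight z) := lintegral_const_mul _ hW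
      _ < ⊤ := ENNReal.mul_lt_top (by simp) lintegral_coshWeight_lt_top
  rw [ENNReal.tsum_mul_right] at htot
  have h2 : ∑' γ : Γ, ENNReal.ofReal (A * (sqSum (γ : SL(2, ℝ)) ^ 2)⁻¹) ≠ ⊤ := by
    intro h
    rw [h, ENNReal.top_mul volume_closedBall_pos.ne'] at htot
    exact lt_irrefl _ htot
  have h3 : Summable fun γ : Γ => A * (sqSum (γ : SL(2, ℝ)) ^ 2)⁻¹ := by
    have := ENNReal.summable_toReal h2
    refine this.congr fun γ => ENNReal.toReal_ofReal (by positivity)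
  exact (summable_mul_left_iff hA.ne').1 h3

/-- The terms of a convergent series tend to zero along the cofinite filter. -/
lemma finite_sqSum_le [DiscreteTopology Γ] (R : ℝ) : {γ : Γ | sqSum (γ : SL(2, ℝ)) ≤ R}.Finite := by
  have h := (summable_inv_sqSum_sq (Γ := Γ)).tendsto_cofinite_zero
  rcases le_or_gt R 0 with hR | hR
  · convert Set.finite_empty
    ext γ
    simpa using hR.trans_lt (sqSum_pos (γ : SL(2, ℝ)))
  have h2 := h.eventually_lt_const (show 0 < (R ^ 2)⁻¹ by positivity)
  refine (Filter.eventually_cofinite.1 h2).subset fun γ hγ => ?_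
  simp only [mem_ofPred_eq, not_lt] at *
  have := sqSum_pos (γ : SL(2, ℝ))
  gcongr

lemma sqSum_le_conj (σ σ' g : SL(2, ℝ)) :
    sqSum g ≤ sqSum σ * sqSum σ' * sqSum (σ⁻¹ * g * σ') := by
  have h1 := sqSum_mul_le σ (σ⁻¹ * g * σ' * σ'⁻¹)
  have h2 := sqSum_mul_le (σ⁻¹ * g * σ') σ'⁻¹
  rw [show σ * (σ⁻¹ * g * σ' * σ'⁻¹) = g by group] at h1
  rw [sqSum_inv] at h2
  calc _ ≤ _ := h1
    _ ≤ sqSum σ * (sqSum (σ⁻¹ * g * σ') * sqSum σ') := by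
        gcongr
        exact (sqSum_pos σ).le
    _ = _ := by ring

lemma finite_sqSum_conj_le [DiscreteTopology Γ] (σ σ' : SL(2, ℝ)) (R : ℝ) :
    {γ : Γ | sqSum (σ⁻¹ * (γ : SL(2, ℝ)) * σ') ≤ R}.Finite := by
  refine (finite_sqSum_le (Γ := Γ) (sqSum σ * sqSum σ' * R)).subset fun γ hγ => ?_
  refine (sqSum_le_conj σ σ' γ).trans ?_
  have := sqSum_pos σ
  have := sqSum_pos σ'
  gcongr
  exact hγ

lemma summable_inv_sqSum_conj_sq [DiscreteTopology Γ] (σ σ' : SL(2, ℝ)) :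
    Summable fun γ : Γ => (sqSum (σ⁻¹ * (γ : SL(2, ℝ)) * σ') ^ 2)⁻¹ := by
  refine Summable.of_nonneg_of_le (fun γ => by positivity) (fun γ => ?_)
    ((summable_inv_sqSum_sq (Γ := Γ)).mul_left ((sqSum σ * sqSum σ') ^ 2))
  have h := sqSum_le_conj σ σ' γ
  have h1 := sqSum_pos (γ : SL(2, ℝ))
  have h2 := sqSum_pos (σ⁻¹ * (γ : SL(2, ℝ)) * σ')
  rw [← div_eq_mul_inv, ← one_div, div_le_div_iff₀ (by positivity) (by positivity), one_mul,
    ← mul_pow]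
  gcongr


/-! ### Stabilizers of hyperbolic fixed pairs -/

lemma SL2_ext {g h : SL(2, ℝ)} (h00 : g 0 0 = h 0 0) (h01 : g 0 1 = h 0 1) (h10 : g 1 0 = h 1 0)
    (h11 : g 1 1 = h 1 1) : g = h := by
  ext i j
  fin_cases i <;> fin_cases j <;> assumption

/-- The hyperbolic matrix `diag (e ^ (t / 2), e ^ (-t / 2))`. -/
def diagExp (t : ℝ) : SL(2, ℝ) :=
  ⟨!![Real.exp (t / 2), 0; 0, Real.exp (-t / 2)], by
    rw [Matrix.det_fin_two_of, ← Real.exp_add]; ring_nf; simp⟩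

@[simp] lemma diagExp_zero_zero (t : ℝ) : diagExp t 0 0 = Real.exp (t / 2) := rfl
@[simp] lemma diagExp_zero_one (t : ℝ) : diagExp t 0 1 = 0 := rfl
@[simp] lemma diagExp_one_zero (t : ℝ) : diagExp t 1 0 = 0 := rfl
@[simp] lemma diagExp_one_one (t : ℝ) : diagExp t 1 1 = Real.exp (-t / 2) := rfl

lemma diagExp_add (s t : ℝ) : diagExp (s + t) = diagExp s * diagExp t := by
  apply SL2_ext <;> simp only [mul_entries] <;> simp [← Real.exp_add] <;> ring

lemma diagExp_zero : diagExp 0 = 1 := by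
  apply SL2_ext <;> simp

lemma diagExp_neg (t : ℝ) : diagExp (-t) = (diagExp t)⁻¹ := by
  rw [eq_inv_iff_mul_eq_one, ← diagExp_add, neg_add_cancel, diagExp_zero]

lemma neg_entries (g : SL(2, ℝ)) (i j : Fin 2) : (-g) i j = -(g i j) := by
  simp [Matrix.SpecialLinearGroup.coe_neg]

lemma sqSum_neg (g : SL(2, ℝ)) : sqSum (-g) = sqSum g := by
  simp [sqSum, neg_entries]

lemma bdAct_mul (g h : SL(2, ℝ)) (x : OnePoint ℝ) : bdAct (g * h) x = bdAct g (bdAct h x) := by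
  simp [bdAct, mul_smul]

lemma bdAct_inv_eq_iff (g : SL(2, ℝ)) (x y : OnePoint ℝ) : bdAct g⁻¹ x = y ↔ x = bdAct g y := by
  simp only [bdAct, map_inv]
  exact inv_smul_eq_iff

lemma bdAct_zero_eq_zero (g : SL(2, ℝ)) :
    bdAct g ((0 : ℝ) : OnePoint ℝ) = ((0 : ℝ) : OnePoint ℝ) ↔ g 0 1 = 0 := by
  have hd := det_entries g
  simp only [bdAct, OnePoint.smul_some_eq_ite]
  simp only [Matrix.SpecialLinearGroup.toGL, mul_zero, zero_add]
  split_ifs with h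
  · simp only [OnePoint.infty_ne_coe, false_iff]
    intro h2
    change g 1 1 = 0 at h
    rw [h, h2] at hd; norm_num at hd
  · rw [OnePoint.coe_eq_coe, div_eq_zero_iff]
    exact or_iff_left h

lemma bdAct_zero_eq_infty (g : SL(2, ℝ)) :
    bdAct g ((0 : ℝ) : OnePoint ℝ) = OnePoint.infty ↔ g 1 1 = 0 := by
  simp only [bdAct, OnePoint.smul_some_eq_ite, mul_zero, zero_add]
  split_ifs with h
  · exact iff_of_true rfl h
  · exact iff_of_false (OnePoint.coe_ne_infty _) h

lemma bdAct_infty_eq_infty (g : SL(2, ℝ)) :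
    bdAct g OnePoint.infty = OnePoint.infty ↔ g 1 0 = 0 :=
  OnePoint.smul_infty_eq_self_iff

lemma bdAct_infty_eq_zero (g : SL(2, ℝ)) :
    bdAct g OnePoint.infty = ((0 : ℝ) : OnePoint ℝ) ↔ g 0 0 = 0 := by
  have hd := det_entries g
  simp only [bdAct, OnePoint.smul_infty_eq_ite]
  split_ifs with h
  · simp only [OnePoint.infty_ne_coe, false_iff]
    intro h2
    change g 1 0 = 0 at h
    rw [h, h2] at hd; norm_num at hd
  · rw [OnePoint.coe_eq_coe, div_eq_zero_iff]
    exact or_iff_left h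

section Pair

variable {Γ : Subgroup SL(2, ℝ)} {η η' : OnePoint ℝ × OnePoint ℝ} {σ σ' : SL(2, ℝ)}

lemma bdAct_pair_iff (hσ : IsScaling η σ) (hσ' : IsScaling η' σ') (γ : SL(2, ℝ)) :
    (bdAct γ η'.1 = η.1 ∧ bdAct γ η'.2 = η.2) ↔
      (σ⁻¹ * γ * σ') 0 1 = 0 ∧ (σ⁻¹ * γ * σ') 1 0 = 0 := by
  rw [← bdAct_zero_eq_zero, ← bdAct_infty_eq_infty, bdAct_mul, bdAct_mul, bdAct_mul, bdAct_mul,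
    bdAct_inv_eq_iff, bdAct_inv_eq_iff, hσ.1, hσ.2, hσ'.1, hσ'.2]

lemma bdAct_pair_swap_iff (hσ : IsScaling η σ) (hσ' : IsScaling η' σ') (γ : SL(2, ℝ)) :
    (bdAct γ η'.1 = η.2 ∧ bdAct γ η'.2 = η.1) ↔
      (σ⁻¹ * γ * σ') 1 1 = 0 ∧ (σ⁻¹ * γ * σ') 0 0 = 0 := by
  rw [← bdAct_zero_eq_infty, ← bdAct_infty_eq_zero, bdAct_mul, bdAct_mul, bdAct_mul, bdAct_mul,
    bdAct_inv_eq_iff, bdAct_inv_eq_iff, hσ.1, hσ.2, hσ'.1, hσ'.2]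

lemma mem_pairStab_iff (hσ : IsScaling η σ) (γ : Γ) : γ ∈ pairStab Γ η ↔
    (σ⁻¹ * (γ : SL(2, ℝ)) * σ) 0 1 = 0 ∧ (σ⁻¹ * (γ : SL(2, ℝ)) * σ) 1 0 = 0 :=
  bdAct_pair_iff hσ hσ γ

lemma eq_diagExp_of_diag {g : SL(2, ℝ)} (h01 : g 0 1 = 0) (h10 : g 1 0 = 0) :
    g = diagExp (2 * Real.log |g 0 0|) ∨ g = -diagExp (2 * Real.log |g 0 0|) := by
  have hd := det_entries g
  rw [h01, zero_mul, sub_zero] at hd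
  have h0 : g 0 0 ≠ 0 := by
    intro h; rw [h] at hd; norm_num at hd
  have h1 : g 1 1 = (g 0 0)⁻¹ := eq_inv_of_mul_eq_one_right hd
  have he : Real.exp (2 * Real.log |g 0 0| / 2) = |g 0 0| := by
    rw [mul_div_cancel_left₀ _ two_ne_zero, Real.exp_log (abs_pos.2 h0)]
  have he' : Real.exp (-(2 * Real.log |g 0 0|) / 2) = |g 0 0|⁻¹ := by
    rw [neg_div, Real.exp_neg, he]
  rcases lt_or_gt_of_ne h0 with h | h
  · right
    rw [abs_of_neg h] at he he' ⊢
    apply SL2_ext <;> simp only [neg_entries, diagExp_zero_zero, diagExp_zero_one,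
      diagExp_one_zero, diagExp_one_one, he, he', h01, h10, h1, neg_zero, neg_neg, inv_neg]
  · left
    rw [abs_of_pos h] at he he' ⊢
    apply SL2_ext <;> simp only [diagExp_zero_zero, diagExp_zero_one,
      diagExp_one_zero, diagExp_one_one, he, he', h01, h10, h1]

lemma conj_mul (γ δ : SL(2, ℝ)) : σ⁻¹ * (γ * δ) * σ' = (σ⁻¹ * γ * σ) * (σ⁻¹ * δ * σ') := by group

/-- The subgroup of the translation lengths (with sign) of the elements of `Γ_η`. -/
def lengthSubgroup (Γ : Subgroup SL(2, ℝ)) (η : OnePoint ℝ × OnePoint ℝ) (σ : SL(2, ℝ)) :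
    AddSubgroup ℝ where
  carrier := {t | ∃ γ ∈ pairStab Γ η, σ⁻¹ * (γ : SL(2, ℝ)) * σ = diagExp t ∨
    σ⁻¹ * (γ : SL(2, ℝ)) * σ = -diagExp t}
  zero_mem' := ⟨1, one_mem _, by left; simp [diagExp_zero]⟩
  add_mem' := by
    rintro s t ⟨γ, hγ, h⟩ ⟨δ, hδ, h'⟩
    refine ⟨γ * δ, mul_mem hγ hδ, ?_⟩
    rw [Subgroup.coe_mul, conj_mul, diagExp_add]
    rcases h with h | h <;> rcases h' with h' | h' <;> rw [h, h'] <;> simp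
  neg_mem' := by
    rintro s ⟨γ, hγ, h⟩
    refine ⟨γ⁻¹, inv_mem hγ, ?_⟩
    have h2 : σ⁻¹ * ((γ⁻¹ : Γ) : SL(2, ℝ)) * σ = (σ⁻¹ * (γ : SL(2, ℝ)) * σ)⁻¹ := by
      rw [Subgroup.coe_inv]; group
    rw [h2, diagExp_neg]
    rcases h with h | h <;> rw [h]
    · left; rfl
    · right
      rw [inv_eq_iff_mul_eq_one]
      simp

lemma exists_mem_lengthSubgroup (hσ : IsScaling η σ) {γ : Γ} (hγ : γ ∈ pairStab Γ η) :
    ∃ t ∈ lengthSubgroup Γ η σ, σ⁻¹ * (γ : SL(2, ℝ)) * σ = diagExp t ∨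
      σ⁻¹ * (γ : SL(2, ℝ)) * σ = -diagExp t := by
  obtain ⟨h01, h10⟩ := (mem_pairStab_iff hσ γ).1 hγ
  exact ⟨_, ⟨γ, hγ, eq_diagExp_of_diag h01 h10⟩, eq_diagExp_of_diag h01 h10⟩

lemma sqSum_diagExp (t : ℝ) : sqSum (diagExp t) = Real.exp t + Real.exp (-t) := by
  simp only [sqSum, diagExp_zero_zero, diagExp_zero_one, diagExp_one_zero, diagExp_one_one,
    ← Real.exp_nat_mul]
  ring_nf

lemma log_diagExp (t : ℝ) : 2 * Real.log |diagExp t 0 0| = t := by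
  rw [diagExp_zero_zero, Real.abs_exp, Real.log_exp]; ring

lemma trace_conj {γ : SL(2, ℝ)} {t : ℝ}
    (h : σ⁻¹ * γ * σ = diagExp t ∨ σ⁻¹ * γ * σ = -diagExp t) :
    |Matrix.trace (γ : Matrix (Fin 2) (Fin 2) ℝ)| = 2 * Real.cosh (t / 2) := by
  have h1 : Matrix.trace (γ : Matrix (Fin 2) (Fin 2) ℝ) =
      (σ⁻¹ * γ * σ) 0 0 + (σ⁻¹ * γ * σ) 1 1 := by
    rw [← Matrix.trace_fin_two, mul_assoc, Matrix.SpecialLinearGroup.coe_mul, Matrix.trace_mul_comm,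
      ← Matrix.SpecialLinearGroup.coe_mul]
    rw [mul_inv_cancel_right]
  rw [h1]
  have h2 : |diagExp t 0 0 + diagExp t 1 1| = 2 * Real.cosh (t / 2) := by
    rw [diagExp_zero_zero, diagExp_one_one, Real.cosh_eq, abs_of_pos (by positivity), neg_div]
    ring
  rcases h with h | h
  · rw [h, h2]
  · rw [h, neg_entries, neg_entries, ← neg_add, abs_neg, h2]

/-- A length t in (0, 1) comes from an element whose conjugate has squared norm e^t + e^(-t) ≤ e +
1. There are finitely many such elements, and each determines its length through its upper left
entry. -/
lemma finite_lengthSubgroup_Ioo [DiscreteTopology Γ] :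
    ((lengthSubgroup Γ η σ : Set ℝ) ∩ Ioo 0 1).Finite := by
  refine ((finite_sqSum_conj_le (Γ := Γ) σ σ (Real.exp 1 + 1)).image
    (fun γ : Γ => 2 * Real.log |(σ⁻¹ * (γ : SL(2, ℝ)) * σ) 0 0|)).subset ?_
  rintro t ⟨⟨γ, -, h⟩, h0, h1⟩
  have hs : sqSum (diagExp t) ≤ Real.exp 1 + 1 := by
    rw [sqSum_diagExp]
    have := Real.exp_le_exp.2 h1.le
    have := Real.exp_le_one_iff.2 (show -t ≤ 0 by linarith)
    linarith
  refine ⟨γ, ?_, ?_⟩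
  · rcases h with h | h <;> simp only [mem_ofPred_eq, h, sqSum_neg] <;> exact hs
  · rcases h with h | h <;> simp only [h, neg_entries, abs_neg] <;> exact log_diagExp t

/-- An element of length zero has trace ± 2, so it is not hyperbolic. -/
lemma exists_lengthSubgroup_ne_zero (hη : IsHyperbolicPair Γ η) (hσ : IsScaling η σ) :
    ∃ t ∈ lengthSubgroup Γ η σ, t ≠ 0 := by
  obtain ⟨-, γ, hγ, hh, h1, h2⟩ := hη
  have hm : (⟨γ, hγ⟩ : Γ) ∈ pairStab Γ η :=
    (mem_pairStab_iff hσ _).2 ((bdAct_pair_iff hσ hσ γ).1 ⟨h1, h2⟩)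
  obtain ⟨t, ht, h⟩ := exists_mem_lengthSubgroup hσ hm
  refine ⟨t, ht, ?_⟩
  rintro rfl
  have htr := trace_conj h
  rw [zero_div, Real.cosh_zero, mul_one] at htr
  simp only at htr
  rw [Matrix.IsHyperbolic, Matrix.discr_fin_two, γ.det_coe, ← sq_abs, htr] at hh
  norm_num at hh

/-- The length `ℓ_η` generates the group of translation lengths of `Γ_η`. -/
theorem lengthSubgroup_eq [DiscreteTopology Γ] (hη : IsHyperbolicPair Γ η) (hσ : IsScaling η σ) :
    0 < pairLength Γ η ∧ lengthSubgroup Γ η σ = AddSubgroup.zmultiples (pairLength Γ η) := by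
  -- The number 1 is adjoined only to make the finite set nonempty. Its minimum a leaves no length
  -- in (0, a), so the group of lengths is cyclic.
  obtain ⟨a, ha, hmin⟩ := Set.exists_min_image _ id
    ((finite_lengthSubgroup_Ioo (Γ := Γ) (η := η) (σ := σ)).insert 1) ⟨1, mem_insert _ _⟩
  have ha0 : 0 < a := by
    rcases ha with rfl | ha
    · exact one_pos
    · exact ha.2.1
  have ha1 : a ≤ 1 := hmin 1 (mem_insert _ _)
  have hdisj : Disjoint (lengthSubgroup Γ η σ : Set ℝ) (Ioo 0 a) := by
    rw [Set.disjoint_left]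
    intro t ht hta
    exact absurd (hmin t (mem_insert_of_mem _ ⟨ht, hta.1, hta.2.trans_le ha1⟩)) (not_le.2 hta.2)
  obtain ⟨b, hb⟩ := AddSubgroup.cyclic_of_isolated_zero ha0 hdisj
  rw [← AddSubgroup.zmultiples_eq_closure] at hb
  have hb0 : b ≠ 0 := by
    rintro rfl
    obtain ⟨t, ht, ht0⟩ := exists_lengthSubgroup_ne_zero hη hσ
    rw [hb] at ht
    simp at ht
    exact ht0 ht
  have hb' : lengthSubgroup Γ η σ = AddSubgroup.zmultiples |b| := by
    rw [hb]
    rcases abs_choice b with h | h <;> rw [h]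
    exact AddSubgroup.zmultiples_neg.symm
  have hl : pairLength Γ η = |b| := by
    refine IsLeast.csInf_eq ⟨⟨abs_pos.2 hb0, ?_⟩, ?_⟩
    · have : |b| ∈ lengthSubgroup Γ η σ := hb' ▸ AddSubgroup.mem_zmultiples _
      obtain ⟨γ, hγ, h⟩ := this
      exact ⟨γ, hγ, trace_conj h⟩
    · rintro l ⟨hl0, γ, hγ, hl⟩
      obtain ⟨t, ht, h⟩ := exists_mem_lengthSubgroup hσ hγ
      rw [trace_conj h] at hl
      have habs : |t| = l := by
        have h1 : Real.cosh (t / 2) = Real.cosh (l / 2) := by linarith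
        have h2 : |t / 2| = |l / 2| :=
          le_antisymm (Real.cosh_le_cosh.1 h1.le) (Real.cosh_le_cosh.1 h1.ge)
        rw [abs_div, abs_div, abs_of_pos hl0] at h2
        simpa using h2
      rw [hb] at ht
      obtain ⟨j, rfl⟩ := AddSubgroup.mem_zmultiples_iff.1 ht
      rw [← habs, zsmul_eq_mul, abs_mul]
      have hj : j ≠ 0 := by
        rintro rfl
        simp at habs
        exact hl0.ne habs
      have : (1 : ℝ) ≤ |(j : ℝ)| := by exact_mod_cast Int.one_le_abs hj
      nlinarith [abs_pos.2 hb0]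
  rw [hl]
  exact ⟨abs_pos.2 hb0, hb'⟩

lemma pairLength_pos [DiscreteTopology Γ] (hη : IsHyperbolicPair Γ η) (hσ : IsScaling η σ) :
    0 < pairLength Γ η := (lengthSubgroup_eq hη hσ).1

lemma exists_pairStab_diagExp [DiscreteTopology Γ] (hη : IsHyperbolicPair Γ η)
    (hσ : IsScaling η σ) (j : ℤ) : ∃ γ ∈ pairStab Γ η,
      σ⁻¹ * (γ : SL(2, ℝ)) * σ = diagExp (j * pairLength Γ η) ∨
      σ⁻¹ * (γ : SL(2, ℝ)) * σ = -diagExp (j * pairLength Γ η) := by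
  have : (j * pairLength Γ η : ℝ) ∈ lengthSubgroup Γ η σ := by
    rw [(lengthSubgroup_eq hη hσ).2]
    exact ⟨j, by simp⟩
  exact this

lemma exists_eq_diagExp [DiscreteTopology Γ] (hη : IsHyperbolicPair Γ η)
    (hσ : IsScaling η σ) {γ : Γ} (hγ : γ ∈ pairStab Γ η) : ∃ j : ℤ,
      σ⁻¹ * (γ : SL(2, ℝ)) * σ = diagExp (j * pairLength Γ η) ∨
      σ⁻¹ * (γ : SL(2, ℝ)) * σ = -diagExp (j * pairLength Γ η) := by
  obtain ⟨t, ht, h⟩ := exists_mem_lengthSubgroup hσ hγ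
  rw [(lengthSubgroup_eq hη hσ).2] at ht
  obtain ⟨j, rfl⟩ := AddSubgroup.mem_zmultiples_iff.1 ht
  exact ⟨j, by simpa using h⟩

/-! ### Fixed pairs of a discrete group: two common points or none -/

lemma conj_diagExp_entries (T : SL(2, ℝ)) (t : ℝ) :
    (diagExp (-t) * T * diagExp t) 0 0 = T 0 0 ∧
    (diagExp (-t) * T * diagExp t) 0 1 = Real.exp (-t) * T 0 1 ∧
    (diagExp (-t) * T * diagExp t) 1 0 = Real.exp t * T 1 0 ∧
    (diagExp (-t) * T * diagExp t) 1 1 = T 1 1 := by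
  have h1 : Real.exp (-t / 2) * Real.exp (t / 2) = 1 := by
    rw [← Real.exp_add]; ring_nf; simp
  have h2 : Real.exp (-t) = Real.exp (-t / 2) * Real.exp (-t / 2) := by
    rw [← Real.exp_add]; ring_nf
  have h3 : Real.exp t = Real.exp (t / 2) * Real.exp (t / 2) := by
    rw [← Real.exp_add]; ring_nf
  simp only [mul_entries, diagExp_zero_zero, diagExp_zero_one, diagExp_one_zero, diagExp_one_one,
    mul_zero, zero_mul, add_zero, zero_add, neg_neg, h2, h3]
  refine ⟨?_, by ring, by ring, ?_⟩
  · linear_combination T 0 0 * h1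
  · linear_combination T 1 1 * h1

/-- In a discrete group, a bounded family of conjugates by powers of a hyperbolic element is
finite, so an element with such conjugates fixes both fixed points. -/
lemma diag_of_bounded_conj [DiscreteTopology Γ] (hη : IsHyperbolicPair Γ η)
    (hσ : IsScaling η σ) (γ : Γ) (e : ℤ) (he : e ≠ 0) (R : ℝ)
    (hR : ∀ i : ℕ, sqSum (diagExp (-(i * (e * pairLength Γ η))) * (σ⁻¹ * (γ : SL(2, ℝ)) * σ) *
      diagExp (i * (e * pairLength Γ η))) ≤ R) :
    (σ⁻¹ * (γ : SL(2, ℝ)) * σ) 0 1 = 0 ∧ (σ⁻¹ * (γ : SL(2, ℝ)) * σ) 1 0 = 0 := by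
  have hl := pairLength_pos hη hσ
  set T := σ⁻¹ * (γ : SL(2, ℝ)) * σ with hT
  choose δ hδ hδ' using exists_pairStab_diagExp hη hσ
  have hconj : ∀ i : ℕ, σ⁻¹ * (((δ (i * e))⁻¹ * γ * δ (i * e) : Γ) : SL(2, ℝ)) * σ =
      diagExp (-(i * (e * pairLength Γ η))) * T * diagExp (i * (e * pairLength Γ η)) := by
    intro i
    have h1 : σ⁻¹ * (((δ (i * e))⁻¹ * γ * δ (i * e) : Γ) : SL(2, ℝ)) * σ =
        (σ⁻¹ * (δ (i * e) : SL(2, ℝ)) * σ)⁻¹ * T * (σ⁻¹ * (δ (i * e) : SL(2, ℝ)) * σ) := by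
      rw [hT]; push_cast; group
    have h2 : (i * (e * pairLength Γ η) : ℝ) = ((i * e : ℤ) : ℝ) * pairLength Γ η := by
      push_cast; ring
    rw [h1, h2, diagExp_neg]
    rcases hδ' (i * e) with h | h <;> rw [h]
    have : (-diagExp (((i * e : ℤ) : ℝ) * pairLength Γ η))⁻¹ =
        -(diagExp (((i * e : ℤ) : ℝ) * pairLength Γ η))⁻¹ := by
      rw [inv_eq_iff_mul_eq_one]; simp
    rw [this]
    simp
  by_contra hcon
  have hfin := finite_sqSum_conj_le (Γ := Γ) σ σ R
  -- A nonzero off-diagonal entry is multiplied by a different power of e at each step, so the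
  -- conjugates are pairwise distinct, against the finiteness of `hfin`.
  have hinj : Function.Injective fun i : ℕ => (δ (i * e))⁻¹ * γ * δ (i * e) := by
    intro i j hij
    have h1 := hconj i
    rw [show ((δ (i * e))⁻¹ * γ * δ (i * e) : Γ) = (δ (j * e))⁻¹ * γ * δ (j * e) from hij,
      hconj j] at h1
    obtain ⟨-, a1, a2, -⟩ := conj_diagExp_entries T (i * (e * pairLength Γ η))
    obtain ⟨-, b1, b2, -⟩ := conj_diagExp_entries T (j * (e * pairLength Γ η))
    have he' : (e : ℝ) * pairLength Γ η ≠ 0 := mul_ne_zero (by exact_mod_cast he) hl.ne'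
    rw [not_and_or] at hcon
    rcases hcon with hc | hc
    · rw [h1, a1] at b1
      have := Real.exp_injective (mul_right_cancel₀ hc b1)
      have := mul_right_cancel₀ he' (neg_injective this)
      exact_mod_cast this
    · rw [h1, a2] at b2
      have := Real.exp_injective (mul_right_cancel₀ hc b2)
      have := mul_right_cancel₀ he' this
      exact_mod_cast this
  refine Set.infinite_range_of_injective hinj (hfin.subset ?_)
  rintro _ ⟨i, rfl⟩
  simp only [mem_ofPred_eq]
  rw [hconj]
  exact hR i

/-- If only one off-diagonal entry survives, conjugating by powers of the hyperbolic element in the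
contracting direction keeps the norm bounded, and `diag_of_bounded_conj` applies. Hence an element
of Γ fixing one point of the pair fixes both. -/
lemma entry_zero_one_iff [DiscreteTopology Γ] (hη : IsHyperbolicPair Γ η)
    (hσ : IsScaling η σ) (γ : Γ) :
    (σ⁻¹ * (γ : SL(2, ℝ)) * σ) 0 1 = 0 ↔ (σ⁻¹ * (γ : SL(2, ℝ)) * σ) 1 0 = 0 := by
  have hl := pairLength_pos hη hσ
  have key : ∀ (T : SL(2, ℝ)) (t : ℝ), (T 1 0 = 0 → 0 ≤ t → sqSum (diagExp (-t) * T * diagExp t) ≤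
      sqSum T) ∧ (T 0 1 = 0 → t ≤ 0 → sqSum (diagExp (-t) * T * diagExp t) ≤ sqSum T) := by
    intro T t
    obtain ⟨h1, h2, h3, h4⟩ := conj_diagExp_entries T t
    simp only [sqSum, h1, h2, h3, h4]
    refine ⟨fun h ht => ?_, fun h ht => ?_⟩
    · rw [h]
      have h5 : Real.exp (-t) ≤ 1 := Real.exp_le_one_iff.2 (by linarith)
      have h6 : Real.exp (-t) ^ 2 ≤ 1 := pow_le_one₀ (Real.exp_pos _).le h5
      nlinarith [sq_nonneg (T 0 1)]
    · rw [h]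
      have h5 : Real.exp t ≤ 1 := Real.exp_le_one_iff.2 (by linarith)
      have h6 : Real.exp t ^ 2 ≤ 1 := pow_le_one₀ (Real.exp_pos _).le h5
      nlinarith [sq_nonneg (T 1 0)]
  constructor
  · intro h
    refine (diag_of_bounded_conj hη hσ γ (-1) (by norm_num) (sqSum (σ⁻¹ * (γ : SL(2, ℝ)) * σ))
      fun i => (key _ _).2 h ?_).2
    have : (0 : ℝ) ≤ i * pairLength Γ η := by positivity
    push_cast; linarith
  · intro h
    refine (diag_of_bounded_conj hη hσ γ 1 (by norm_num) (sqSum (σ⁻¹ * (γ : SL(2, ℝ)) * σ))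
      fun i => (key _ _).1 h ?_).1
    push_cast; positivity

/-- Let δ generate Γ_η' modulo ± I. The off-diagonal entries of the conjugate of γδγ⁻¹ are, up to
sign, ab and cd times the same nonzero factor, and `entry_zero_one_iff` relates their vanishing. -/
lemma conj_pair_entries [DiscreteTopology Γ] (hη : IsHyperbolicPair Γ η)
    (hη' : IsHyperbolicPair Γ η') (hσ : IsScaling η σ) (hσ' : IsScaling η' σ') (γ : Γ) :
    ((σ⁻¹ * (γ : SL(2, ℝ)) * σ') 0 0 * (σ⁻¹ * (γ : SL(2, ℝ)) * σ') 0 1 = 0 ↔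
      (σ⁻¹ * (γ : SL(2, ℝ)) * σ') 1 0 * (σ⁻¹ * (γ : SL(2, ℝ)) * σ') 1 1 = 0) := by
  have hl := pairLength_pos hη' hσ'
  obtain ⟨δ, hδ, h⟩ := exists_pairStab_diagExp hη' hσ' 1
  rw [Int.cast_one, one_mul] at h
  have h1 : σ⁻¹ * ((γ * δ * γ⁻¹ : Γ) : SL(2, ℝ)) * σ = (σ⁻¹ * (γ : SL(2, ℝ)) * σ') *
      (σ'⁻¹ * (δ : SL(2, ℝ)) * σ') * (σ⁻¹ * (γ : SL(2, ℝ)) * σ')⁻¹ := by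
    push_cast; group
  have h2 := entry_zero_one_iff hη hσ (γ * δ * γ⁻¹)
  rw [h1] at h2
  set M := σ⁻¹ * (γ : SL(2, ℝ)) * σ' with hM
  obtain ⟨i1, i2, i3, i4⟩ := inv_entries M
  have hlam : Real.exp (-(pairLength Γ η') / 2) - Real.exp (pairLength Γ η' / 2) ≠ 0 := by
    have := Real.exp_lt_exp.2 (show -(pairLength Γ η') / 2 < pairLength Γ η' / 2 by linarith)
    linarith
  have h3 : ((M 0 0 * M 0 1) * (Real.exp (-(pairLength Γ η') / 2) - Real.exp (pairLength Γ η' / 2)) = 0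
      ↔ (M 1 0 * M 1 1) * (Real.exp (-(pairLength Γ η') / 2) - Real.exp (pairLength Γ η' / 2)) = 0) := by
    rcases h with h | h <;> rw [h] at h2 <;>
      simp only [mul_entries, neg_entries, diagExp_zero_zero, diagExp_zero_one, diagExp_one_zero,
        diagExp_one_one, i1, i2, i3, i4] at h2
    · constructor
      · intro h4
        linear_combination -h2.1 (by linear_combination h4)
      · intro h4
        linear_combination h2.2 (by linear_combination -h4)
    · constructor
      · intro h4
        linear_combination h2.1 (by linear_combination -h4)
      · intro h4
        linear_combination -h2.2 (by linear_combination h4)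
  simpa [hlam] using h3

/-- Every matrix `σ_η⁻¹ γ σ_η'` has nonzero entries, or is diagonal, or is antidiagonal. -/
theorem entries_trichotomy [DiscreteTopology Γ] (hη : IsHyperbolicPair Γ η)
    (hη' : IsHyperbolicPair Γ η') (hσ : IsScaling η σ) (hσ' : IsScaling η' σ') {M : SL(2, ℝ)}
    (hM : ∃ γ ∈ Γ, M = σ⁻¹ * γ * σ') :
    (M 0 0 ≠ 0 ∧ M 0 1 ≠ 0 ∧ M 1 0 ≠ 0 ∧ M 1 1 ≠ 0) ∨ (M 0 1 = 0 ∧ M 1 0 = 0) ∨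
      (M 0 0 = 0 ∧ M 1 1 = 0) := by
  obtain ⟨γ, hγ, rfl⟩ := hM
  have h1 := conj_pair_entries hη hη' hσ hσ' ⟨γ, hγ⟩
  -- The first relation says ab = 0 iff cd = 0. Applied to the inverse, with the pairs exchanged, it
  -- says bd = 0 iff ac = 0. With ad - bc = 1 these leave the three cases.
  have h2 := conj_pair_entries hη' hη hσ' hσ ⟨γ, hγ⟩⁻¹
  have h3 : σ'⁻¹ * (((⟨γ, hγ⟩⁻¹ : Γ) : Γ) : SL(2, ℝ)) * σ = (σ⁻¹ * γ * σ')⁻¹ := by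
    push_cast; group
  rw [h3] at h2
  simp only at h1
  obtain ⟨i1, i2, i3, i4⟩ := inv_entries (σ⁻¹ * γ * σ')
  rw [i1, i2, i3, i4] at h2
  have hd := det_entries (σ⁻¹ * γ * σ')
  generalize (σ⁻¹ * γ * σ') 0 0 = a at *
  generalize (σ⁻¹ * γ * σ') 0 1 = b at *
  generalize (σ⁻¹ * γ * σ') 1 0 = c at *
  generalize (σ⁻¹ * γ * σ') 1 1 = d at *
  simp only [mul_eq_zero, neg_eq_zero] at h1 h2
  by_cases ha : a = 0
  · subst ha
    simp only [zero_mul, zero_sub] at hd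
    have hb : b ≠ 0 := by rintro rfl; simp at hd
    have hc : c ≠ 0 := by rintro rfl; simp at hd
    simp_all
  · by_cases hb : b = 0
    · subst hb
      simp only [zero_mul, sub_zero] at hd
      have hb : d ≠ 0 := by rintro rfl; simp at hd
      simp_all
    · simp_all

theorem exists_isTransition (hσ : IsScaling η σ) (hσ' : IsScaling η' σ') :
    ∃ a b : ℝ, IsTransition Γ η η' σ σ' a b := by
  have hA : ∃ a : ℝ, a ≠ 0 ∧ (PairEquiv Γ η' η → ∃ γ ∈ Γ,
      ((σ⁻¹ * γ * σ' : SL(2, ℝ)) : Matrix (Fin 2) (Fin 2) ℝ) = !![a, 0; 0, 1 / a]) := by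
    by_cases h : PairEquiv Γ η' η
    · obtain ⟨γ, hγ, hh⟩ := h
      obtain ⟨h1, h2⟩ := (bdAct_pair_iff hσ hσ' γ).1 hh
      have hd := det_entries (σ⁻¹ * γ * σ')
      rw [h1, zero_mul, sub_zero] at hd
      refine ⟨(σ⁻¹ * γ * σ') 0 0, left_ne_zero_of_mul_eq_one hd, fun _ => ⟨γ, hγ, ?_⟩⟩
      rw [one_div, ← eq_inv_of_mul_eq_one_right hd]
      ext i j
      fin_cases i <;> fin_cases j
      exacts [rfl, h1, h2, rfl]
    -- For inequivalent pairs nothing is required of a, and any nonzero value serves.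
    · exact ⟨1, one_ne_zero, fun h' => absurd h' h⟩
  have hB : ∃ b : ℝ, b ≠ 0 ∧ (PairEquiv Γ η' η.swap → ∃ γ ∈ Γ,
      ((σ⁻¹ * γ * σ' : SL(2, ℝ)) : Matrix (Fin 2) (Fin 2) ℝ) = !![0, b; -1 / b, 0]) := by
    by_cases h : PairEquiv Γ η' η.swap
    · obtain ⟨γ, hγ, hh⟩ := h
      obtain ⟨h1, h2⟩ := (bdAct_pair_swap_iff hσ hσ' γ).1 hh
      have hd := det_entries (σ⁻¹ * γ * σ')
      rw [h1, mul_zero, zero_sub] at hd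
      have hb : (σ⁻¹ * γ * σ') 0 1 ≠ 0 := by
        intro h; rw [h] at hd; norm_num at hd
      refine ⟨(σ⁻¹ * γ * σ') 0 1, hb, fun _ => ⟨γ, hγ, ?_⟩⟩
      have hc : (σ⁻¹ * γ * σ') 1 0 = -1 / (σ⁻¹ * γ * σ') 0 1 := by
        rw [eq_div_iff hb]; linarith
      rw [← hc]
      ext i j
      fin_cases i <;> fin_cases j
      exacts [h2, rfl, rfl, h1]
    · exact ⟨1, one_ne_zero, fun h' => absurd h' h⟩
  obtain ⟨a, ha, ha'⟩ := hA
  obtain ⟨b, hb, hb'⟩ := hB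
  exact ⟨a, b, ha, hb, ha', hb'⟩

end Pair


/-! ### Cosets and double cosets -/

/-- The matrix `σ⁻¹ γ σ'`. -/
def transMatrix {Γ : Subgroup SL(2, ℝ)} (σ σ' : SL(2, ℝ)) (γ : Γ) : SL(2, ℝ) :=
  σ⁻¹ * (γ : SL(2, ℝ)) * σ'

/-- All entries of a matrix are nonzero. -/
def Nondeg (g : SL(2, ℝ)) : Prop := g 0 0 ≠ 0 ∧ g 0 1 ≠ 0 ∧ g 1 0 ≠ 0 ∧ g 1 1 ≠ 0

lemma left_diagExp_entries (t : ℝ) (g : SL(2, ℝ)) :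
    (diagExp t * g) 0 0 = Real.exp (t / 2) * g 0 0 ∧ (diagExp t * g) 0 1 = Real.exp (t / 2) * g 0 1 ∧
    (diagExp t * g) 1 0 = Real.exp (-t / 2) * g 1 0 ∧
    (diagExp t * g) 1 1 = Real.exp (-t / 2) * g 1 1 := by
  simp [mul_entries]

lemma right_diagExp_entries (t : ℝ) (g : SL(2, ℝ)) :
    (g * diagExp t) 0 0 = g 0 0 * Real.exp (t / 2) ∧
    (g * diagExp t) 0 1 = g 0 1 * Real.exp (-t / 2) ∧
    (g * diagExp t) 1 0 = g 1 0 * Real.exp (t / 2) ∧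
    (g * diagExp t) 1 1 = g 1 1 * Real.exp (-t / 2) := by
  simp [mul_entries]

lemma nondeg_left_diagExp (t : ℝ) (g : SL(2, ℝ)) : Nondeg (diagExp t * g) ↔ Nondeg g := by
  obtain ⟨h1, h2, h3, h4⟩ := left_diagExp_entries t g
  simp [Nondeg, h1, h2, h3, h4]

lemma nondeg_right_diagExp (t : ℝ) (g : SL(2, ℝ)) : Nondeg (g * diagExp t) ↔ Nondeg g := by
  obtain ⟨h1, h2, h3, h4⟩ := right_diagExp_entries t g
  simp [Nondeg, h1, h2, h3, h4]

lemma nondeg_neg (g : SL(2, ℝ)) : Nondeg (-g) ↔ Nondeg g := by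
  simp [Nondeg, neg_entries]

section Cosets

variable {Γ : Subgroup SL(2, ℝ)} {η η' : OnePoint ℝ × OnePoint ℝ} {σ σ' : SL(2, ℝ)}

lemma transMatrix_mul (γ δ : Γ) :
    transMatrix σ σ' (γ * δ) = transMatrix σ σ γ * transMatrix σ σ' δ := by
  simp only [transMatrix, Subgroup.coe_mul]; group

lemma transMatrix_mul' (γ δ : Γ) :
    transMatrix σ σ' (γ * δ) = transMatrix σ σ' γ * transMatrix σ' σ' δ := by
  simp only [transMatrix, Subgroup.coe_mul]; group

/-- The double coset of an element of `Γ`. -/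
def dblMk (Γ : Subgroup SL(2, ℝ)) (η η' : OnePoint ℝ × OnePoint ℝ) (γ : Γ) : DblCosets Γ η η' :=
  DoubleCoset.mk _ _ γ

/-- The representative of a double coset. -/
def dblOut (q : DblCosets Γ η η') : Γ := Quotient.out q

/-- The right coset of an element of `Γ`. -/
def rightMk (Γ : Subgroup SL(2, ℝ)) (η : OnePoint ℝ × OnePoint ℝ) (γ : Γ) : RightCosets Γ η :=
  Quotient.mk _ γ

lemma dblMk_dblOut (q : DblCosets Γ η η') : dblMk Γ η η' (dblOut q) = q := Quotient.out_eq q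

lemma dblMk_eq_iff {x y : Γ} : dblMk Γ η η' x = dblMk Γ η η' y ↔
    ∃ h ∈ pairStab Γ η, ∃ k ∈ pairStab Γ η', y = h * x * k := DoubleCoset.eq _ _ _ _

lemma rightMk_out (p : RightCosets Γ η) : rightMk Γ η p.out = p := Quotient.out_eq p

lemma rightMk_eq_iff {x y : Γ} : rightMk Γ η x = rightMk Γ η y ↔ y * x⁻¹ ∈ pairStab Γ η := by
  rw [rightMk, rightMk, Quotient.eq, QuotientGroup.rightRel_apply]

lemma cSet_eq : cSet Γ σ σ' = {C | ∃ γ : Γ, Nondeg (transMatrix σ σ' γ) ∧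
    C = transMatrix σ σ' γ 0 0 * transMatrix σ σ' γ 1 1} := by
  ext C
  constructor
  · rintro ⟨γ, hγ, a, b, c, d, hm, hne, rfl⟩
    have e : ∀ i j, transMatrix σ σ' (⟨γ, hγ⟩ : Γ) i j = !![a, b; c, d] i j := fun i j => by
      rw [← hm]; rfl
    refine ⟨⟨γ, hγ⟩, ?_, ?_⟩
    · simp only [ne_eq, mul_eq_zero, not_or] at hne
      simp only [Nondeg, e]
      exact ⟨hne.1.1.1, hne.1.1.2, hne.1.2, hne.2⟩
    · simp only [e]; rfl
  · rintro ⟨γ, ⟨ha, hb, hc, hd⟩, rfl⟩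
    exact ⟨γ, γ.2, _, _, _, _, Matrix.eta_fin_two _,
      mul_ne_zero (mul_ne_zero (mul_ne_zero ha hb) hc) hd, rfl⟩

lemma cSet_ne {C : ℝ} (hC : C ∈ cSet Γ σ σ') : C ≠ 0 ∧ C ≠ 1 := by
  rw [cSet_eq] at hC
  obtain ⟨γ, ⟨ha, hb, hc, hd⟩, rfl⟩ := hC
  refine ⟨mul_ne_zero ha hd, fun h => ?_⟩
  have := det_entries (transMatrix σ σ' γ)
  rw [h] at this
  exact mul_ne_zero hb hc (by linarith)

lemma mem_kloosterIndex_iff {q : DblCosets Γ η η'} {C : ℝ} {α : SignType} :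
    q ∈ kloosterIndex Γ η η' σ σ' C α ↔
      transMatrix σ σ' (dblOut q) 0 0 * transMatrix σ σ' (dblOut q) 1 1 = C ∧
      SignType.sign (transMatrix σ σ' (dblOut q) 0 0 * transMatrix σ σ' (dblOut q) 1 0) = α :=
  Iff.rfl

lemma nondeg_of_mul_eq {g : SL(2, ℝ)} {C : ℝ} (h0 : C ≠ 0) (h1 : C ≠ 1) (h : g 0 0 * g 1 1 = C) :
    Nondeg g := by
  have hd := det_entries g
  have hbc : g 0 1 * g 1 0 ≠ 0 := by
    intro h2
    apply h1
    rw [← h]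
    linarith
  rw [← h] at h0
  exact ⟨left_ne_zero_of_mul h0, left_ne_zero_of_mul hbc, right_ne_zero_of_mul hbc,
    right_ne_zero_of_mul h0⟩

variable [DiscreteTopology Γ]

lemma transMatrix_left_mul (hη : IsHyperbolicPair Γ η) (hσ : IsScaling η σ) {h : Γ}
    (hh : h ∈ pairStab Γ η) : ∃ j : ℤ, ∀ x : Γ,
      transMatrix σ σ' (h * x) = diagExp (j * pairLength Γ η) * transMatrix σ σ' x ∨
      transMatrix σ σ' (h * x) = -(diagExp (j * pairLength Γ η) * transMatrix σ σ' x) := by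
  obtain ⟨j, hj⟩ := exists_eq_diagExp hη hσ hh
  refine ⟨j, fun x => ?_⟩
  rw [transMatrix_mul]
  rcases hj with hj | hj
  · left; rw [transMatrix, hj]
  · right; rw [transMatrix, hj, neg_mul]

lemma exists_transMatrix_left (hη : IsHyperbolicPair Γ η) (hσ : IsScaling η σ) (j : ℤ) :
    ∃ h ∈ pairStab Γ η, ∀ x : Γ,
      transMatrix σ σ' (h * x) = diagExp (j * pairLength Γ η) * transMatrix σ σ' x ∨
      transMatrix σ σ' (h * x) = -(diagExp (j * pairLength Γ η) * transMatrix σ σ' x) := by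
  obtain ⟨h, hh, hj⟩ := exists_pairStab_diagExp hη hσ j
  refine ⟨h, hh, fun x => ?_⟩
  rw [transMatrix_mul]
  rcases hj with hj | hj
  · left; rw [transMatrix, hj]
  · right; rw [transMatrix, hj, neg_mul]

lemma exists_transMatrix_right (hη' : IsHyperbolicPair Γ η') (hσ' : IsScaling η' σ') (j : ℤ) :
    ∃ h ∈ pairStab Γ η', ∀ x : Γ,
      transMatrix σ σ' (x * h) = transMatrix σ σ' x * diagExp (j * pairLength Γ η') ∨
      transMatrix σ σ' (x * h) = -(transMatrix σ σ' x * diagExp (j * pairLength Γ η')) := by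
  obtain ⟨h, hh, hj⟩ := exists_pairStab_diagExp hη' hσ' j
  refine ⟨h, hh, fun x => ?_⟩
  rw [transMatrix_mul']
  rcases hj with hj | hj
  · left; rw [show transMatrix σ' σ' h = _ from hj]
  · right; rw [show transMatrix σ' σ' h = _ from hj, mul_neg]

/-! #### Normalized representatives -/

lemma exists_int_abs_add_le {l : ℝ} (hl : 0 < l) (x : ℝ) : ∃ j : ℤ, |x + j * l| ≤ l := by
  refine ⟨-⌊x / l⌋, ?_⟩
  have h1 := Int.floor_le (x / l)
  have h2 := Int.lt_floor_add_one (x / l)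
  rw [le_div_iff₀ hl] at h1
  rw [div_lt_iff₀ hl] at h2
  rw [abs_le]
  push_cast
  constructor <;> nlinarith

/-- The product ad is invariant under the opposite scalings of a and d, and log |a/d| measures their
imbalance, which t shifts. -/
lemma sq_mul_exp_half {a d : ℝ} (ha : a ≠ 0) (hd : d ≠ 0) (t : ℝ) :
    (a * Real.exp (t / 2)) ^ 2 = |a * d| * Real.exp (Real.log |a / d| + t) ∧
    (d * Real.exp (-t / 2)) ^ 2 = |a * d| * Real.exp (-(Real.log |a / d| + t)) := by
  have h1 : Real.exp (t / 2) ^ 2 = Real.exp t := by rw [← Real.exp_nat_mul]; ring_nf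
  have h2 : Real.exp (-t / 2) ^ 2 = Real.exp (-t) := by rw [← Real.exp_nat_mul]; ring_nf
  have h3 : Real.exp (Real.log |a / d|) = |a / d| := Real.exp_log (abs_pos.2 (div_ne_zero ha hd))
  have ha' := abs_pos.2 ha
  have hd' := abs_pos.2 hd
  rw [mul_pow, mul_pow, h1, h2, neg_add, Real.exp_add, Real.exp_add, Real.exp_neg (Real.log _), h3,
    abs_mul, abs_div, ← sq_abs a, ← sq_abs d]
  constructor <;> field_simp

/-- Once both imbalances are at most R, the squares of the entries are at most e^R |ad| on the
diagonal and e^R |bc| off it; the determinant gives |bc| ≤ |ad| + 1. -/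
lemma sqSum_normalized_le {g : SL(2, ℝ)} (hg : Nondeg g) {s t R : ℝ}
    (h1 : |Real.log |g 0 0 / g 1 1| + (s + t)| ≤ R) (h2 : |Real.log |g 0 1 / g 1 0| + (s - t)| ≤ R) :
    sqSum (diagExp s * g * diagExp t) ≤ 2 * Real.exp R * (2 * |g 0 0 * g 1 1| + 1) := by
  obtain ⟨ha, hb, hc, hd⟩ := hg
  have hdet := det_entries g
  obtain ⟨l1, l2, l3, l4⟩ := left_diagExp_entries s g
  obtain ⟨r1, r2, r3, r4⟩ := right_diagExp_entries t (diagExp s * g)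
  obtain ⟨e1, e2⟩ := sq_mul_exp_half ha hd (s + t)
  obtain ⟨e3, e4⟩ := sq_mul_exp_half hb hc (s - t)
  rw [sqSum, r1, r2, r3, r4, l1, l2, l3, l4]
  have f1 : Real.exp (s / 2) * g 0 0 * Real.exp (t / 2) = g 0 0 * Real.exp ((s + t) / 2) := by
    rw [add_div, Real.exp_add]; ring
  have f2 : Real.exp (s / 2) * g 0 1 * Real.exp (-t / 2) = g 0 1 * Real.exp ((s - t) / 2) := by
    rw [show (s - t) / 2 = s / 2 + -t / 2 by ring, Real.exp_add]; ring
  have f3 : Real.exp (-s / 2) * g 1 0 * Real.exp (t / 2) = g 1 0 * Real.exp (-(s - t) / 2) := by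
    rw [show -(s - t) / 2 = -s / 2 + t / 2 by ring, Real.exp_add]; ring
  have f4 : Real.exp (-s / 2) * g 1 1 * Real.exp (-t / 2) = g 1 1 * Real.exp (-(s + t) / 2) := by
    rw [show -(s + t) / 2 = -s / 2 + -t / 2 by ring, Real.exp_add]; ring
  rw [f1, f2, f3, f4, e1, e2, e3, e4]
  have hbc : |g 0 1 * g 1 0| ≤ |g 0 0 * g 1 1| + 1 := by
    rw [show g 0 1 * g 1 0 = g 0 0 * g 1 1 - 1 by linarith]
    simpa using abs_sub (g 0 0 * g 1 1) 1
  have x1 := Real.exp_le_exp.2 (abs_le.1 h1).2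
  have x2 := Real.exp_le_exp.2 (show -(Real.log |g 0 0 / g 1 1| + (s + t)) ≤ R by
    linarith [(abs_le.1 h1).1])
  have x3 := Real.exp_le_exp.2 (abs_le.1 h2).2
  have x4 := Real.exp_le_exp.2 (show -(Real.log |g 0 1 / g 1 0| + (s - t)) ≤ R by
    linarith [(abs_le.1 h2).1])
  have p1 := abs_nonneg (g 0 0 * g 1 1)
  have p2 := abs_nonneg (g 0 1 * g 1 0)
  have p3 := Real.exp_pos R
  have y1 := mul_le_mul_of_nonneg_left x1 p1
  have y2 := mul_le_mul_of_nonneg_left x2 p1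
  have y3 := mul_le_mul_of_nonneg_left x3 p2
  have y4 := mul_le_mul_of_nonneg_left x4 p2
  have y5 := mul_le_mul_of_nonneg_right hbc p3.le
  nlinarith

lemma diag_mul_invariant (s t : ℝ) (g : SL(2, ℝ)) :
    (diagExp s * g * diagExp t) 0 0 * (diagExp s * g * diagExp t) 1 1 = g 0 0 * g 1 1 := by
  obtain ⟨l1, l2, l3, l4⟩ := left_diagExp_entries s g
  obtain ⟨r1, r2, r3, r4⟩ := right_diagExp_entries t (diagExp s * g)
  rw [r1, r4, l1, l4]
  have h1 : Real.exp (s / 2) * Real.exp (-s / 2) = 1 := by rw [← Real.exp_add]; ring_nf; simp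
  have h2 : Real.exp (t / 2) * Real.exp (-t / 2) = 1 := by rw [← Real.exp_add]; ring_nf; simp
  linear_combination g 0 0 * g 1 1 * Real.exp (t / 2) * Real.exp (-t / 2) * h1 + g 0 0 * g 1 1 * h2

/-- Every double coset with nonzero entries has a representative of norm bounded by `|ad|`. -/
lemma exists_normalized (hη : IsHyperbolicPair Γ η) (hη' : IsHyperbolicPair Γ η')
    (hσ : IsScaling η σ) (hσ' : IsScaling η' σ') (x : Γ) (hx : Nondeg (transMatrix σ σ' x)) :
    ∃ y : Γ, dblMk Γ η η' x = dblMk Γ η η' y ∧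
      transMatrix σ σ' y 0 0 * transMatrix σ σ' y 1 1 =
        transMatrix σ σ' x 0 0 * transMatrix σ σ' x 1 1 ∧
      sqSum (transMatrix σ σ' y) ≤ 2 * Real.exp (pairLength Γ η + pairLength Γ η') *
        (2 * |transMatrix σ σ' x 0 0 * transMatrix σ σ' x 1 1| + 1) := by
  have hl := pairLength_pos hη hσ
  have hl' := pairLength_pos hη' hσ'
  set g := transMatrix σ σ' x with hgdef
  set A := Real.log |g 0 0 / g 1 1|
  set B := Real.log |g 0 1 / g 1 0|
  -- Diagonal factors s on the left and t on the right change A by s + t and B by s - t. Both are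
  -- cancelled by s = -(A + B)/2 and t = -(A - B)/2, up to rounding to multiples of the two lengths.
  obtain ⟨i, hi⟩ := exists_int_abs_add_le hl ((A + B) / 2)
  obtain ⟨j, hj⟩ := exists_int_abs_add_le hl' ((A - B) / 2)
  obtain ⟨h, hh, hh'⟩ := exists_transMatrix_left (σ' := σ') hη hσ i
  obtain ⟨k, hk, hk'⟩ := exists_transMatrix_right (σ := σ) hη' hσ' j
  have hM : transMatrix σ σ' (h * x * k) =
      diagExp (i * pairLength Γ η) * g * diagExp (j * pairLength Γ η') ∨
      transMatrix σ σ' (h * x * k) =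
      -(diagExp (i * pairLength Γ η) * g * diagExp (j * pairLength Γ η')) := by
    rcases hh' x with e1 | e1 <;> rcases hk' (h * x) with e2 | e2 <;> rw [e2, e1] <;> simp [hgdef]
  have hb : sqSum (diagExp (i * pairLength Γ η) * g * diagExp (j * pairLength Γ η')) ≤
      2 * Real.exp (pairLength Γ η + pairLength Γ η') * (2 * |g 0 0 * g 1 1| + 1) := by
    apply sqSum_normalized_le hx
    · rw [abs_le] at *; constructor <;> linarith
    · rw [abs_le] at *; constructor <;> linarith
  have hd := diag_mul_invariant (i * pairLength Γ η) (j * pairLength Γ η') g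
  refine ⟨h * x * k, dblMk_eq_iff.2 ⟨h, hh, k, hk, rfl⟩, ?_, ?_⟩
  · rcases hM with e | e <;> rw [e]
    · exact hd
    · rw [neg_entries, neg_entries, neg_mul_neg, hd]
  · rcases hM with e | e <;> rw [e]
    · exact hb
    · rw [sqSum_neg]; exact hb

lemma finite_dblCosets (hη : IsHyperbolicPair Γ η) (hη' : IsHyperbolicPair Γ η')
    (hσ : IsScaling η σ) (hσ' : IsScaling η' σ') (R : ℝ) :
    {q : DblCosets Γ η η' | Nondeg (transMatrix σ σ' (dblOut q)) ∧
      |transMatrix σ σ' (dblOut q) 0 0 * transMatrix σ σ' (dblOut q) 1 1| ≤ R}.Finite := by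
  refine ((finite_sqSum_conj_le (Γ := Γ) σ σ'
    (2 * Real.exp (pairLength Γ η + pairLength Γ η') * (2 * R + 1))).image (dblMk Γ η η')).subset ?_
  rintro q ⟨hq, hR⟩
  obtain ⟨y, h1, -, h2⟩ := exists_normalized hη hη' hσ hσ' (dblOut q) hq
  refine ⟨y, h2.trans ?_, by rw [← h1, dblMk_dblOut]⟩
  gcongr

lemma cSet_inter_finite (hη : IsHyperbolicPair Γ η) (hη' : IsHyperbolicPair Γ η')
    (hσ : IsScaling η σ) (hσ' : IsScaling η' σ') : (cSet Γ σ σ' ∩ Ioo 0 1).Finite := by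
  refine ((finite_sqSum_conj_le (Γ := Γ) σ σ'
    (2 * Real.exp (pairLength Γ η + pairLength Γ η') * (2 * 1 + 1))).image
    fun γ => transMatrix σ σ' γ 0 0 * transMatrix σ σ' γ 1 1).subset ?_
  rw [cSet_eq]
  rintro C ⟨⟨γ, hγ, rfl⟩, h0, h1⟩
  obtain ⟨y, -, h2, h3⟩ := exists_normalized hη hη' hσ hσ' γ hγ
  refine ⟨y, h3.trans ?_, h2⟩
  rw [abs_of_pos h0]
  gcongr

lemma kloosterIndex_finite (hη : IsHyperbolicPair Γ η) (hη' : IsHyperbolicPair Γ η')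
    (hσ : IsScaling η σ) (hσ' : IsScaling η' σ') {C : ℝ} (hC : C ∈ cSet Γ σ σ') (α : SignType) :
    (kloosterIndex Γ η η' σ σ' C α).Finite := by
  obtain ⟨h0, h1⟩ := cSet_ne hC
  refine (finite_dblCosets hη hη' hσ hσ' |C|).subset fun q hq => ?_
  rw [mem_kloosterIndex_iff] at hq
  exact ⟨nondeg_of_mul_eq h0 h1 hq.1, by rw [hq.1]⟩

/-! #### Summation over right cosets -/

/-- A function on matrices which is invariant under `± diag (e ^ (j l / 2), e ^ (-j l / 2))` on the
left. -/
structure LeftInvariant (l : ℝ) (G : SL(2, ℝ) → ℂ) : Prop where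
  diag : ∀ (j : ℤ) (g : SL(2, ℝ)), G (diagExp (j * l) * g) = G g
  neg : ∀ g : SL(2, ℝ), G (-g) = G g

lemma LeftInvariant.eq_of_rightMk_eq {G : SL(2, ℝ) → ℂ} (hG : LeftInvariant (pairLength Γ η) G)
    (hη : IsHyperbolicPair Γ η) (hσ : IsScaling η σ) {x y : Γ} (h : rightMk Γ η x = rightMk Γ η y) :
    G (transMatrix σ σ' x) = G (transMatrix σ σ' y) := by
  rw [rightMk_eq_iff] at h
  obtain ⟨j, hj⟩ := transMatrix_left_mul (σ' := σ') hη hσ h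
  have h1 := hj x
  rw [inv_mul_cancel_right] at h1
  rcases h1 with h1 | h1 <;> rw [h1]
  · rw [hG.diag]
  · rw [hG.neg, hG.diag]

lemma LeftInvariant.out_rightMk {G : SL(2, ℝ) → ℂ} (hG : LeftInvariant (pairLength Γ η) G)
    (hη : IsHyperbolicPair Γ η) (hσ : IsScaling η σ) (x : Γ) :
    G (transMatrix σ σ' (rightMk Γ η x).out) = G (transMatrix σ σ' x) :=
  hG.eq_of_rightMk_eq hη hσ (rightMk_out _)

lemma nondeg_rightMk (hη : IsHyperbolicPair Γ η) (hσ : IsScaling η σ) (x : Γ) :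
    Nondeg (transMatrix σ σ' (rightMk Γ η x).out) ↔ Nondeg (transMatrix σ σ' x) := by
  have h := rightMk_eq_iff.1 (rightMk_out (rightMk Γ η x))
  obtain ⟨j, hj⟩ := transMatrix_left_mul (σ' := σ') hη hσ h
  have h1 := hj (rightMk Γ η x).out
  rw [inv_mul_cancel_right] at h1
  rcases h1 with h1 | h1 <;> rw [h1]
  · rw [nondeg_left_diagExp]
  · rw [nondeg_neg, nondeg_left_diagExp]

lemma sqSum_rows_pos (g : SL(2, ℝ)) : 0 < g 0 0 ^ 2 + g 0 1 ^ 2 ∧ 0 < g 1 0 ^ 2 + g 1 1 ^ 2 := by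
  have hd := det_entries g
  constructor
  · by_contra h
    have h1 : g 0 0 = 0 := by nlinarith [sq_nonneg (g 0 0), sq_nonneg (g 0 1)]
    have h2 : g 0 1 = 0 := by nlinarith [sq_nonneg (g 0 0), sq_nonneg (g 0 1)]
    rw [h1, h2] at hd; norm_num at hd
  · by_contra h
    have h1 : g 1 0 = 0 := by nlinarith [sq_nonneg (g 1 0), sq_nonneg (g 1 1)]
    have h2 : g 1 1 = 0 := by nlinarith [sq_nonneg (g 1 0), sq_nonneg (g 1 1)]
    rw [h1, h2] at hd; norm_num at hd

/-- The product of the squared norms of the rows of a matrix. -/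
def rowProd (g : SL(2, ℝ)) : ℝ := (g 0 0 ^ 2 + g 0 1 ^ 2) * (g 1 0 ^ 2 + g 1 1 ^ 2)

/-- Lagrange's identity: the product equals the squared determinant plus the squared inner product
of the rows. -/
lemma one_le_rowProd (g : SL(2, ℝ)) : 1 ≤ rowProd g := by
  have hd := det_entries g
  unfold rowProd
  nlinarith [sq_nonneg (g 0 0 * g 1 0 + g 0 1 * g 1 1)]

/-- Left multiplication by the diagonal matrix of parameter t scales the squared row norms by e^t
and e^(-t), with constant product PQ. Making them agree up to the factor e^(2ℓ) gives (P + Q)² ≤ 4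
e^(2ℓ) PQ. -/
lemma exists_row_normalized (hη : IsHyperbolicPair Γ η) (hσ : IsScaling η σ) (x : Γ) :
    ∃ y : Γ, rightMk Γ η x = rightMk Γ η y ∧
      (rowProd (transMatrix σ σ' x))⁻¹ ≤ 4 * Real.exp (2 * pairLength Γ η) *
        (sqSum (transMatrix σ σ' y) ^ 2)⁻¹ := by
  have hl := pairLength_pos hη hσ
  set g := transMatrix σ σ' x with hgdef
  obtain ⟨p1, p2⟩ := sqSum_rows_pos g
  obtain ⟨X, hX⟩ : ∃ X, X = g 0 0 ^ 2 + g 0 1 ^ 2 := ⟨_, rfl⟩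
  obtain ⟨Y, hY⟩ : ∃ Y, Y = g 1 0 ^ 2 + g 1 1 ^ 2 := ⟨_, rfl⟩
  rw [← hX] at p1
  rw [← hY] at p2
  obtain ⟨j, hj⟩ := exists_int_abs_add_le hl (Real.log (X / Y) / 2)
  obtain ⟨h, hh, hh'⟩ := exists_transMatrix_left (σ' := σ') hη hσ j
  refine ⟨h * x, rightMk_eq_iff.2 (by simpa using hh), ?_⟩
  have hs : sqSum (transMatrix σ σ' (h * x)) =
      X * Real.exp (j * pairLength Γ η) + Y * Real.exp (-(j * pairLength Γ η)) := by
    have h1 : sqSum (transMatrix σ σ' (h * x)) = sqSum (diagExp (j * pairLength Γ η) * g) := by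
      rcases hh' x with e | e <;> rw [e]
      rw [sqSum_neg]
    obtain ⟨l1, l2, l3, l4⟩ := left_diagExp_entries (j * pairLength Γ η) g
    have e1 : Real.exp (j * pairLength Γ η) = Real.exp (j * pairLength Γ η / 2) ^ 2 := by
      rw [← Real.exp_nat_mul]; ring_nf
    have e2 : Real.exp (-(j * pairLength Γ η)) = Real.exp (-(j * pairLength Γ η) / 2) ^ 2 := by
      rw [← Real.exp_nat_mul]; ring_nf
    rw [h1, sqSum, l1, l2, l3, l4, hX, hY, e1, e2]
    ring
  rw [hs]
  obtain ⟨t, ht⟩ : ∃ t, t = j * pairLength Γ η := ⟨_, rfl⟩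
  rw [← ht] at hj ⊢
  obtain ⟨P, hP⟩ : ∃ P, P = X * Real.exp t := ⟨_, rfl⟩
  obtain ⟨Q, hQ⟩ : ∃ Q, Q = Y * Real.exp (-t) := ⟨_, rfl⟩
  rw [← hP, ← hQ]
  have hPp : 0 < P := by rw [hP]; positivity
  have hQp : 0 < Q := by rw [hQ]; positivity
  have hPQ : P * Q = rowProd g := by
    rw [hP, hQ, rowProd, ← hX, ← hY]
    have : Real.exp t * Real.exp (-t) = 1 := by rw [← Real.exp_add]; simp
    linear_combination X * Y * this
  have hlog : Real.log (P / Q) = Real.log (X / Y) + 2 * t := by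
    rw [hP, hQ, Real.log_div (by positivity) (by positivity), Real.log_div p1.ne' p2.ne',
      Real.log_mul p1.ne' (Real.exp_pos _).ne', Real.log_mul p2.ne' (Real.exp_pos _).ne',
      Real.log_exp, Real.log_exp]
    ring
  have habs : |Real.log (P / Q)| ≤ 2 * pairLength Γ η := by
    rw [hlog]; rw [abs_le] at *; constructor <;> linarith
  have h1 : P ≤ Real.exp (2 * pairLength Γ η) * Q := by
    rw [← div_le_iff₀ hQp, ← Real.log_le_iff_le_exp (by positivity)]
    exact (abs_le.1 habs).2
  have h2 : Q ≤ Real.exp (2 * pairLength Γ η) * P := by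
    rw [← div_le_iff₀ hPp, ← Real.log_le_iff_le_exp (by positivity), ← inv_div, Real.log_inv]
    linarith [(abs_le.1 habs).1]
  rw [← hPQ, ← div_eq_mul_inv, ← one_div, div_le_div_iff₀ (by positivity) (by positivity)]
  have he : 1 ≤ Real.exp (2 * pairLength Γ η) := Real.one_le_exp (by positivity)
  nlinarith [mul_le_mul_of_nonneg_left h1 hPp.le, mul_le_mul_of_nonneg_left h2 hQp.le,
    mul_pos hPp hQp]

/-- Balanced representatives of distinct cosets are distinct elements of Γ, so the sum over cosets
is dominated by the sum of ‖γ‖⁻⁴ over Γ. -/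
lemma summable_inv_rowProd (hη : IsHyperbolicPair Γ η) (hσ : IsScaling η σ) :
    Summable fun p : RightCosets Γ η => (rowProd (transMatrix σ σ' p.out))⁻¹ := by
  choose y hy hy' using exists_row_normalized (σ' := σ') hη hσ
  have hinj : Function.Injective fun p : RightCosets Γ η => y p.out := by
    intro p p' h
    rw [← rightMk_out p, ← rightMk_out p', hy p.out, hy p'.out]
    exact congrArg _ h
  refine Summable.of_nonneg_of_le (fun p => ?_) (fun p => hy' p.out)
    (((summable_inv_sqSum_conj_sq (Γ := Γ) σ σ').comp_injective hinj).mul_left _)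
  have := one_le_rowProd (transMatrix σ σ' p.out)
  positivity

/-- The double cosets with nonzero entries. -/
abbrev NondegCosets (Γ : Subgroup SL(2, ℝ)) (η η' : OnePoint ℝ × OnePoint ℝ) (σ σ' : SL(2, ℝ)) :
    Type := {q : DblCosets Γ η η' // Nondeg (transMatrix σ σ' (dblOut q))}

/-- Equality of two cosets makes M · diagExp t · M⁻¹ diagonal, with t = (j - i) ℓ_η'. Its upper
right entry is ab (e^(-t/2) - e^(t/2)), and ab ≠ 0 forces t = 0. -/
lemma rightMk_mul_injective (hη' : IsHyperbolicPair Γ η')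
    (hσ : IsScaling η σ) (hσ' : IsScaling η' σ') {τ : ℤ → Γ} (hτ : ∀ j, τ j ∈ pairStab Γ η')
    (hτ' : ∀ j, transMatrix σ' σ' (τ j) = diagExp (j * pairLength Γ η') ∨
      transMatrix σ' σ' (τ j) = -diagExp (j * pairLength Γ η')) :
    Function.Injective fun x : NondegCosets Γ η η' σ σ' × ℤ =>
      rightMk Γ η (dblOut x.1.1 * τ x.2) := by
  have hl' := pairLength_pos hη' hσ'
  rintro ⟨⟨q, hq⟩, i⟩ ⟨⟨q', hq'⟩, j⟩ h
  simp only at h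
  rw [rightMk_eq_iff] at h
  have hqq : q = q' := by
    rw [← dblMk_dblOut q, ← dblMk_dblOut q']
    exact dblMk_eq_iff.2 ⟨_, h, τ i * (τ j)⁻¹, mul_mem (hτ i) (inv_mem (hτ j)), by group⟩
  subst hqq
  congr 1
  have h2 := (mem_pairStab_iff hσ _).1 h
  set M := transMatrix σ σ' (dblOut q) with hMdef
  have h3 : transMatrix σ σ (dblOut q * τ j * (dblOut q * τ i)⁻¹) =
      M * (transMatrix σ' σ' (τ j) * (transMatrix σ' σ' (τ i))⁻¹) * M⁻¹ := by
    rw [hMdef]; simp only [transMatrix]; push_cast; group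
  have h4 : M * (transMatrix σ' σ' (τ j) * (transMatrix σ' σ' (τ i))⁻¹) * M⁻¹ =
      M * diagExp ((j - i) * pairLength Γ η') * M⁻¹ ∨
      M * (transMatrix σ' σ' (τ j) * (transMatrix σ' σ' (τ i))⁻¹) * M⁻¹ =
      -(M * diagExp ((j - i) * pairLength Γ η') * M⁻¹) := by
    have e : diagExp ((j - i) * pairLength Γ η') =
        diagExp (j * pairLength Γ η') * (diagExp (i * pairLength Γ η'))⁻¹ := by
      rw [← diagExp_neg, ← diagExp_add]; ring_nf
    have e' : ∀ g : SL(2, ℝ), (-g)⁻¹ = -g⁻¹ := fun g => by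
      rw [inv_eq_iff_mul_eq_one]; simp
    rw [e]
    rcases hτ' i with a | a <;> rcases hτ' j with b | b <;> rw [a, b] <;> simp [e']
  have h5 : (M * diagExp ((j - i) * pairLength Γ η') * M⁻¹) 0 1 = 0 := by
    have h6 := h2.1
    change (transMatrix σ σ (dblOut q * τ j * (dblOut q * τ i)⁻¹)) 0 1 = 0 at h6
    rw [h3] at h6
    rcases h4 with h4 | h4 <;> rw [h4] at h6
    · exact h6
    · rwa [neg_entries, neg_eq_zero] at h6
  obtain ⟨i1, i2, i3, i4⟩ := inv_entries M
  obtain ⟨r1, r2, r3, r4⟩ := right_diagExp_entries ((j - i) * pairLength Γ η') M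
  rw [mul_entries, r1, r2, i2, i4] at h5
  have h7 : M 0 0 * M 0 1 * (Real.exp (-((j - i) * pairLength Γ η') / 2) -
      Real.exp ((j - i) * pairLength Γ η' / 2)) = 0 := by linear_combination h5
  have h8 := (mul_eq_zero.1 h7).resolve_left (mul_ne_zero hq.1 hq.2.1)
  have h9 := Real.exp_injective (sub_eq_zero.1 h8)
  have h10 : ((j : ℝ) - i) * pairLength Γ η' = 0 := by linarith
  have h11 := (mul_eq_zero.1 h10).resolve_right hl'.ne'
  have : (j : ℝ) = i := by linarith
  exact_mod_cast this.symm

/-- In p = h q k the factor k agrees up to sign with some τ j, and a sign does not change whether a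
matrix is diagonal. Thus p and q · τ j lie in one right coset. -/
lemma range_rightMk_mul (hη : IsHyperbolicPair Γ η) (hη' : IsHyperbolicPair Γ η')
    (hσ : IsScaling η σ) (hσ' : IsScaling η' σ') {τ : ℤ → Γ}
    (hτ' : ∀ j, transMatrix σ' σ' (τ j) = diagExp (j * pairLength Γ η') ∨
      transMatrix σ' σ' (τ j) = -diagExp (j * pairLength Γ η')) :
    Set.range (fun x : NondegCosets Γ η η' σ σ' × ℤ => rightMk Γ η (dblOut x.1.1 * τ x.2)) =
      {p | Nondeg (transMatrix σ σ' p.out)} := by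
  have e' : ∀ g : SL(2, ℝ), (-g)⁻¹ = -g⁻¹ := fun g => by
    rw [inv_eq_iff_mul_eq_one]; simp
  ext p
  constructor
  · rintro ⟨⟨⟨q, hq⟩, j⟩, rfl⟩
    simp only [mem_ofPred_eq]
    rw [nondeg_rightMk hη hσ, transMatrix_mul']
    rcases hτ' j with h | h <;> rw [h]
    · rwa [nondeg_right_diagExp]
    · rwa [mul_neg, nondeg_neg, nondeg_right_diagExp]
  · intro hp
    obtain ⟨h, hh, k, hk, hhk⟩ := dblMk_eq_iff.1 (dblMk_dblOut (dblMk Γ η η' p.out))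
    set q := dblMk Γ η η' p.out
    obtain ⟨j, hj⟩ := exists_eq_diagExp hη' hσ' hk
    obtain ⟨i, hi⟩ := exists_eq_diagExp hη hσ hh
    change transMatrix σ' σ' k = _ ∨ transMatrix σ' σ' k = _ at hj
    change transMatrix σ σ h = _ ∨ transMatrix σ σ h = _ at hi
    have hpm : transMatrix σ σ' p.out = transMatrix σ σ h * transMatrix σ σ' (dblOut q) *
        transMatrix σ' σ' k := by
      rw [hhk, transMatrix_mul', transMatrix_mul]
    have hqn : Nondeg (transMatrix σ σ' (dblOut q)) := by
      simp only [mem_ofPred_eq, hpm] at hp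
      rcases hi with a | a <;> rcases hj with b | b <;> rw [a, b] at hp <;>
        simpa [nondeg_neg, nondeg_left_diagExp, nondeg_right_diagExp] using hp
    refine ⟨(⟨q, hqn⟩, j), ?_⟩
    simp only
    conv_rhs => rw [← rightMk_out p]
    rw [rightMk_eq_iff, mem_pairStab_iff hσ]
    have h3 : transMatrix σ σ (p.out * (dblOut q * τ j)⁻¹) = transMatrix σ σ h *
        (transMatrix σ σ' (dblOut q) * (transMatrix σ' σ' k * (transMatrix σ' σ' (τ j))⁻¹) *
          (transMatrix σ σ' (dblOut q))⁻¹) := by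
      rw [hhk]; simp only [transMatrix]; push_cast; group
    change transMatrix σ σ (p.out * (dblOut q * τ j)⁻¹) 0 1 = 0 ∧
      transMatrix σ σ (p.out * (dblOut q * τ j)⁻¹) 1 0 = 0
    have h4 : transMatrix σ σ (p.out * (dblOut q * τ j)⁻¹) = transMatrix σ σ h ∨
        transMatrix σ σ (p.out * (dblOut q * τ j)⁻¹) = -transMatrix σ σ h := by
      rw [h3]
      rcases hj with a | a <;> rcases hτ' j with b | b <;> rw [a, b] <;> simp [e']
    have h5 := (mem_pairStab_iff hσ h).1 hh
    rcases h4 with h4 | h4 <;> rw [h4]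
    · exact h5
    · rw [neg_entries, neg_entries, neg_eq_zero, neg_eq_zero]
      exact h5

/-- The sum over `Γ_η \ Γ`, split according to the double cosets. -/
theorem tsum_rightCosets (hη : IsHyperbolicPair Γ η) (hη' : IsHyperbolicPair Γ η')
    (hσ : IsScaling η σ) (hσ' : IsScaling η' σ') {G : SL(2, ℝ) → ℂ}
    (hG : LeftInvariant (pairLength Γ η) G)
    (hs : Summable fun p : RightCosets Γ η => G (transMatrix σ σ' p.out)) :
    (Summable fun x : NondegCosets Γ η η' σ σ' × ℤ =>
      G (transMatrix σ σ' (dblOut x.1.1) * diagExp (x.2 * pairLength Γ η'))) ∧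
    ∑' p : RightCosets Γ η, G (transMatrix σ σ' p.out) =
      ∑' x : NondegCosets Γ η η' σ σ' × ℤ,
        G (transMatrix σ σ' (dblOut x.1.1) * diagExp (x.2 * pairLength Γ η')) +
      ∑' p : RightCosets Γ η, {p : RightCosets Γ η | transMatrix σ σ' p.out 0 1 = 0 ∧
        transMatrix σ σ' p.out 1 0 = 0}.indicator (fun p => G (transMatrix σ σ' p.out)) p +
      ∑' p : RightCosets Γ η, {p : RightCosets Γ η | transMatrix σ σ' p.out 0 0 = 0 ∧
        transMatrix σ σ' p.out 1 1 = 0}.indicator (fun p => G (transMatrix σ σ' p.out)) p := by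
  choose τ hτ hτ' using exists_pairStab_diagExp hη' hσ'
  set f : RightCosets Γ η → ℂ := fun p => G (transMatrix σ σ' p.out) with hf
  set E := fun x : NondegCosets Γ η η' σ σ' × ℤ => rightMk Γ η (dblOut x.1.1 * τ x.2)
  have hE : Function.Injective E := rightMk_mul_injective hη' hσ hσ' hτ hτ'
  have hR : Set.range E = {p | Nondeg (transMatrix σ σ' p.out)} :=
    range_rightMk_mul hη hη' hσ hσ' hτ'
  have hfE : ∀ x, f (E x) =
      G (transMatrix σ σ' (dblOut x.1.1) * diagExp (x.2 * pairLength Γ η')) := by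
    intro x
    rw [hf]
    simp only [E]
    rw [hG.out_rightMk hη hσ, transMatrix_mul']
    rcases hτ' x.2 with h | h <;> rw [show transMatrix σ' σ' (τ x.2) = _ from h]
    rw [mul_neg, hG.neg]
  have hsE : Summable (f ∘ E) := hs.comp_injective hE
  have hsum : ∑' x, f (E x) = ∑' p, (Set.range E).indicator f p := by
    rw [← tsum_subtype, ← (Equiv.ofInjective E hE).tsum_eq]
    rfl
  refine ⟨hsE.congr hfE, ?_⟩
  rw [← tsum_congr hfE, hsum, ← (hs.indicator _).tsum_add (hs.indicator _),
    ← ((hs.indicator _).add (hs.indicator _)).tsum_add (hs.indicator _)]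
  refine tsum_congr fun p => ?_
  rw [hR]
  -- Exactly one of the three indicators is nonzero at each coset: the trichotomy gives at least
  -- one, the determinant at most one.
  have ht := entries_trichotomy hη hη' hσ hσ' (M := transMatrix σ σ' p.out) ⟨_, p.out.2, rfl⟩
  have hd := det_entries (transMatrix σ σ' p.out)
  simp only [Set.indicator, mem_ofPred_eq, Nondeg]
  by_cases h1 : transMatrix σ σ' p.out 0 1 = 0
  · have h2 : transMatrix σ σ' p.out 0 0 ≠ 0 := by
      intro h; rw [h1, h] at hd; norm_num at hd
    simp_all
  · by_cases h2 : transMatrix σ σ' p.out 0 0 = 0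
    · simp_all
    · simp_all

/-- The quotient of two diagonal matrices is diagonal and so comes from Γ_η: all diagonal
representatives lie in one coset. -/
lemma tsum_indicator_diag (hη : IsHyperbolicPair Γ η) (hσ : IsScaling η σ) {G : SL(2, ℝ) → ℂ}
    (hG : LeftInvariant (pairLength Γ η) G) {γ : Γ}
    (h01 : transMatrix σ σ' γ 0 1 = 0) (h10 : transMatrix σ σ' γ 1 0 = 0) :
    ∑' p : RightCosets Γ η, {p : RightCosets Γ η | transMatrix σ σ' p.out 0 1 = 0 ∧
        transMatrix σ σ' p.out 1 0 = 0}.indicator (fun p => G (transMatrix σ σ' p.out)) p =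
      G (transMatrix σ σ' γ) := by
  have hset : {p : RightCosets Γ η | transMatrix σ σ' p.out 0 1 = 0 ∧
        transMatrix σ σ' p.out 1 0 = 0} = {rightMk Γ η γ} := by
    ext p
    simp only [mem_ofPred_eq, mem_singleton_iff]
    have key : ∀ g h : SL(2, ℝ), h 0 1 = 0 → h 1 0 = 0 → (g * h⁻¹) 0 1 = g 0 1 * h 0 0 ∧
        (g * h⁻¹) 1 0 = g 1 0 * h 1 1 := by
      intro g h e1 e2
      obtain ⟨i1, i2, i3, i4⟩ := inv_entries h
      simp [mul_entries, i1, i2, i3, i4, e1, e2]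
    have hd := det_entries (transMatrix σ σ' γ)
    rw [h01, zero_mul, sub_zero] at hd
    have n0 := left_ne_zero_of_mul_eq_one hd
    have n1 := right_ne_zero_of_mul_eq_one hd
    conv_rhs => rw [← rightMk_out p, eq_comm, rightMk_eq_iff, mem_pairStab_iff hσ]
    have e : σ⁻¹ * ((p.out * γ⁻¹ : Γ) : SL(2, ℝ)) * σ =
        transMatrix σ σ' p.out * (transMatrix σ σ' γ)⁻¹ := by
      simp only [transMatrix]; push_cast; group
    rw [e, (key _ _ h01 h10).1, (key _ _ h01 h10).2, mul_eq_zero, mul_eq_zero, or_iff_left n0,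
      or_iff_left n1]
  rw [hset, tsum_eq_single (rightMk Γ η γ)]
  · rw [Set.indicator_of_mem (mem_singleton _), hG.out_rightMk hη hσ]
  · intro p hp
    exact Set.indicator_of_notMem (by simpa using hp) _

/-- The quotient of two antidiagonal matrices is again diagonal, so here too there is only one
coset. -/
lemma tsum_indicator_antidiag (hη : IsHyperbolicPair Γ η) (hσ : IsScaling η σ) {G : SL(2, ℝ) → ℂ}
    (hG : LeftInvariant (pairLength Γ η) G) {γ : Γ}
    (h00 : transMatrix σ σ' γ 0 0 = 0) (h11 : transMatrix σ σ' γ 1 1 = 0) :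
    ∑' p : RightCosets Γ η, {p : RightCosets Γ η | transMatrix σ σ' p.out 0 0 = 0 ∧
        transMatrix σ σ' p.out 1 1 = 0}.indicator (fun p => G (transMatrix σ σ' p.out)) p =
      G (transMatrix σ σ' γ) := by
  have hset : {p : RightCosets Γ η | transMatrix σ σ' p.out 0 0 = 0 ∧
        transMatrix σ σ' p.out 1 1 = 0} = {rightMk Γ η γ} := by
    ext p
    simp only [mem_ofPred_eq, mem_singleton_iff]
    have key : ∀ g h : SL(2, ℝ), h 0 0 = 0 → h 1 1 = 0 → (g * h⁻¹) 0 1 = -(g 0 0 * h 0 1) ∧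
        (g * h⁻¹) 1 0 = -(g 1 1 * h 1 0) := by
      intro g h e1 e2
      obtain ⟨i1, i2, i3, i4⟩ := inv_entries h
      simp [mul_entries, i1, i2, i3, i4, e1, e2]
    have hd := det_entries (transMatrix σ σ' γ)
    rw [h00, zero_mul, zero_sub, ← neg_mul] at hd
    have n0 := neg_ne_zero.1 (left_ne_zero_of_mul_eq_one hd)
    have n1 := right_ne_zero_of_mul_eq_one hd
    conv_rhs => rw [← rightMk_out p, eq_comm, rightMk_eq_iff, mem_pairStab_iff hσ]
    have e : σ⁻¹ * ((p.out * γ⁻¹ : Γ) : SL(2, ℝ)) * σ =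
        transMatrix σ σ' p.out * (transMatrix σ σ' γ)⁻¹ := by
      simp only [transMatrix]; push_cast; group
    rw [e, (key _ _ h00 h11).1, (key _ _ h00 h11).2, neg_eq_zero, neg_eq_zero, mul_eq_zero,
      mul_eq_zero, or_iff_left n0, or_iff_left n1]
  rw [hset, tsum_eq_single (rightMk Γ η γ)]
  · rw [Set.indicator_of_mem (mem_singleton _), hG.out_rightMk hη hσ]
  · intro p hp
    exact Set.indicator_of_notMem (by simpa using hp) _

end Cosets


/-! ### Fourier expansions of periodic holomorphic functions on a strip -/

/-- The strip `0 < im w < π`, which the exponential maps onto the upper half-plane. -/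
def piStrip : Set ℂ := {w | 0 < w.im ∧ w.im < π}

lemma isOpen_piStrip : IsOpen piStrip :=
  (isOpen_lt continuous_const Complex.continuous_im).inter
    (isOpen_lt Complex.continuous_im continuous_const)

lemma add_mul_I_mem_piStrip {x v : ℝ} (h0 : 0 < v) (h1 : v < π) : (x + v * I : ℂ) ∈ piStrip := by
  simp [piStrip, h0, h1]

/-- The `n`-th coefficient of the expansion of an `L`-periodic function in `e ^ (2 π i n w / L)`,
computed on the line `im w = v`. -/
def stripCoeff (L : ℝ) (h : ℂ → ℂ) (v : ℝ) (n : ℤ) : ℂ :=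
  ∫ x in (0 : ℝ)..1, h (L * x + v * I) * exp (-(2 * π * I * n / L) * (L * x + v * I))

variable {L : ℝ} {h : ℂ → ℂ}

lemma exp_two_pi_period (hL : 0 < L) (n : ℤ) (w : ℂ) :
    exp (2 * π * I * n / L * (w + L)) = exp (2 * π * I * n / L * w) := by
  have hL' : (L : ℂ) ≠ 0 := by exact_mod_cast hL.ne'
  rw [mul_add, exp_add, div_mul_cancel₀ _ hL', show 2 * π * I * n = n * (2 * π * I) by ring,
    exp_int_mul_two_pi_mul_I, mul_one]

/-- Cauchy's theorem on the rectangle of width L between the two heights; its vertical sides cancel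
by periodicity. -/
lemma stripCoeff_eq (hL : 0 < L) (hd : DifferentiableOn ℂ h piStrip)
    (hp : ∀ w ∈ piStrip, h (w + L) = h w) {v₁ v₂ : ℝ} (h1 : v₁ ∈ Ioo 0 π) (h2 : v₂ ∈ Ioo 0 π)
    (n : ℤ) : stripCoeff L h v₁ n = stripCoeff L h v₂ n := by
  set φ : ℂ → ℂ := fun w => h w * exp (-(2 * π * I * n / L) * w) with hφ
  have hφp : ∀ w ∈ piStrip, φ (w + L) = φ w := by
    intro w hw
    have := exp_two_pi_period hL (-n) w
    rw [hφ]
    simp only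
    rw [hp w hw]
    congr 1
    convert this using 2 <;> push_cast <;> ring
  have hsub : ∀ v ∈ uIcc v₁ v₂, v ∈ Ioo 0 π := fun v hv =>
    ⟨(lt_min h1.1 h2.1).trans_le hv.1, hv.2.trans_lt (max_lt h1.2 h2.2)⟩
  have key := Complex.integral_boundary_rect_eq_zero_of_differentiableOn φ (v₁ * I) (L + v₂ * I) (by
    refine DifferentiableOn.mul (hd.mono ?_) (by fun_prop)
    intro w hw
    rw [mem_reProdIm] at hw
    have := hsub w.im (by simpa using hw.2)
    exact this)
  have hside : (∫ y in v₁..v₂, φ (L + y * I)) = ∫ y in v₁..v₂, φ ((0 : ℝ) + y * I) := by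
    refine intervalIntegral.integral_congr fun y hy => ?_
    obtain ⟨hy0, hy1⟩ := hsub y hy
    have := hφp _ (add_mul_I_mem_piStrip (x := 0) hy0 hy1)
    rw [← this]
    congr 1
    push_cast; ring
  simp only [mul_im, ofReal_re, I_im, mul_one, ofReal_im, I_re, mul_zero, add_zero, mul_re,
    sub_zero, add_re, add_im, zero_add] at key
  rw [hside] at key
  have hscale : ∀ v : ℝ, stripCoeff L h v n = L⁻¹ • ∫ x in (0 : ℝ)..L, φ (x + v * I) := by
    intro v
    have := intervalIntegral.integral_comp_mul_left (a := 0) (b := 1)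
      (fun x : ℝ => φ (x + v * I)) hL.ne'
    rw [mul_zero, mul_one] at this
    rw [← this, stripCoeff]
    simp [hφ]
  rw [hscale, hscale]
  congr 1
  simpa [sub_eq_zero] using key

lemma continuous_strip_line (hd : DifferentiableOn ℂ h piStrip) {v : ℝ} (hv : v ∈ Ioo 0 π) :
    Continuous fun x : ℝ => h (L * x + v * I) := by
  refine hd.continuousOn.comp_continuous (by fun_prop) fun x => ?_
  have := add_mul_I_mem_piStrip (x := L * x) hv.1 hv.2
  simpa using this

lemma norm_stripCoeff_le (hd : DifferentiableOn ℂ h piStrip) {v : ℝ} (hv : v ∈ Ioo 0 π) :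
    ∃ K : ℝ, 0 ≤ K ∧ ∀ n : ℤ, ‖stripCoeff L h v n‖ ≤ K * Real.exp (2 * π * n * v / L) := by
  obtain ⟨K, hK⟩ := (isCompact_Icc (a := (0 : ℝ)) (b := 1)).exists_bound_of_continuousOn
    (continuous_strip_line (L := L) hd hv).continuousOn
  refine ⟨K, (norm_nonneg _).trans (hK 0 (by simp)), fun n => ?_⟩
  have : ∀ x ∈ uIoc (0 : ℝ) 1, ‖h (L * x + v * I) * exp (-(2 * π * I * n / L) * (L * x + v * I))‖ ≤
      K * Real.exp (2 * π * n * v / L) := by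
    intro x hx
    rw [uIoc_of_le zero_le_one] at hx
    rw [norm_mul, norm_exp]
    have e : (-(2 * π * I * n / L) * (L * x + v * I) : ℂ).re = 2 * π * n * v / L := by
      have : (-(2 * π * I * n / L) * (L * x + v * I) : ℂ) =
          ((2 * π * n * v / L : ℝ) : ℂ) + ((-(2 * π * n / L) * (L * x) : ℝ) : ℂ) * I := by
        push_cast
        linear_combination -(2 * π * n / L * v : ℂ) * I_mul_I
      rw [this]; simp
    rw [e]
    gcongr
    exact hK x ⟨hx.1.le, hx.2⟩
  simpa [stripCoeff] using intervalIntegral.norm_integral_le_of_norm_le_const this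

lemma summable_exp_neg_abs {δ : ℝ} (hδ : 0 < δ) : Summable fun n : ℤ => Real.exp (-(δ * |(n : ℝ)|)) := by
  have h1 : Summable fun n : ℕ => Real.exp (-δ) ^ n :=
    summable_geometric_of_lt_one (Real.exp_pos _).le (Real.exp_lt_one_iff.2 (by linarith))
  have h2 : Summable fun n : ℕ => Real.exp (-(δ * n)) := by
    refine h1.congr fun n => ?_
    rw [← Real.exp_nat_mul]; ring_nf
  refine Summable.of_nat_of_neg ?_ ?_ <;> simpa using h2

/-- A periodic holomorphic function on a strip is the sum of its Fourier series. -/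
theorem hasSum_stripCoeff (hL : 0 < L) (hd : DifferentiableOn ℂ h piStrip)
    (hp : ∀ w ∈ piStrip, h (w + L) = h w) {w : ℂ} (hw : w ∈ piStrip) :
    HasSum (fun n : ℤ => stripCoeff L h (π / 2) n * exp (2 * π * I * n / L * w)) (h w) := by
  have hL' : (L : ℂ) ≠ 0 := by exact_mod_cast hL.ne'
  obtain ⟨hw0, hw1⟩ := hw
  set v := w.im with hv
  have hvm : v ∈ Ioo 0 π := ⟨hw0, hw1⟩
  have hpi : π / 2 ∈ Ioo 0 π := ⟨by positivity, by linarith [Real.pi_pos]⟩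
  have hcont := continuous_strip_line (L := L) hd hvm
  have hper : Function.Periodic (fun x : ℝ => h (L * x + v * I)) 1 := by
    intro x
    have hm := add_mul_I_mem_piStrip (x := L * x) hw0 hw1
    simp only
    rw [ofReal_mul] at hm
    rw [← hp _ hm]
    congr 1
    push_cast; ring
  have : Fact ((0 : ℝ) < 1) := ⟨one_pos⟩
  let f : C(AddCircle (1 : ℝ), ℂ) := ⟨hper.lift, continuous_coinduced_dom.mpr hcont⟩
  have hcoeff : ∀ n : ℤ, fourierCoeff f n =
      stripCoeff L h (π / 2) n * exp (2 * π * I * n / L * (v * I)) := by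
    intro n
    rw [stripCoeff_eq hL hd hp hpi hvm, fourierCoeff_eq_intervalIntegral f n 0, stripCoeff,
      ← intervalIntegral.integral_mul_const]
    simp only [zero_add, one_div, inv_one, one_smul]
    refine intervalIntegral.integral_congr fun x _ => ?_
    change fourier (-n) (x : AddCircle (1 : ℝ)) • h (L * x + v * I) = _
    rw [fourier_coe_apply, smul_eq_mul, mul_assoc (h _), ← exp_add, mul_comm]
    congr 2
    field_simp
    push_cast
    ring
  -- Independence of the height gives exponential decay: the coefficients with n ≥ 0 are estimated
  -- on the line at height v - δ and those with n ≤ 0 on the line at height v + δ, which gains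
  -- e^(-2πδ|n|/L).
  have hsum : Summable (fourierCoeff f) := by
    obtain ⟨δ, hδ0, hδ1, hδ2⟩ : ∃ δ : ℝ, 0 < δ ∧ v - δ ∈ Ioo 0 π ∧ v + δ ∈ Ioo 0 π := by
      refine ⟨min v (π - v) / 2, ?_, ?_, ?_⟩
      · have : 0 < min v (π - v) := lt_min hw0 (by linarith)
        linarith
      · have := min_le_left v (π - v)
        have : 0 < min v (π - v) := lt_min hw0 (by linarith)
        constructor <;> linarith
      · have := min_le_right v (π - v)
        have : 0 < min v (π - v) := lt_min hw0 (by linarith)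
        constructor <;> linarith
    obtain ⟨K₁, hK₁, hb₁⟩ := norm_stripCoeff_le (L := L) hd hδ1
    obtain ⟨K₂, hK₂, hb₂⟩ := norm_stripCoeff_le (L := L) hd hδ2
    have hδ' : 0 < 2 * π * δ / L := by positivity
    refine Summable.of_norm_bounded ((summable_exp_neg_abs hδ').mul_left (K₁ + K₂)) fun n => ?_
    have he : ‖exp (2 * π * I * n / L * (v * I))‖ = Real.exp (-(2 * π * n * v / L)) := by
      rw [norm_exp]
      congr 1
      have : (2 * π * I * n / L * (v * I) : ℂ) = ((-(2 * π * n * v / L) : ℝ) : ℂ) := by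
        push_cast
        linear_combination (2 * π * n / L * v : ℂ) * I_mul_I
      rw [this, ofReal_re]
    rw [hcoeff, norm_mul, he]
    rcases le_total 0 (n : ℝ) with hn | hn
    · rw [stripCoeff_eq hL hd hp hpi hδ1]
      calc _ ≤ K₁ * Real.exp (2 * π * n * (v - δ) / L) * Real.exp (-(2 * π * n * v / L)) := by
            gcongr; exact hb₁ n
        _ = K₁ * Real.exp (-(2 * π * δ / L * |(n : ℝ)|)) := by
            rw [mul_assoc, ← Real.exp_add, abs_of_nonneg hn]; ring_nf
        _ ≤ _ := by gcongr; linarith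
    · rw [stripCoeff_eq hL hd hp hpi hδ2]
      calc _ ≤ K₂ * Real.exp (2 * π * n * (v + δ) / L) * Real.exp (-(2 * π * n * v / L)) := by
            gcongr; exact hb₂ n
        _ = K₂ * Real.exp (-(2 * π * δ / L * |(n : ℝ)|)) := by
            rw [mul_assoc, ← Real.exp_add, abs_of_nonpos hn]; ring_nf
        _ ≤ _ := by gcongr; linarith
  have hfin := has_pointwise_sum_fourier_series_of_summable hsum ((w.re / L : ℝ) : AddCircle (1 : ℝ))
  have hval : f ((w.re / L : ℝ) : AddCircle (1 : ℝ)) = h w := by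
    change h (L * ((w.re / L : ℝ) : ℂ) + v * I) = h w
    congr 1
    push_cast
    rw [mul_div_cancel₀ _ hL', hv, re_add_im]
  rw [hval] at hfin
  refine hfin.congr_fun fun n => ?_
  rw [hcoeff, fourier_coe_apply, smul_eq_mul, mul_assoc (stripCoeff _ _ _ _), ← exp_add]
  congr 2
  conv_lhs => rw [← re_add_im w]
  push_cast
  field_simp
  ring

/-- The coefficients of a Fourier series on a strip are determined by its sum. -/
theorem stripCoeff_unique (hL : 0 < L) {c : ℤ → ℂ}
    (hc : ∀ w ∈ piStrip, HasSum (fun n : ℤ => c n * exp (2 * π * I * n / L * w)) (h w)) :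
    c = stripCoeff L h (π / 2) := by
  have hL' : (L : ℂ) ≠ 0 := by exact_mod_cast hL.ne'
  have hline : ∀ x : ℝ, (L * x + (π / 2 : ℝ) * I : ℂ) ∈ piStrip := fun x => by
    have := add_mul_I_mem_piStrip (x := L * x) (v := π / 2) (by positivity)
      (by linarith [Real.pi_pos])
    simpa using this
  funext m
  let f : ℤ → C(ℝ, ℂ) := fun n => ⟨fun x : ℝ => c n * exp (2 * π * I * n / L *
    (L * x + (π / 2 : ℝ) * I)) * exp (-(2 * π * I * m / L) * (L * x + (π / 2 : ℝ) * I)),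
    by fun_prop⟩
  -- On a horizontal line each term has constant modulus, so summability at one point is uniform and
  -- permits termwise integration.
  have hnorm : ∀ n (x : ℝ), ‖f n x‖ = ‖f n 0‖ := by
    intro n x
    simp only [f, ContinuousMap.coe_mk, norm_mul, norm_exp]
    have : ∀ (j : ℤ) (y : ℝ), (2 * π * I * j / L * (L * y + (π / 2 : ℝ) * I) : ℂ).re =
        -(2 * π * j * (π / 2) / L) := by
      intro j y
      have : (2 * π * I * j / L * (L * y + (π / 2 : ℝ) * I) : ℂ) =
          ((-(2 * π * j * (π / 2) / L) : ℝ) : ℂ) + ((2 * π * j / L * (L * y) : ℝ) : ℂ) * I := by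
        push_cast
        linear_combination (2 * π * j / L * (π / 2) : ℂ) * I_mul_I
      rw [this]; simp
    simp only [neg_mul, neg_re, this]
  have hs0 : Summable fun n => ‖f n 0‖ := by
    have := (hc _ (hline 0)).summable.norm.mul_right
      ‖exp (-(2 * π * I * m / L) * (L * (0 : ℝ) + (π / 2 : ℝ) * I))‖
    refine this.congr fun n => ?_
    rw [← norm_mul]; rfl
  have hs : Summable fun n => ‖(f n).restrict (⟨uIcc 0 1, isCompact_uIcc⟩ :
      TopologicalSpace.Compacts ℝ)‖ := by
    refine Summable.of_nonneg_of_le (fun n => norm_nonneg _) (fun n => ?_) hs0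
    rw [ContinuousMap.norm_le _ (norm_nonneg _)]
    rintro ⟨x, hx⟩
    exact (hnorm n x).le
  have hI := intervalIntegral.hasSum_intervalIntegral_of_summable_norm hs
  have hsum : ∀ x : ℝ, ∑' n, f n x =
      h (L * x + (π / 2 : ℝ) * I) * exp (-(2 * π * I * m / L) * (L * x + (π / 2 : ℝ) * I)) :=
    fun x => ((hc _ (hline x)).mul_right _).tsum_eq
  have hval : ∀ n, (∫ x in (0 : ℝ)..1, f n x) = if n = m then c m else 0 := by
    intro n
    have e : ∀ x : ℝ, f n x = c n * exp (2 * π * I * (n - m) / L * ((π / 2 : ℝ) * I)) *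
        exp (2 * π * I * (n - m) * x) := by
      intro x
      simp only [f, ContinuousMap.coe_mk]
      rw [mul_assoc (c n), ← exp_add, mul_assoc (c n), ← exp_add]
      congr 2
      field_simp
      ring
    simp_rw [e]
    rw [intervalIntegral.integral_const_mul]
    split_ifs with hnm
    · subst hnm; simp
    · have hne : (2 * π * I * (n - m) : ℂ) ≠ 0 := by
        have : (n : ℂ) - m ≠ 0 := sub_ne_zero.2 (by exact_mod_cast hnm)
        have := Real.pi_ne_zero
        simp [*]
      rw [integral_exp_mul_complex hne]
      have h1 : exp (2 * π * I * (n - m)) = 1 := by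
        have := exp_int_mul_two_pi_mul_I (n - m)
        rw [← this]; congr 1; push_cast; ring
      simp [h1]
  simp_rw [hval, hsum] at hI
  have := hI.unique (hasSum_ite_eq m (c m))
  rw [stripCoeff, this]


/-! ### The terms of the Poincaré series in logarithmic coordinates -/

/-- The numerator `a z + b` at `z = e ^ w`. -/
def expNum (g : SL(2, ℝ)) (w : ℂ) : ℂ := g 0 0 * exp w + g 0 1

/-- The denominator `c z + d` at `z = e ^ w`. -/
def expDen (g : SL(2, ℝ)) (w : ℂ) : ℂ := g 1 0 * exp w + g 1 1

/-- The function `z ^ j ((z ^ (-j + s)) |_{2j} g)(z)` at `z = e ^ w`. -/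
def hypTerm (j : ℕ) (s : ℂ) (g : SL(2, ℝ)) (w : ℂ) : ℂ :=
  exp (j * w) * (expDen g w ^ (2 * j))⁻¹ * (expNum g w / expDen g w) ^ (-(j : ℂ) + s)

lemma exp_im_pos {w : ℂ} (hw : w ∈ piStrip) : 0 < (exp w).im := by
  rw [exp_im]
  exact mul_pos (Real.exp_pos _) (Real.sin_pos_of_pos_of_lt_pi hw.1 hw.2)

lemma log_exp_piStrip {w : ℂ} (hw : w ∈ piStrip) : log (exp w) = w :=
  log_exp (by linarith [hw.1, Real.pi_pos]) hw.2.le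

lemma log_mem_piStrip {z : ℂ} (hz : 0 < z.im) : log z ∈ piStrip := by
  have h1 : 0 < arg z := by
    rcases (arg_nonneg_iff.2 hz.le).lt_or_eq with h | h
    · exact h
    · have := arg_eq_zero_iff.1 h.symm
      exact absurd this.2 hz.ne'
  have h2 : arg z < π := by
    refine lt_of_le_of_ne (arg_le_pi z) fun h => ?_
    exact hz.ne' (arg_eq_pi_iff.1 h).2
  simp only [piStrip, mem_ofPred_eq, log_im]
  exact ⟨h1, h2⟩

lemma normSq_real_linear (a b : ℝ) (z : ℂ) :
    ‖(a * z + b : ℂ)‖ ^ 2 = (a * z.re + b) ^ 2 + (a * z.im) ^ 2 := by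
  rw [← normSq_eq_norm_sq, normSq_apply]
  simp
  ring

lemma real_linear_ne_zero {a b : ℝ} {z : ℂ} (hz : 0 < z.im) (h : 0 < a ^ 2 + b ^ 2) :
    (a * z + b : ℂ) ≠ 0 := by
  intro h0
  have h1 := normSq_real_linear a b z
  rw [h0, norm_zero] at h1
  have h2 : a * z.im = 0 := by nlinarith [sq_nonneg (a * z.re + b), sq_nonneg (a * z.im)]
  have h3 : a = 0 := (mul_eq_zero.1 h2).resolve_right hz.ne'
  rw [h3] at h1 h
  have h4 : b = 0 := by nlinarith
  rw [h4] at h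
  norm_num at h

lemma expNum_ne_zero (g : SL(2, ℝ)) {w : ℂ} (hw : w ∈ piStrip) : expNum g w ≠ 0 :=
  real_linear_ne_zero (exp_im_pos hw) (sqSum_rows_pos g).1

lemma expDen_ne_zero (g : SL(2, ℝ)) {w : ℂ} (hw : w ∈ piStrip) : expDen g w ≠ 0 :=
  real_linear_ne_zero (exp_im_pos hw) (sqSum_rows_pos g).2

lemma moebius_im_pos (g : SL(2, ℝ)) {w : ℂ} (hw : w ∈ piStrip) :
    0 < (expNum g w / expDen g w).im := by
  have hz := exp_im_pos hw
  have hD := normSq_pos.2 (expDen_ne_zero g hw)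
  have hd := det_entries g
  have h : (expNum g w).im * (expDen g w).re - (expNum g w).re * (expDen g w).im =
      (exp w).im := by
    simp [expNum, expDen]
    linear_combination (exp w).im * hd
  rw [div_im, ← sub_div, h]
  exact div_pos hz hD

lemma differentiableOn_hypTerm (j : ℕ) (s : ℂ) (g : SL(2, ℝ)) :
    DifferentiableOn ℂ (hypTerm j s g) piStrip := by
  intro w hw
  have hD := expDen_ne_zero g hw
  have hsl : expNum g w / expDen g w ∈ slitPlane := Or.inr (moebius_im_pos g hw).ne'
  have h1 : DifferentiableAt ℂ (expNum g) w := by unfold expNum; fun_prop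
  have h2 : DifferentiableAt ℂ (expDen g) w := by unfold expDen; fun_prop
  have h3 : DifferentiableAt ℂ (fun w => expNum g w / expDen g w) w := h1.div h2 hD
  have h4 : DifferentiableAt ℂ (fun w => exp (j * w) * (expDen g w ^ (2 * j))⁻¹) w :=
    (by fun_prop : DifferentiableAt ℂ (fun w : ℂ => exp (j * w)) w).mul
      ((h2.pow _).inv (pow_ne_zero _ hD))
  exact (h4.mul (h3.cpow (differentiableAt_const _) hsl)).differentiableWithinAt

lemma hypTerm_neg (j : ℕ) (s : ℂ) (g : SL(2, ℝ)) (w : ℂ) : hypTerm j s (-g) w = hypTerm j s g w := by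
  have h1 : expNum (-g) w = -expNum g w := by
    simp only [expNum, neg_entries]; push_cast; ring
  have h2 : expDen (-g) w = -expDen g w := by
    simp only [expDen, neg_entries]; push_cast; ring
  rw [hypTerm, h1, h2, neg_div_neg_eq, Even.neg_pow (even_two_mul j), hypTerm]

/-- The common factor e^(-t/2) leaves the quotient unchanged, and its power in the denominator is
exactly the change of e^(jw) under the translation. -/
lemma hypTerm_right_diagExp (j : ℕ) (s : ℂ) (g : SL(2, ℝ)) (t : ℝ) (w : ℂ) :
    hypTerm j s (g * diagExp t) w = hypTerm j s g (w + t) := by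
  obtain ⟨r1, r2, r3, r4⟩ := right_diagExp_entries t g
  have he : (Real.exp (t / 2) : ℂ) = Real.exp (-t / 2) * exp t := by
    rw [← ofReal_exp, ← ofReal_mul, ← Real.exp_add]; ring_nf
  have h1 : expNum (g * diagExp t) w = Real.exp (-t / 2) * expNum g (w + t) := by
    simp only [expNum, r1, r2, exp_add, ofReal_mul, he]; ring
  have h2 : expDen (g * diagExp t) w = Real.exp (-t / 2) * expDen g (w + t) := by
    simp only [expDen, r3, r4, exp_add, ofReal_mul, he]; ring
  have hne : (Real.exp (-t / 2) : ℂ) ≠ 0 := by exact_mod_cast (Real.exp_pos _).ne'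
  have h3 : ((Real.exp (-t / 2) : ℂ) ^ (2 * j))⁻¹ = exp (j * t) := by
    rw [ofReal_exp, ← exp_nat_mul, ← exp_neg]
    congr 1; push_cast; ring
  rw [hypTerm, h1, h2, mul_div_mul_left _ _ hne, mul_pow, mul_inv, h3, hypTerm, mul_add, exp_add]
  ring

lemma ofReal_exp_mul_cpow (t : ℝ) {x : ℂ} (hx : x ≠ 0) (p : ℂ) :
    ((Real.exp t : ℝ) * x) ^ p = exp (t * p) * x ^ p := by
  have h := Real.exp_pos t
  have h0 : (Real.exp t : ℂ) ≠ 0 := by exact_mod_cast h.ne'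
  rw [cpow_def_of_ne_zero (mul_ne_zero h0 hx), cpow_def_of_ne_zero hx, log_ofReal_mul h hx,
    Real.log_exp, add_mul, exp_add]

/-- The quotient is scaled by e^(il). Its power -j cancels the weight factor, and its power 2πim/l
(imaginary unit in the exponent) contributes a full turn e^(2πi · im) with integer im. -/
lemma hypTerm_left_diagExp {l : ℝ} (hl : 0 < l) (j : ℕ) (m i : ℤ) (g : SL(2, ℝ)) {w : ℂ}
    (hw : w ∈ piStrip) : hypTerm j (2 * π * I * m / l) (diagExp (i * l) * g) w =
      hypTerm j (2 * π * I * m / l) g w := by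
  have hl' : (l : ℂ) ≠ 0 := by exact_mod_cast hl.ne'
  obtain ⟨r1, r2, r3, r4⟩ := left_diagExp_entries (i * l) g
  have h1 : expNum (diagExp (i * l) * g) w = Real.exp (i * l / 2) * expNum g w := by
    simp only [expNum, r1, r2, ofReal_mul]; ring
  have h2 : expDen (diagExp (i * l) * g) w = Real.exp (-(i * l) / 2) * expDen g w := by
    simp only [expDen, r3, r4, ofReal_mul]; ring
  have h3 : expNum (diagExp (i * l) * g) w / expDen (diagExp (i * l) * g) w =
      (Real.exp (i * l) : ℝ) * (expNum g w / expDen g w) := by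
    rw [h1, h2, mul_div_mul_comm]
    congr 1
    rw [← ofReal_div, ← Real.exp_sub]
    congr 2; ring
  have h4 : ((Real.exp (-(i * l) / 2) : ℂ) ^ (2 * j))⁻¹ = exp (i * l * j) := by
    rw [ofReal_exp, ← exp_nat_mul, ← exp_neg]
    congr 1; push_cast; ring
  have hne : expNum g w / expDen g w ≠ 0 := div_ne_zero (expNum_ne_zero g hw) (expDen_ne_zero g hw)
  rw [hypTerm, h3, ofReal_exp_mul_cpow _ hne, h2, mul_pow, mul_inv, h4, hypTerm]
  have h5 : exp (i * l * j) * exp (((i * l : ℝ) : ℂ) * (-(j : ℂ) + 2 * π * I * m / l)) = 1 := by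
    rw [← exp_add, ← exp_int_mul_two_pi_mul_I (i * m)]
    congr 1
    push_cast
    field_simp
    ring
  linear_combination exp (j * w) * (expDen g w ^ (2 * j))⁻¹ *
    (expNum g w / expDen g w) ^ (-(j : ℂ) + 2 * π * I * m / l) * h5

/-- As s is imaginary, the s-th power only contributes the exponential of an argument. The remaining
moduli combine to |N|⁻ʲ |D|⁻ʲ, symmetric in numerator and denominator. -/
lemma norm_hypTerm_le (j : ℕ) {s : ℂ} (hs : s.re = 0) (g : SL(2, ℝ)) {w : ℂ} (hw : w ∈ piStrip) :
    ‖hypTerm j s g w‖ ≤ Real.exp (π * |s.im|) * Real.exp (j * w.re) *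
      ((‖expNum g w‖ * ‖expDen g w‖) ^ j)⁻¹ := by
  have hN := expNum_ne_zero g hw
  have hD := expDen_ne_zero g hw
  have hN' := norm_pos_iff.2 hN
  have hD' := norm_pos_iff.2 hD
  have hq : expNum g w / expDen g w ≠ 0 := div_ne_zero hN hD
  rw [hypTerm, norm_mul, norm_mul, norm_inv, norm_pow, norm_exp, norm_cpow_of_ne_zero hq, norm_div]
  have e1 : (-(j : ℂ) + s).re = -(j : ℝ) := by simp [hs]
  have e2 : (-(j : ℂ) + s).im = s.im := by simp
  have e3 : (j * w : ℂ).re = j * w.re := by simp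
  rw [e1, e2, e3, Real.rpow_neg (by positivity), Real.rpow_natCast]
  have h1 : (Real.exp (arg (expNum g w / expDen g w) * s.im))⁻¹ ≤ Real.exp (π * |s.im|) := by
    rw [← Real.exp_neg]
    apply Real.exp_le_exp.2
    calc _ ≤ |arg (expNum g w / expDen g w) * s.im| := neg_le_abs _
      _ ≤ _ := by rw [abs_mul]; gcongr; exact abs_arg_le_pi _
  have h2 : (‖expDen g w‖ ^ (2 * j))⁻¹ * ((‖expNum g w‖ / ‖expDen g w‖) ^ j)⁻¹ =
      ((‖expNum g w‖ * ‖expDen g w‖) ^ j)⁻¹ := by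
    rw [← mul_inv, div_pow, mul_pow, pow_mul']
    congr 1
    field_simp
  calc _ = Real.exp (j * w.re) * ((‖expDen g w‖ ^ (2 * j))⁻¹ *
        ((‖expNum g w‖ / ‖expDen g w‖) ^ j)⁻¹) *
        (Real.exp (arg (expNum g w / expDen g w) * s.im))⁻¹ := by ring
    _ ≤ Real.exp (j * w.re) * ((‖expDen g w‖ ^ (2 * j))⁻¹ *
        ((‖expNum g w‖ / ‖expDen g w‖) ^ j)⁻¹) * Real.exp (π * |s.im|) := by gcongr
    _ = _ := by rw [h2]; ring

/-- The locally bounded factor in the bound for the terms of the Poincaré series. -/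
def stripBound (w : ℂ) : ℝ := (1 + ‖exp w‖ ^ 2) / (exp w).im ^ 2

lemma one_le_stripBound {w : ℂ} (hw : w ∈ piStrip) : 1 ≤ stripBound w := by
  have h := exp_im_pos hw
  rw [stripBound, le_div_iff₀ (by positivity), one_mul]
  have := abs_im_le_norm (exp w)
  nlinarith [abs_of_pos h]

/-- For z = x + iy, (1 + |z|²)|az + b|² - (a² + b²)y² = (a|z|² + bx)² + (ax + b)². -/
lemma norm_real_linear_ge (a b : ℝ) {w : ℂ} (hw : w ∈ piStrip) :
    a ^ 2 + b ^ 2 ≤ stripBound w * ‖(a * exp w + b : ℂ)‖ ^ 2 := by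
  have h := exp_im_pos hw
  have hn : ‖exp w‖ ^ 2 = (exp w).re ^ 2 + (exp w).im ^ 2 := by
    rw [← normSq_eq_norm_sq, normSq_apply]; ring
  rw [normSq_real_linear, stripBound, hn, div_mul_eq_mul_div, le_div_iff₀ (by positivity)]
  set x := (exp w).re
  set y := (exp w).im
  nlinarith [sq_nonneg (a * (x ^ 2 + y ^ 2) + b * x), sq_nonneg (a * x + b)]

/-- With K = `stripBound w` and X = |N||D|, `rowProd g` ≤ (KX)² and KX ≥ 1; hence `rowProd g` ≤
(KX)^j as soon as j ≥ 2. This is where k ≥ 4 is needed. -/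
lemma norm_hypTerm_le_rowProd {j : ℕ} (hj : 2 ≤ j) {s : ℂ} (hs : s.re = 0) (g : SL(2, ℝ)) {w : ℂ}
    (hw : w ∈ piStrip) : ‖hypTerm j s g w‖ ≤
      Real.exp (π * |s.im|) * Real.exp (j * w.re) * stripBound w ^ j * (rowProd g)⁻¹ := by
  refine (norm_hypTerm_le j hs g hw).trans ?_
  rw [mul_assoc (_ * _)]
  gcongr
  have hK := one_le_stripBound hw
  have hP := one_le_rowProd g
  have hN' := norm_pos_iff.2 (expNum_ne_zero g hw)
  have hD' := norm_pos_iff.2 (expDen_ne_zero g hw)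
  have h1 : (g 0 0 ^ 2 + g 0 1 ^ 2) ≤ stripBound w * ‖expNum g w‖ ^ 2 := norm_real_linear_ge _ _ hw
  have h2 : (g 1 0 ^ 2 + g 1 1 ^ 2) ≤ stripBound w * ‖expDen g w‖ ^ 2 := norm_real_linear_ge _ _ hw
  obtain ⟨r1, r2⟩ := sqSum_rows_pos g
  obtain ⟨X, hX⟩ : ∃ X, X = ‖expNum g w‖ * ‖expDen g w‖ := ⟨_, rfl⟩
  have hX0 : 0 < X := by rw [hX]; positivity
  have h3 : rowProd g ≤ stripBound w ^ 2 * X ^ 2 := by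
    have := mul_le_mul h1 h2 r2.le (by positivity)
    rw [hX, rowProd]
    calc _ ≤ _ := this
      _ = _ := by ring
  rw [← hX]
  have h4 : 1 ≤ stripBound w * X := by
    have : (1 : ℝ) ^ 2 ≤ (stripBound w * X) ^ 2 := by
      rw [one_pow, mul_pow]; exact hP.trans h3
    exact le_of_sq_le_sq this (by positivity)
  obtain ⟨i, rfl⟩ : ∃ i, j = 2 + i := ⟨j - 2, by omega⟩
  rw [← div_eq_mul_inv, ← one_div, div_le_div_iff₀ (by positivity) (by positivity), one_mul,
    ← mul_pow, pow_add]
  calc rowProd g ≤ (stripBound w * X) ^ 2 * 1 := by rw [mul_one, mul_pow]; exact h3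
    _ ≤ _ := by gcongr; exact one_le_pow₀ h4

lemma continuousOn_stripBound : ContinuousOn stripBound piStrip := by
  unfold stripBound
  refine ContinuousOn.div (by fun_prop) (by fun_prop) fun w hw => ?_
  have := exp_im_pos hw
  positivity

/-- The continuous factor β is below β w + 1 near w, so the Weierstrass test applies locally. -/
lemma differentiableOn_tsum_of_le_mul {ι : Type*} {F : ι → ℂ → ℂ} {U : Set ℂ} (hU : IsOpen U)
    (hF : ∀ i, DifferentiableOn ℂ (F i) U) {u : ι → ℝ} (hu : Summable u) (hu0 : ∀ i, 0 ≤ u i)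
    {β : ℂ → ℝ} (hβ : ContinuousOn β U) (hle : ∀ i, ∀ w ∈ U, ‖F i w‖ ≤ β w * u i) :
    DifferentiableOn ℂ (fun w => ∑' i, F i w) U := by
  intro w hw
  have hev : ∀ᶠ z in 𝓝 w, z ∈ U ∧ β z < β w + 1 :=
    Filter.Eventually.and (hU.mem_nhds hw) ((hβ.continuousAt (hU.mem_nhds hw)).eventually_lt_const (by linarith))
  obtain ⟨V, hVs, hVo, hwV⟩ := eventually_nhds_iff.1 hev
  have := differentiableOn_tsum_of_summable_norm (hu.mul_left (β w + 1))
    (fun i => (hF i).mono fun z hz => (hVs z hz).1) hVo (fun i z hz => by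
      refine (hle i z (hVs z hz).1).trans ?_
      have := hu0 i
      gcongr
      exact (hVs z hz).2.le)
  exact (this.differentiableAt (hVo.mem_nhds hwV)).differentiableWithinAt

/-! ### The line integral of a term with nonzero entries -/

lemma integrable_exp_neg_abs : Integrable fun x : ℝ => Real.exp (-|x|) := by
  rw [← integrableOn_univ, ← Iic_union_Ioi (a := (0 : ℝ))]
  refine IntegrableOn.union ?_ ?_
  · refine (integrableOn_exp_Iic 0).congr_fun (fun x hx => ?_) measurableSet_Iic
    rw [abs_of_nonpos hx, neg_neg]
  · refine (integrableOn_exp_neg_Ioi 0).congr_fun (fun x hx => ?_) measurableSet_Ioi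
    simp only
    rw [abs_of_pos hx]

lemma pi_div_two_line (y : ℝ) : (y + (π / 2 : ℝ) * I : ℂ) ∈ piStrip :=
  add_mul_I_mem_piStrip (by positivity) (by linarith [Real.pi_pos])

lemma exp_pi_div_two_line (y : ℝ) : exp (y + (π / 2 : ℝ) * I) = Real.exp y * I := by
  rw [exp_add, ofReal_div, ofReal_ofNat, exp_pi_div_two_mul_I, ofReal_exp]

/-- The left side is (2 cosh y)⁻ʲ, and 2 cosh y ≥ e^|y| ≥ 1. -/
lemma exp_mul_inv_pow_le {j : ℕ} (hj : 1 ≤ j) (y : ℝ) :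
    Real.exp (j * y) * ((Real.exp (2 * y) + 1) ^ j)⁻¹ ≤ Real.exp (-|y|) := by
  have h1 : Real.exp (j * y) = Real.exp y ^ j := by rw [← Real.exp_nat_mul]
  rw [h1, ← inv_pow, ← mul_pow]
  have h2 : Real.exp y * (Real.exp (2 * y) + 1)⁻¹ ≤ Real.exp (-|y|) := by
    rw [← div_eq_mul_inv, div_le_iff₀ (by positivity), mul_add, mul_one, ← Real.exp_add]
    rcases le_total 0 y with h | h
    · rw [abs_of_nonneg h]
      have := Real.exp_pos (-y)
      ring_nf
      linarith
    · rw [abs_of_nonpos h]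
      have := Real.exp_pos (- -y + 2 * y)
      rw [neg_neg] at *
      linarith
  have h3 : Real.exp y * (Real.exp (2 * y) + 1)⁻¹ ≤ 1 :=
    h2.trans (Real.exp_le_one_iff.2 (neg_nonpos.2 (abs_nonneg y)))
  exact (pow_le_of_le_one (by positivity) h3 (by omega)).trans h2

/-- On this line z = i e^y and |az + b|² = a² e^(2y) + b², which is at least μ (e^(2y) + 1) when
both entries are nonzero. Nonzero entries thus give decay in both directions. -/
lemma norm_hypTerm_line_le {j : ℕ} (hj : 1 ≤ j) {s : ℂ} (hs : s.re = 0) {g : SL(2, ℝ)}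
    (hg : Nondeg g) : ∃ K : ℝ, ∀ y : ℝ, ‖hypTerm j s g (y + (π / 2 : ℝ) * I)‖ ≤
      K * Real.exp (-|y|) := by
  obtain ⟨ha, hb, hc, hd⟩ := hg
  obtain ⟨μ, hμ0, hμa, hμb, hμc, hμd⟩ : ∃ μ : ℝ, 0 < μ ∧ μ ≤ g 0 0 ^ 2 ∧ μ ≤ g 0 1 ^ 2 ∧
      μ ≤ g 1 0 ^ 2 ∧ μ ≤ g 1 1 ^ 2 := by
    refine ⟨min (min (g 0 0 ^ 2) (g 0 1 ^ 2)) (min (g 1 0 ^ 2) (g 1 1 ^ 2)), ?_, ?_, ?_, ?_, ?_⟩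
    · simp only [lt_min_iff]
      exact ⟨⟨by positivity, by positivity⟩, by positivity, by positivity⟩
    all_goals simp
  have hlin : ∀ (a b : ℝ), μ ≤ a ^ 2 → μ ≤ b ^ 2 → ∀ y : ℝ,
      μ * (Real.exp (2 * y) + 1) ≤ ‖(a * exp (y + (π / 2 : ℝ) * I) + b : ℂ)‖ ^ 2 := by
    intro a b h1 h2 y
    rw [exp_pi_div_two_line, normSq_real_linear]
    have : Real.exp (2 * y) = Real.exp y ^ 2 := by rw [← Real.exp_nat_mul]; norm_num
    rw [re_ofReal_mul, im_ofReal_mul, I_re, I_im, this]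
    nlinarith [mul_le_mul_of_nonneg_right h1 (sq_nonneg (Real.exp y))]
  refine ⟨Real.exp (π * |s.im|) * (μ ^ j)⁻¹, fun y => ?_⟩
  refine (norm_hypTerm_le j hs g (pi_div_two_line y)).trans ?_
  have e1 : ((y + (π / 2 : ℝ) * I : ℂ)).re = y := by simp
  have hN := hlin _ _ hμa hμb y
  have hD := hlin _ _ hμc hμd y
  have hX : μ * (Real.exp (2 * y) + 1) ≤
      ‖expNum g (y + (π / 2 : ℝ) * I)‖ * ‖expDen g (y + (π / 2 : ℝ) * I)‖ := by
    refine le_of_sq_le_sq ?_ (by positivity)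
    rw [sq, mul_pow]
    exact mul_le_mul hN hD (by positivity) (by positivity)
  rw [e1]
  calc _ ≤ Real.exp (π * |s.im|) * Real.exp (j * y) * ((μ * (Real.exp (2 * y) + 1)) ^ j)⁻¹ := by
        gcongr
    _ = Real.exp (π * |s.im|) * (μ ^ j)⁻¹ *
        (Real.exp (j * y) * ((Real.exp (2 * y) + 1) ^ j)⁻¹) := by
        rw [mul_pow, mul_inv]; ring
    _ ≤ _ := by gcongr; exact exp_mul_inv_pow_le hj y

lemma continuous_hypTerm_line (j : ℕ) (s : ℂ) (g : SL(2, ℝ)) :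
    Continuous fun y : ℝ => hypTerm j s g (y + (π / 2 : ℝ) * I) :=
  (differentiableOn_hypTerm j s g).continuousOn.comp_continuous (by fun_prop) pi_div_two_line

/-- The integral of `hypTerm` against `e ^ (-r w)` over the line `im w = π / 2`. -/
def lineIntegral (j : ℕ) (s r : ℂ) (g : SL(2, ℝ)) : ℂ :=
  ∫ y : ℝ, hypTerm j s g (y + (π / 2 : ℝ) * I) * exp (-r * (y + (π / 2 : ℝ) * I))

lemma norm_exp_neg_mul_line {r : ℂ} (hr : r.re = 0) (y : ℝ) :
    ‖exp (-r * (y + (π / 2 : ℝ) * I))‖ = Real.exp (r.im * (π / 2)) := by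
  rw [norm_exp]
  congr 1
  simp [hr]

lemma integrable_lineIntegral {j : ℕ} (hj : 1 ≤ j) {s r : ℂ} (hs : s.re = 0) (hr : r.re = 0)
    {g : SL(2, ℝ)} (hg : Nondeg g) :
    Integrable fun y : ℝ => hypTerm j s g (y + (π / 2 : ℝ) * I) *
      exp (-r * (y + (π / 2 : ℝ) * I)) := by
  obtain ⟨K, hK⟩ := norm_hypTerm_line_le hj hs hg
  refine Integrable.mono' ((integrable_exp_neg_abs.const_mul K).mul_const
    (Real.exp (r.im * (π / 2)))) ?_ (ae_of_all _ fun y => ?_)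
  · exact ((continuous_hypTerm_line j s g).mul (by fun_prop)).aestronglyMeasurable
  · rw [norm_mul, norm_exp_neg_mul_line hr]
    gcongr
    exact hK y

/-- Unfolding: the coefficients of the translates of `g` add up to a line integral. -/
lemma tsum_stripCoeff_right {L : ℝ} (hL : 0 < L) {j : ℕ} (hj : 1 ≤ j) {s : ℂ} (hs : s.re = 0) (n : ℤ)
    {g : SL(2, ℝ)} (hg : Nondeg g) :
    ∑' i : ℤ, stripCoeff L (hypTerm j s (g * diagExp (i * L))) (π / 2) n =
      (L : ℂ)⁻¹ * lineIntegral j s (2 * π * I * n / L) g := by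
  have hL' : (L : ℂ) ≠ 0 := by exact_mod_cast hL.ne'
  have hr : (2 * π * I * n / L : ℂ).re = 0 := by
    have : (2 * π * I * n / L : ℂ) = ((2 * π * n / L : ℝ) : ℂ) * I := by push_cast; ring
    rw [this]; simp
  have hint := integrable_lineIntegral hj hs hr hg
  have hint' := hint.comp_mul_left' hL.ne'
  have h := hint'.hasSum_intervalIntegral_comp_add_int
  rw [Measure.integral_comp_mul_left (fun y : ℝ => hypTerm j s g (y + (π / 2 : ℝ) * I) *
      exp (-(2 * π * I * n / L) * (y + (π / 2 : ℝ) * I))) L, abs_of_pos (inv_pos.2 hL)] at h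
  rw [lineIntegral, ← ofReal_inv, ← real_smul, ← h.tsum_eq]
  refine tsum_congr fun i => ?_
  rw [stripCoeff]
  refine intervalIntegral.integral_congr fun x _ => ?_
  rw [hypTerm_right_diagExp]
  congr 1
  · congr 1; push_cast; ring
  · have := exp_two_pi_period hL (-n * i) (0 : ℂ)
    have h2 : exp (-(2 * π * I * n / L) * (((L * (x + i) : ℝ) : ℂ) + (π / 2 : ℝ) * I)) =
        exp (-(2 * π * I * n / L) * (L * x + (π / 2 : ℝ) * I)) *
        exp ((-n * i : ℤ) * (2 * π * I)) := by
      rw [← exp_add]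
      congr 1
      push_cast
      field_simp
      ring
    rw [h2, exp_int_mul_two_pi_mul_I, mul_one]


/-! ### Euler's integral for the hypergeometric function -/

/-- The integrand `e ^ ((j - r) w) (1 + e ^ w) ^ (-2 j)` of a beta integral. -/
def betaKernel (j : ℕ) (r w : ℂ) : ℂ := exp ((j - r) * w) * ((1 + exp w) ^ (2 * j))⁻¹

/-- The integrand of Euler's integral. -/
def eulerKernel (j : ℕ) (r α x w : ℂ) : ℂ := betaKernel j r w * (1 - x / (1 + exp w)) ^ (-α)

lemma exp_re_nonneg {w : ℂ} (hw : |w.im| ≤ π / 2) : 0 ≤ (exp w).re := by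
  rw [exp_re]
  exact mul_nonneg (Real.exp_pos _).le
    (Real.cos_nonneg_of_mem_Icc ⟨by linarith [(abs_le.1 hw).1], (abs_le.1 hw).2⟩)

lemma one_add_norm_sq_le {u : ℂ} (hu : 0 ≤ u.re) : 1 + ‖u‖ ^ 2 ≤ ‖1 + u‖ ^ 2 := by
  rw [← normSq_eq_norm_sq, ← normSq_eq_norm_sq, normSq_apply, normSq_apply]
  simp
  nlinarith

lemma one_le_norm_one_add {u : ℂ} (hu : 0 ≤ u.re) : 1 ≤ ‖1 + u‖ := by
  have := one_add_norm_sq_le hu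
  nlinarith [norm_nonneg (1 + u), sq_nonneg ‖u‖]

lemma one_add_ne_zero {u : ℂ} (hu : 0 ≤ u.re) : 1 + u ≠ 0 :=
  norm_pos_iff.1 (one_pos.trans_le (one_le_norm_one_add hu))

lemma norm_betaKernel_le {j : ℕ} (hj : 1 ≤ j) {r : ℂ} (hr : r.re = 0) {w : ℂ}
    (hw : |w.im| ≤ π / 2) :
    ‖betaKernel j r w‖ ≤ Real.exp (|r.im| * (π / 2)) * Real.exp (-|w.re|) := by
  have h1 : ‖exp ((j - r) * w)‖ = Real.exp (r.im * w.im) * Real.exp (j * w.re) := by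
    rw [norm_exp, ← Real.exp_add]
    congr 1
    simp [hr]
    ring
  have h2 : Real.exp (2 * w.re) + 1 ≤ ‖1 + exp w‖ ^ 2 := by
    have := one_add_norm_sq_le (exp_re_nonneg hw)
    rw [norm_exp, ← Real.exp_nat_mul] at this
    push_cast at this
    linarith
  have h3 : r.im * w.im ≤ |r.im| * (π / 2) :=
    (le_abs_self _).trans (by rw [abs_mul]; gcongr)
  rw [betaKernel, norm_mul, h1, norm_inv, norm_pow, pow_mul]
  calc _ ≤ Real.exp (|r.im| * (π / 2)) * Real.exp (j * w.re) *
        ((Real.exp (2 * w.re) + 1) ^ j)⁻¹ := by gcongr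
    _ = Real.exp (|r.im| * (π / 2)) * (Real.exp (j * w.re) *
        ((Real.exp (2 * w.re) + 1) ^ j)⁻¹) := by ring
    _ ≤ _ := by gcongr; exact exp_mul_inv_pow_le hj w.re

/-- The modulus of q lies in a compact subset of (0, ∞) and its argument in [-π, π]. The bound
ignores the discontinuity across the cut. -/
lemma exists_norm_cpow_le (β : ℂ) {δ R : ℝ} (hδ : 0 < δ) :
    ∃ K : ℝ, 0 ≤ K ∧ ∀ q : ℂ, δ ≤ ‖q‖ → ‖q‖ ≤ R → ‖q ^ β‖ ≤ K := by
  refine ⟨Real.exp ((|Real.log δ| + |Real.log R|) * |β.re|) * Real.exp (π * |β.im|), by positivity,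
    fun q h1 h2 => ?_⟩
  have hq : 0 < ‖q‖ := hδ.trans_le h1
  rw [norm_cpow_of_ne_zero (norm_pos_iff.1 hq), div_eq_mul_inv, ← Real.exp_neg,
    Real.rpow_def_of_pos hq]
  refine mul_le_mul (Real.exp_le_exp.2 ?_) (Real.exp_le_exp.2 ?_) (Real.exp_pos _).le
    (Real.exp_pos _).le
  · refine (le_abs_self _).trans ?_
    rw [abs_mul]
    refine mul_le_mul_of_nonneg_right ?_ (abs_nonneg _)
    have l1 := Real.log_le_log hδ h1
    have l2 := Real.log_le_log hq h2
    rw [abs_le]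
    constructor
    · linarith [neg_abs_le (Real.log δ), abs_nonneg (Real.log R)]
    · linarith [le_abs_self (Real.log R), abs_nonneg (Real.log δ)]
  · refine (neg_le_abs _).trans ?_
    rw [abs_mul]
    exact mul_le_mul_of_nonneg_right (abs_arg_le_pi q) (abs_nonneg _)

lemma exists_norm_one_sub_div_cpow_le (β : ℂ) {R δ : ℝ} (hR : 0 ≤ R) (hδ : 0 < δ) :
    ∃ K : ℝ, 0 ≤ K ∧ ∀ x u : ℂ, ‖x‖ ≤ R → 0 ≤ u.re → δ ≤ ‖1 + u - x‖ →
      ‖(1 - x / (1 + u)) ^ β‖ ≤ K := by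
  -- If |1 + u| ≥ 2R + 1 then |x/(1 + u)| ≤ 1/2, whence the bound 1/2; otherwise (1 + u - x)/(1 + u)
  -- has modulus at least δ/(2R + 1). The upper bound 1 + R uses |1 + u| ≥ 1.
  obtain ⟨K, hK, h⟩ := exists_norm_cpow_le β (δ := min (1 / 2) (δ / (2 * R + 1))) (R := 1 + R)
    (by positivity)
  refine ⟨K, hK, fun x u hx hu hd => h _ ?_ ?_⟩
  · have h1 := one_le_norm_one_add hu
    have h0 : 0 < ‖1 + u‖ := by linarith
    rcases le_total (2 * R + 1) ‖1 + u‖ with h2 | h2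
    · refine (min_le_left _ _).trans ?_
      have h3 : ‖x / (1 + u)‖ ≤ 1 / 2 := by
        rw [norm_div, div_le_iff₀ h0]; linarith
      have h4 := norm_sub_norm_le 1 (x / (1 + u))
      rw [norm_one] at h4
      linarith
    · refine (min_le_right _ _).trans ?_
      rw [one_sub_div (one_add_ne_zero hu), norm_div]
      gcongr
  · refine (norm_sub_le _ _).trans ?_
    rw [norm_one, norm_div]
    gcongr
    exact (div_le_self (norm_nonneg _) (one_le_norm_one_add hu)).trans hx

lemma one_sub_div_mem_slitPlane {x v : ℂ} (hv : v ≠ 0) (h : ∀ μ : ℝ, 1 ≤ μ → x ≠ μ * v) :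
    1 - x / v ∈ slitPlane := by
  by_contra hn
  rw [mem_slitPlane_iff, not_or, not_lt, not_not] at hn
  refine h (x / v).re ?_ ?_
  · have := hn.1
    simp only [sub_re, one_re] at this
    linarith
  · have h2 : (x / v).im = 0 := by simpa using hn.2
    have h3 : (((x / v).re : ℝ) : ℂ) = x / v := by apply Complex.ext <;> simp [h2]
    rw [h3, div_mul_cancel₀ _ hv]

/-- Shifting a line of integration. -/
lemma integral_eq_integral_add_mul_I {Ψ : ℂ → ℂ} {θ K : ℝ}
    (hd : ∀ w : ℂ, w.im ∈ uIcc 0 θ → DifferentiableAt ℂ Ψ w)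
    (hb : ∀ w : ℂ, w.im ∈ uIcc 0 θ → ‖Ψ w‖ ≤ K * Real.exp (-|w.re|)) :
    ∫ y : ℝ, Ψ y = ∫ y : ℝ, Ψ (y + θ * I) := by
  have hint : ∀ v ∈ uIcc 0 θ, Integrable fun y : ℝ => Ψ (y + v * I) := by
    intro v hv
    have him : ∀ y : ℝ, ((y : ℂ) + v * I).im ∈ uIcc 0 θ := fun y => by simpa using hv
    refine Integrable.mono' (integrable_exp_neg_abs.const_mul K) ?_ (ae_of_all _ fun y => ?_)
    · refine Continuous.aestronglyMeasurable (continuous_iff_continuousAt.2 fun y => ?_)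
      exact ContinuousAt.comp (f := fun y : ℝ => (y : ℂ) + v * I) (hd _ (him y)).continuousAt
        (by fun_prop)
    · simpa using hb _ (him y)
  have h0 : Integrable fun y : ℝ => Ψ y := by simpa using hint 0 left_mem_uIcc
  have h1 := hint θ right_mem_uIcc
  have t1 := intervalIntegral_tendsto_integral h0 tendsto_neg_atTop_atBot tendsto_id
  have t2 := intervalIntegral_tendsto_integral h1 tendsto_neg_atTop_atBot tendsto_id
  refine sub_eq_zero.1 (tendsto_nhds_unique (t1.sub t2) ?_)
  -- The difference of the horizontal integrals over [-T, T] is that of the two vertical sides, each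
  -- of size at most K e^(-T) |θ|.
  have hK : ∀ T : ℝ, 0 ≤ T → ‖(∫ y in (-T)..T, Ψ y) - ∫ y in (-T)..T, Ψ (y + θ * I)‖ ≤
      2 * (K * Real.exp (-T) * |θ|) := by
    intro T hT
    have hrect := integral_boundary_rect_eq_zero_of_differentiableOn Ψ (-T : ℝ) (T + θ * I) (by
      intro w hw
      have : w.im ∈ uIcc 0 θ := by simpa [mem_reProdIm] using hw.2
      exact (hd w this).differentiableWithinAt)
    simp only [ofReal_re, ofReal_im, add_re, add_im, mul_re, mul_im, I_re, I_im, mul_zero, mul_one,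
      zero_mul, add_zero, sub_zero, zero_add, smul_eq_mul, ofReal_zero] at hrect
    have hside : ∀ S : ℝ, |S| = T → ‖∫ y in (0:ℝ)..θ, Ψ (S + y * I)‖ ≤ K * Real.exp (-T) * |θ| := by
      intro S hS
      have := intervalIntegral.norm_integral_le_of_norm_le_const (a := 0) (b := θ)
        (f := fun y : ℝ => Ψ (S + y * I)) (C := K * Real.exp (-T)) (fun y hy => by
          have := hb (S + y * I) (by simpa using uIoc_subset_uIcc hy)
          simpa [hS] using this)
      simpa using this
    have e1 := hside T (abs_of_nonneg hT)
    have e2 := hside (-T) (by rw [abs_neg, abs_of_nonneg hT])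
    have : (∫ y in (-T)..T, Ψ y) - ∫ y in (-T)..T, Ψ (y + θ * I) =
        I * (∫ y in (0:ℝ)..θ, Ψ ((-T : ℝ) + y * I)) - I * ∫ y in (0:ℝ)..θ, Ψ (T + y * I) := by
      linear_combination hrect
    rw [this]
    refine (norm_sub_le _ _).trans ?_
    rw [norm_mul, norm_mul, norm_I, one_mul, one_mul]
    linarith
  refine squeeze_zero_norm' (a := fun T : ℝ => 2 * (K * Real.exp (-T) * |θ|)) ?_ ?_
  · filter_upwards [eventually_ge_atTop (0 : ℝ)] with T hT
    exact hK T hT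
  · have : Tendsto (fun T : ℝ => 2 * (K * Real.exp (-T) * |θ|)) atTop
        (𝓝 (2 * (K * 0 * |θ|))) :=
      ((Real.tendsto_exp_neg_atTop_nhds_zero.const_mul K).mul_const _).const_mul 2
    simpa using this

/-- The beta integral in logarithmic coordinates. -/
lemma integral_exp_mul_inv_one_add_exp_pow (N : ℕ) {u : ℂ} (hu : 0 < u.re) (hu' : u.re < N) :
    ∫ y : ℝ, exp (u * y) * ((1 + exp (y : ℂ)) ^ N)⁻¹ = betaFn u (N - u) := by
  have hB : betaFn u (N - u) = betaIntegral u (N - u) := by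
    rw [betaFn, Gamma_mul_Gamma_eq_betaIntegral hu (by simpa using hu'), mul_comm, mul_div_assoc,
      div_self, mul_one]
    rw [add_sub_cancel]
    refine Gamma_ne_zero_of_re_pos ?_
    simpa using hu.trans hu'
  -- Substitution t = e^y/(1 + e^y), which maps the line onto (0, 1); its derivative t(1 - t)
  -- absorbs the two exponents -1 of the beta integral.
  rw [hB, betaIntegral, intervalIntegral.integral_of_le zero_le_one, integral_Ioc_eq_integral_Ioo,
    ← Real.range_sigmoid, ← image_univ,
    integral_image_eq_integral_abs_deriv_smul MeasurableSet.univ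
      (fun x _ => (Real.hasDerivAt_sigmoid x).hasDerivWithinAt) Real.sigmoid_injective.injOn,
    setIntegral_univ]
  · congr 1
    ext y
    have hp := Real.sigmoid_pos y
    have hq : 0 < 1 - Real.sigmoid y := sub_pos.2 (Real.sigmoid_lt_one y)
    have hE : 0 < 1 + Real.exp y := by positivity
    have e2 : 1 - Real.sigmoid y = (1 + Real.exp y)⁻¹ := by
      rw [← Real.sigmoid_neg, Real.sigmoid_def, neg_neg]
    have e1 : Real.sigmoid y = Real.exp y * (1 + Real.exp y)⁻¹ := by
      have := e2
      field_simp at this ⊢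
      linarith
    have hc : (1 - (Real.sigmoid y : ℂ)) = ((1 - Real.sigmoid y : ℝ) : ℂ) := by push_cast; rfl
    have hp' : (Real.sigmoid y : ℂ) ≠ 0 := by exact_mod_cast hp.ne'
    have hq' : ((1 - Real.sigmoid y : ℝ) : ℂ) ≠ 0 := by exact_mod_cast hq.ne'
    have hE' : (((1 + Real.exp y)⁻¹ : ℝ) : ℂ) ≠ 0 := by exact_mod_cast (inv_pos.2 hE).ne'
    rw [abs_of_pos (mul_pos hp hq), real_smul, ofReal_mul, hc, cpow_sub _ _ hp', cpow_sub _ _ hq',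
      cpow_one, cpow_one]
    have : (Real.sigmoid y : ℂ) * ((1 - Real.sigmoid y : ℝ) : ℂ) *
        ((Real.sigmoid y : ℂ) ^ u / (Real.sigmoid y : ℂ) *
          (((1 - Real.sigmoid y : ℝ) : ℂ) ^ ((N : ℂ) - u) / ((1 - Real.sigmoid y : ℝ) : ℂ))) =
        (Real.sigmoid y : ℂ) ^ u * ((1 - Real.sigmoid y : ℝ) : ℂ) ^ ((N : ℂ) - u) := by
      field_simp
    rw [this, e2, e1, ofReal_mul, ofReal_exp_mul_cpow y hE', cpow_sub _ _ hE', mul_comm (y : ℂ) u, cpow_natCast]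
    have hE'' : (((1 + Real.exp y)⁻¹ : ℝ) : ℂ) ^ u ≠ 0 :=
      fun h => hE' ((cpow_eq_zero_iff _ _).1 h).1
    rw [mul_assoc, mul_div_cancel₀ _ hE'']
    push_cast
    rw [inv_pow]


/-! ### Euler's integral as the continuation of the Gauss series -/

lemma differentiableAt_betaKernel (j : ℕ) (r : ℂ) {w : ℂ} (hw : |w.im| ≤ π / 2) :
    DifferentiableAt ℂ (betaKernel j r) w := by
  have h := one_add_ne_zero (exp_re_nonneg hw)
  have h1 : DifferentiableAt ℂ (fun w : ℂ => (1 + exp w) ^ (2 * j)) w := by fun_prop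
  exact (by fun_prop : DifferentiableAt ℂ (fun w : ℂ => exp ((j - r) * w)) w).mul
    (h1.inv (pow_ne_zero _ h))

lemma differentiableAt_eulerKernel (j : ℕ) (r α : ℂ) {x w : ℂ} (hw : |w.im| ≤ π / 2)
    (hx : ∀ μ : ℝ, 1 ≤ μ → x ≠ μ * (1 + exp w)) : DifferentiableAt ℂ (eulerKernel j r α x) w := by
  have h := one_add_ne_zero (exp_re_nonneg hw)
  have h1 : DifferentiableAt ℂ (fun w : ℂ => 1 - x / (1 + exp w)) w := by
    have : DifferentiableAt ℂ (fun w : ℂ => 1 + exp w) w := by fun_prop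
    exact (differentiableAt_const _).sub ((differentiableAt_const _).div this h)
  exact (differentiableAt_betaKernel j r hw).mul
    (h1.cpow (differentiableAt_const _) (one_sub_div_mem_slitPlane h hx))

lemma hasDerivAt_eulerKernel_parameter (j : ℕ) (r α : ℂ) {x w : ℂ} (hw : |w.im| ≤ π / 2)
    (hx : ∀ μ : ℝ, 1 ≤ μ → x ≠ μ * (1 + exp w)) :
    HasDerivAt (fun x => eulerKernel j r α x w)
      (α / (1 + exp w) * eulerKernel j r (α + 1) x w) x := by
  have h := one_add_ne_zero (exp_re_nonneg hw)
  have h1 : HasDerivAt (fun x : ℂ => 1 - x / (1 + exp w)) (-(1 / (1 + exp w))) x :=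
    ((hasDerivAt_id x).div_const _).const_sub 1
  have h2 := (h1.cpow_const (c := -α) (one_sub_div_mem_slitPlane h hx)).const_mul
    (betaKernel j r w)
  refine h2.congr_deriv ?_
  rw [eulerKernel, neg_add, ← sub_eq_add_neg]
  ring

lemma exists_norm_eulerKernel_le {j : ℕ} (hj : 1 ≤ j) {r : ℂ} (hr : r.re = 0) (α : ℂ) {R δ : ℝ}
    (hR : 0 ≤ R) (hδ : 0 < δ) : ∃ K : ℝ, 0 ≤ K ∧ ∀ x w : ℂ, |w.im| ≤ π / 2 → ‖x‖ ≤ R →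
      δ ≤ ‖1 + exp w - x‖ → ‖eulerKernel j r α x w‖ ≤ K * Real.exp (-|w.re|) := by
  obtain ⟨K, hK, h⟩ := exists_norm_one_sub_div_cpow_le (-α) hR hδ
  refine ⟨Real.exp (|r.im| * (π / 2)) * K, by positivity, fun x w hw hx hd => ?_⟩
  rw [eulerKernel, norm_mul]
  calc _ ≤ Real.exp (|r.im| * (π / 2)) * Real.exp (-|w.re|) * K :=
        mul_le_mul (norm_betaKernel_le hj hr hw) (h x _ hx (exp_re_nonneg hw) hd) (norm_nonneg _)
          (by positivity)
    _ = _ := by ring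

/-- Euler's integral, over the line. -/
def eulerIntegral (j : ℕ) (r α x : ℂ) : ℂ := ∫ y : ℝ, eulerKernel j r α x y

lemma abs_ofReal_im_le (y : ℝ) : |(y : ℂ).im| ≤ π / 2 := by
  rw [ofReal_im, abs_zero]
  positivity

lemma continuous_eulerKernel_real (j : ℕ) (r α : ℂ) {x : ℂ}
    (hx : ∀ t : ℝ, 1 ≤ t → x ≠ t) : Continuous fun y : ℝ => eulerKernel j r α x y := by
  refine continuous_iff_continuousAt.2 fun y => ?_
  refine ContinuousAt.comp (f := fun y : ℝ => (y : ℂ)) (g := eulerKernel j r α x)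
    (differentiableAt_eulerKernel j r α (abs_ofReal_im_le y) fun μ hμ h => ?_).continuousAt
    (by fun_prop)
  refine hx (μ * (1 + Real.exp y)) (one_le_mul_of_one_le_of_one_le hμ ?_) (by rw [h]; push_cast; rfl)
  linarith [Real.exp_pos y]

lemma ne_of_one_sub_mem_slitPlane {x : ℂ} (hx : 1 - x ∈ slitPlane) {t : ℝ} (ht : 1 ≤ t) :
    x ≠ t := by
  rintro rfl
  rw [mem_slitPlane_iff] at hx
  simp at hx
  linarith

lemma isOpen_one_sub_mem_slitPlane : IsOpen {x : ℂ | 1 - x ∈ slitPlane} :=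
  isOpen_slitPlane.preimage (f := fun x : ℂ => 1 - x) (by fun_prop)

lemma exists_le_norm_sub {x₀ : ℂ} (hx : 1 - x₀ ∈ slitPlane) :
    ∃ δ : ℝ, 0 < δ ∧ ∀ x ∈ Metric.ball x₀ δ, ∀ t : ℝ, 1 ≤ t → δ ≤ ‖(t : ℂ) - x‖ := by
  obtain ⟨ε, hε, h⟩ := Metric.isOpen_iff.1 isOpen_one_sub_mem_slitPlane x₀ hx
  refine ⟨ε / 2, by positivity, fun x hxb t ht => ?_⟩
  by_contra hlt
  have h1 : (t : ℂ) ∈ Metric.ball x₀ ε := by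
    rw [Metric.mem_ball, dist_eq_norm] at hxb ⊢
    have := norm_sub_le_norm_sub_add_norm_sub (t : ℂ) x x₀
    push Not at hlt
    linarith
  exact ne_of_one_sub_mem_slitPlane (h h1) ht rfl

/-- The points 1 + e^y lie on the cut, so x stays at a positive distance from them, uniformly near
x₀. Differentiating in x yields a kernel of the same type with α + 1, so the same estimate dominates
the derivative. -/
lemma differentiableOn_eulerIntegral {j : ℕ} (hj : 1 ≤ j) {r : ℂ} (hr : r.re = 0) (α : ℂ) :
    DifferentiableOn ℂ (eulerIntegral j r α) {x | 1 - x ∈ slitPlane} := by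
  intro x₀ hx₀
  obtain ⟨δ, hδ, h⟩ := exists_le_norm_sub hx₀
  have hne : ∀ x ∈ Metric.ball x₀ δ, ∀ t : ℝ, 1 ≤ t → x ≠ t := fun x hx t ht he => by
    have := h x hx t ht
    rw [he, sub_self, norm_zero] at this
    linarith
  have hne' : ∀ x ∈ Metric.ball x₀ δ, ∀ y : ℝ, ∀ μ : ℝ, 1 ≤ μ → x ≠ μ * (1 + exp (y : ℂ)) := by
    intro x hx y μ hμ
    have := hne x hx (μ * (1 + Real.exp y))
      (one_le_mul_of_one_le_of_one_le hμ (by linarith [Real.exp_pos y]))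
    push_cast at this
    exact this
  have hge : ∀ x ∈ Metric.ball x₀ δ, ∀ y : ℝ, δ ≤ ‖1 + exp (y : ℂ) - x‖ := by
    intro x hx y
    have := h x hx (1 + Real.exp y) (by linarith [Real.exp_pos y])
    push_cast at this
    exact this
  have hR : ∀ x ∈ Metric.ball x₀ δ, ‖x‖ ≤ ‖x₀‖ + δ := fun x hx => by
    rw [Metric.mem_ball, dist_eq_norm] at hx
    have := norm_sub_norm_le x x₀
    linarith
  obtain ⟨K, hK, hb⟩ := exists_norm_eulerKernel_le hj hr α (R := ‖x₀‖ + δ) (by positivity) hδ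
  obtain ⟨K', hK', hb'⟩ := exists_norm_eulerKernel_le hj hr (α + 1) (R := ‖x₀‖ + δ) (by positivity) hδ
  have hx₀b := Metric.mem_ball_self (x := x₀) hδ
  have key := hasDerivAt_integral_of_dominated_loc_of_deriv_le (μ := volume) (𝕜 := ℂ)
    (F := fun (x : ℂ) (y : ℝ) => eulerKernel j r α x y)
    (F' := fun (x : ℂ) (y : ℝ) => α / (1 + exp (y : ℂ)) * eulerKernel j r (α + 1) x y)
    (bound := fun y => ‖α‖ * (K' * Real.exp (-|y|)))
    (Metric.ball_mem_nhds x₀ hδ) ?_ ?_ ?_ ?_ ?_ ?_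
  · exact key.2.differentiableAt.differentiableWithinAt
  · filter_upwards [Metric.ball_mem_nhds x₀ hδ] with x hx
    exact (continuous_eulerKernel_real j r α (hne x hx)).aestronglyMeasurable
  · refine Integrable.mono' (integrable_exp_neg_abs.const_mul K)
      (continuous_eulerKernel_real j r α (hne x₀ hx₀b)).aestronglyMeasurable (ae_of_all _ fun y => ?_)
    simpa using hb x₀ y (abs_ofReal_im_le y) (hR x₀ hx₀b) (hge x₀ hx₀b y)
  · refine Continuous.aestronglyMeasurable (Continuous.mul ?_
      (continuous_eulerKernel_real j r (α + 1) (hne x₀ hx₀b)))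
    refine Continuous.div (by fun_prop) (by fun_prop) fun y => one_add_ne_zero
      (exp_re_nonneg (abs_ofReal_im_le y))
  · refine ae_of_all _ fun y x hx => ?_
    rw [norm_mul, norm_div]
    refine mul_le_mul (div_le_self (norm_nonneg _)
      (one_le_norm_one_add (exp_re_nonneg (abs_ofReal_im_le y)))) ?_ (norm_nonneg _) (norm_nonneg _)
    simpa using hb' x y (abs_ofReal_im_le y) (hR x hx) (hge x hx y)
  · exact (integrable_exp_neg_abs.const_mul K').const_mul _
  · exact ae_of_all _ fun y x hx =>
      hasDerivAt_eulerKernel_parameter j r α (abs_ofReal_im_le y) (hne' x hx y)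

lemma ringChoose_add_sub_one (α : ℂ) (n : ℕ) :
    Ring.choose (α + n - 1) n = (n.factorial : ℂ)⁻¹ * (ascPochhammer ℂ n).eval α := by
  rw [Ring.choose]
  have h := Ring.factorial_nsmul_multichoose_eq_ascPochhammer α n
  rw [Polynomial.ascPochhammer_smeval_eq_eval, nsmul_eq_mul] at h
  rw [← h, inv_mul_cancel_left₀ (by exact_mod_cast n.factorial_ne_zero)]
  congr 1; ring

/-- The binomial series. -/
lemma hasSum_one_sub_cpow_neg (α : ℂ) {q : ℂ} (hq : ‖q‖ < 1) :
    HasSum (fun n : ℕ => (n.factorial : ℂ)⁻¹ * (ascPochhammer ℂ n).eval α * q ^ n)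
      ((1 - q) ^ (-α)) := by
  have h := (one_div_one_sub_cpow_hasFPowerSeriesOnBall_zero α).hasSum (y := q)
    (by simpa [enorm_eq_nnnorm, ← NNReal.coe_lt_coe] using hq)
  simp only [zero_add] at h
  rw [cpow_neg, ← one_div]
  simp only [FormalMultilinearSeries.ofScalars_apply_eq, ringChoose_add_sub_one, smul_eq_mul] at h
  exact h

lemma betaFn_add_nat {u v : ℂ} (hu : 0 < u.re) (hv : 0 < v.re) (n : ℕ) :
    betaFn u (v + n) = betaFn u v * (ascPochhammer ℂ n).eval v *
      ((ascPochhammer ℂ n).eval (u + v))⁻¹ := by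
  have hne : ∀ {z : ℂ}, 0 < z.re → ∀ k : ℕ, z ≠ -k := fun {z} hz k h => by
    rw [h] at hz
    simp at hz
    linarith [(Nat.cast_nonneg k : (0:ℝ) ≤ k)]
  have h1 := Gamma_add_nat_div_Gamma_eq (n := n) v (hne hv)
  have huv : 0 < (u + v).re := by rw [add_re]; linarith
  have h2 := Gamma_add_nat_div_Gamma_eq (n := n) (u + v) (hne huv)
  have g1 := Gamma_ne_zero (hne hv)
  have g2 := Gamma_ne_zero (hne huv)
  rw [betaFn, betaFn, ← h1, ← h2, ← add_assoc]
  field_simp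

lemma integrable_betaKernel_real {j : ℕ} (hj : 1 ≤ j) {r : ℂ} (hr : r.re = 0) :
    Integrable fun y : ℝ => betaKernel j r y := by
  refine Integrable.mono' (integrable_exp_neg_abs.const_mul (Real.exp (|r.im| * (π / 2)))) ?_
    (ae_of_all _ fun y => by simpa using norm_betaKernel_le hj hr (abs_ofReal_im_le y))
  refine (continuous_iff_continuousAt.2 fun y => ?_).aestronglyMeasurable
  exact ContinuousAt.comp (f := fun y : ℝ => (y : ℂ)) (g := betaKernel j r)
    (differentiableAt_betaKernel j r (abs_ofReal_im_le y)).continuousAt (by fun_prop)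

/-- As |x/(1 + e^y)| ≤ |x| < 1, the binomial series can be integrated term by term. The n-th
integral is B(j - r, j + r + n), whose ratio to B(j - r, j + r) is the Pochhammer quotient of the
Gauss series. -/
lemma eulerIntegral_eq_hypergeometric {j : ℕ} (hj : 1 ≤ j) {r : ℂ} (hr : r.re = 0) (α : ℂ) {x : ℂ}
    (hx : ‖x‖ < 1) : eulerIntegral j r α x =
      betaFn (j - r) (j + r) * ₂F₁ α (j + r) ((2 * j : ℕ) : ℂ) x := by
  have hj0 : (0 : ℝ) < j := by exact_mod_cast hj
  have hv : ∀ y : ℝ, 1 + exp (y : ℂ) ≠ 0 := fun y =>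
    one_add_ne_zero (exp_re_nonneg (abs_ofReal_im_le y))
  have hq : ∀ y : ℝ, ‖x / (1 + exp (y : ℂ))‖ ≤ ‖x‖ := fun y => by
    rw [norm_div]
    exact div_le_self (norm_nonneg _) (one_le_norm_one_add (exp_re_nonneg (abs_ofReal_im_le y)))
  obtain ⟨c, hc⟩ : ∃ c : ℕ → ℂ, c = fun n => (n.factorial : ℂ)⁻¹ * (ascPochhammer ℂ n).eval α :=
    ⟨_, rfl⟩
  have hI := integrable_betaKernel_real hj hr
  obtain ⟨F, hF⟩ : ∃ F : ℕ → ℝ → ℂ, F = fun n (y : ℝ) =>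
      betaKernel j r y * (c n * (x / (1 + exp (y : ℂ))) ^ n) := ⟨_, rfl⟩
  have hFn : ∀ n y, ‖F n y‖ ≤ ‖betaKernel j r y‖ * ‖c n * x ^ n‖ := by
    intro n y
    rw [hF, norm_mul, norm_mul, norm_mul, norm_pow, norm_pow]
    gcongr
    exact hq y
  have hFm : ∀ n, Integrable (F n) := by
    intro n
    refine Integrable.mono' (hI.norm.mul_const ‖c n * x ^ n‖) ?_ (ae_of_all _ (hFn n))
    rw [hF]
    refine hI.aestronglyMeasurable.mul (Continuous.aestronglyMeasurable ?_)
    exact continuous_const.mul ((continuous_const.div (by fun_prop) hv).pow n)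
  have hs := hasSum_integral_of_summable_integral_norm (μ := volume) hFm (by
    refine Summable.of_nonneg_of_le (fun n => integral_nonneg fun y => norm_nonneg _)
      (fun n => integral_mono (hFm n).norm (hI.norm.mul_const _) (hFn n)) ?_
    simp only [integral_mul_const]
    refine Summable.mul_left _ ?_
    have := (hasSum_one_sub_cpow_neg α hx).summable.norm
    rw [hc]
    exact this)
  have e1 : (fun y => ∑' n, F n y) = fun y : ℝ => eulerKernel j r α x y := by
    ext y
    have := (hasSum_one_sub_cpow_neg α ((hq y).trans_lt hx)).mul_left (betaKernel j r y)
    rw [hF, hc]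
    exact this.tsum_eq
  rw [e1] at hs
  rw [eulerIntegral, ← hs.tsum_eq, ordinaryHypergeometric_eq_tsum, ← tsum_mul_left]
  refine tsum_congr fun n => ?_
  have e2 : F n = fun y : ℝ => (c n * x ^ n) *
      (exp ((j - r) * y) * ((1 + exp (y : ℂ)) ^ (2 * j + n))⁻¹) := by
    ext y
    have := hv y
    rw [hF]
    simp only [betaKernel, div_pow, pow_add]
    field_simp
  rw [e2, integral_const_mul, integral_exp_mul_inv_one_add_exp_pow _ (by simpa [hr] using (by omega : 0 < j))
    (by simp [hr]; linarith [(Nat.cast_nonneg n : (0:ℝ) ≤ n)])]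
  have e3 : ((2 * j + n : ℕ) : ℂ) - (j - r) = (j + r) + n := by push_cast; ring
  have e4 : ((2 * j : ℕ) : ℂ) = (j - r) + (j + r) := by push_cast; ring
  rw [e3, e4, betaFn_add_nat (by simpa [hr] using (by omega : 0 < j)) (by simpa [hr] using (by omega : 0 < j)), hc, smul_eq_mul]
  ring

lemma betaFn_ne_zero {u v : ℂ} (hu : 0 < u.re) (hv : 0 < v.re) : betaFn u v ≠ 0 :=
  div_ne_zero (mul_ne_zero (Gamma_ne_zero_of_re_pos hu) (Gamma_ne_zero_of_re_pos hv))
    (Gamma_ne_zero_of_re_pos (by rw [add_re]; linarith))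

lemma isPreconnected_one_sub_mem_slitPlane : IsPreconnected {x : ℂ | 1 - x ∈ slitPlane} := by
  have h : IsPreconnected slitPlane :=
    (starConvex_one_slitPlane.isPathConnected one_mem_slitPlane).isConnected.isPreconnected
  have h2 := h.image (fun x : ℂ => 1 - x) (by fun_prop)
  convert h2 using 1
  ext x
  constructor
  · intro hx
    exact ⟨1 - x, hx, by ring⟩
  · rintro ⟨y, hy, rfl⟩
    change 1 - (1 - y) ∈ slitPlane
    rwa [sub_sub_cancel]

/-- Euler's integral represents the continuation of the Gauss series. -/
lemma betaFn_mul_hyp2F1Cut {j : ℕ} (hj : 1 ≤ j) {r : ℂ} (hr : r.re = 0) (α : ℂ) {x : ℂ}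
    (hx : 1 - x ∈ slitPlane) :
    betaFn (j - r) (j + r) * hyp2F1Cut α (j + r) ((2 * j : ℕ) : ℂ) x = eulerIntegral j r α x := by
  have hB : betaFn (j - r) (j + r) ≠ 0 :=
    betaFn_ne_zero (by simpa [hr] using (by omega : 0 < j)) (by simpa [hr] using (by omega : 0 < j))
  have hE : AnalyticOnNhd ℂ (eulerIntegral j r α) {x | 1 - x ∈ slitPlane} :=
    (differentiableOn_eulerIntegral hj hr α).analyticOnNhd isOpen_one_sub_mem_slitPlane
  -- Euler's integral divided by the beta value is itself a continuation, so the definition does not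
  -- take its default value. The identity theorem on the connected slit domain then identifies the
  -- chosen continuation.
  have hex : ∃ F : ℂ → ℂ, AnalyticOnNhd ℂ F {x | 1 - x ∈ slitPlane} ∧
      ∀ x : ℂ, ‖x‖ < 1 → F x = ₂F₁ α (j + r) ((2 * j : ℕ) : ℂ) x := by
    refine ⟨fun x => (betaFn (j - r) (j + r))⁻¹ * eulerIntegral j r α x,
      analyticOnNhd_const.mul hE, fun x hx => ?_⟩
    change (betaFn (j - r) (j + r))⁻¹ * eulerIntegral j r α x = _
    rw [eulerIntegral_eq_hypergeometric hj hr α hx, inv_mul_cancel_left₀ hB]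
  rw [hyp2F1Cut, dif_pos hex]
  obtain ⟨h1, h2⟩ := hex.choose_spec
  refine AnalyticOnNhd.eqOn_of_preconnected_of_eventuallyEq (z₀ := 0)
    (f := fun x => betaFn (j - r) (j + r) * hex.choose x)
    (analyticOnNhd_const.mul h1) hE isPreconnected_one_sub_mem_slitPlane (by simp) ?_ hx
  filter_upwards [Metric.ball_mem_nhds (0 : ℂ) one_pos] with y hy
  have hy' : ‖y‖ < 1 := by simpa using hy
  rw [h2 y hy', eulerIntegral_eq_hypergeometric hj hr α hy']

/-! ### Principal values off and on the cut -/

/-- Euler's integral over the line `im w = θ`, for real arguments off the cut. -/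
lemma betaFn_mul_hyp2F1_of_lt_one {j : ℕ} (hj : 1 ≤ j) {r : ℂ} (hr : r.re = 0) (α : ℂ) {x θ : ℝ}
    (hx : x < 1) (hθ : |θ| ≤ π / 2) :
    betaFn (j - r) (j + r) * hyp2F1 α (j + r) ((2 * j : ℕ) : ℂ) x =
      ∫ y : ℝ, eulerKernel j r α x (y + θ * I) := by
  have hx' : 1 - (x : ℂ) ∈ slitPlane := by
    rw [mem_slitPlane_iff]
    left
    simpa using hx
  obtain ⟨K, hK, hb⟩ := exists_norm_eulerKernel_le hj hr α (abs_nonneg x) (sub_pos.2 hx)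
  have him : ∀ w : ℂ, w.im ∈ uIcc 0 θ → |w.im| ≤ π / 2 := fun w hw => by
    have := abs_sub_left_of_mem_uIcc hw
    simp only [sub_zero] at this
    exact this.trans hθ
  rw [hyp2F1, if_pos hx', betaFn_mul_hyp2F1Cut hj hr α hx', eulerIntegral]
  -- For |im w| ≤ π/2 the real part of e^w is nonnegative, so 1 + e^w - x has real part at least 1 -
  -- x > 0 throughout the shift.
  refine integral_eq_integral_add_mul_I (K := K) (fun w hw => ?_) fun w hw => ?_
  · refine differentiableAt_eulerKernel j r α (him w hw) fun μ hμ h => ?_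
    have h1 := congrArg re h
    rw [re_ofReal_mul, add_re, one_re, ofReal_re] at h1
    nlinarith [exp_re_nonneg (him w hw)]
  · refine hb _ _ (him w hw) (by simp) (le_trans ?_ (re_le_norm _))
    simp only [sub_re, add_re, one_re, ofReal_re]
    linarith [exp_re_nonneg (him w hw)]

lemma exp_im_nonneg {w : ℂ} (h0 : 0 ≤ w.im) (h1 : w.im ≤ π) : 0 ≤ (exp w).im := by
  rw [exp_im]
  exact mul_nonneg (Real.exp_pos _).le (Real.sin_nonneg_of_nonneg_of_le_pi h0 h1)

/-- Euler's integral over the line `im w = π / 2`, for real arguments on the cut. -/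
lemma betaFn_mul_hyp2F1_of_one_lt {j : ℕ} (hj : 1 ≤ j) {r : ℂ} (hr : r.re = 0) (α : ℂ) {x : ℝ}
    (hx : 1 < x) : betaFn (j - r) (j + r) * hyp2F1 α (j + r) ((2 * j : ℕ) : ℂ) x =
      ∫ y : ℝ, eulerKernel j r α x (y + (π / 2 : ℝ) * I) := by
  have hpi := Real.pi_pos
  have hx' : 1 - (x : ℂ) ∉ slitPlane := by
    rw [mem_slitPlane_iff]
    simp
    exact hx.le
  have hB : betaFn (j - r) (j + r) ≠ 0 := betaFn_ne_zero
    (by simpa [hr] using (by omega : 0 < j)) (by simpa [hr] using (by omega : 0 < j))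
  -- Below the real axis the line can be raised to π/2: there im e^w ≥ 0, so 1 + e^w - z has
  -- imaginary part at least -im z > 0.
  have hshift : ∀ z : ℂ, z.im < 0 → hyp2F1Cut α (j + r) ((2 * j : ℕ) : ℂ) z =
      (betaFn (j - r) (j + r))⁻¹ * ∫ y : ℝ, eulerKernel j r α z (y + (π / 2 : ℝ) * I) := by
    intro z hz
    have hz' : 1 - z ∈ slitPlane := by
      rw [mem_slitPlane_iff]
      right
      simpa using hz.ne
    rw [eq_inv_mul_iff_mul_eq₀ hB, betaFn_mul_hyp2F1Cut hj hr α hz', eulerIntegral]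
    obtain ⟨K, hK, hb⟩ := exists_norm_eulerKernel_le hj hr α (norm_nonneg z) (neg_pos.2 hz)
    have him : ∀ w : ℂ, w.im ∈ uIcc 0 (π / 2) → |w.im| ≤ π / 2 ∧ 0 ≤ (exp w).im := fun w hw => by
      rw [uIcc_of_le (by positivity)] at hw
      refine ⟨by rw [abs_of_nonneg hw.1]; exact hw.2, exp_im_nonneg hw.1 (by linarith [hw.2])⟩
    refine integral_eq_integral_add_mul_I (K := K) (fun w hw => ?_) fun w hw => ?_
    · refine differentiableAt_eulerKernel j r α (him w hw).1 fun μ hμ h => ?_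
      have h1 := congrArg im h
      rw [im_ofReal_mul, add_im, one_im] at h1
      nlinarith [(him w hw).2]
    · refine hb _ _ (him w hw).1 le_rfl (le_trans ?_ (abs_im_le_norm _))
      refine le_trans ?_ (le_abs_self _)
      simp only [sub_im, add_im, one_im]
      linarith [(him w hw).2]
  have himl : ∀ y : ℝ, |((y : ℂ) + (π / 2 : ℝ) * I).im| ≤ π / 2 := fun y => by
    simp only [add_im, ofReal_im, mul_im, ofReal_re, I_im, I_re, mul_one, mul_zero, add_zero, zero_add]
    exact (abs_of_pos (by positivity)).le
  have hne : ∀ z : ℂ, 1 < z.re → ∀ y μ : ℝ, 1 ≤ μ → z ≠ μ * (1 + exp (y + (π / 2 : ℝ) * I)) ∨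
      0 < z.im := by
    intro z hz y μ hμ
    by_contra hcon
    rw [not_or, not_not, not_lt] at hcon
    have h1 := congrArg im hcon.1
    rw [exp_pi_div_two_line, im_ofReal_mul, add_im, one_im, im_ofReal_mul, I_im] at h1
    nlinarith [Real.exp_pos y, hcon.2]
  have hlim : Tendsto (fun z : ℂ => ∫ y : ℝ, eulerKernel j r α z (y + (π / 2 : ℝ) * I))
      (𝓝[{w : ℂ | w.im < 0}] (x : ℂ))
      (𝓝 (∫ y : ℝ, eulerKernel j r α x (y + (π / 2 : ℝ) * I))) := by
    obtain ⟨K, hK, hb⟩ := exists_norm_eulerKernel_le hj hr α (R := |x| + 1) (by positivity)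
      (half_pos (sub_pos.2 hx))
    have hev : ∀ᶠ z in 𝓝[{w : ℂ | w.im < 0}] (x : ℂ), ‖z‖ ≤ |x| + 1 ∧ (x + 1) / 2 < z.re ∧
        z.im < 0 := by
      refine Filter.Eventually.and ?_ (Filter.Eventually.and ?_ self_mem_nhdsWithin)
      · have : ∀ᶠ z : ℂ in 𝓝 (x : ℂ), ‖z‖ < |x| + 1 :=
          continuous_norm.continuousAt.eventually_lt_const (by simp)
        exact (this.mono fun z hz => hz.le).filter_mono nhdsWithin_le_nhds
      · have : ∀ᶠ z : ℂ in 𝓝 (x : ℂ), (x + 1) / 2 < z.re :=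
          continuous_re.continuousAt.eventually_const_lt (by rw [ofReal_re]; linarith)
        exact this.filter_mono nhdsWithin_le_nhds
    refine tendsto_integral_filter_of_dominated_convergence (fun y => K * Real.exp (-|y|)) ?_ ?_
      (integrable_exp_neg_abs.const_mul K) (ae_of_all _ fun y => ?_)
    · filter_upwards [hev] with z hz
      refine (continuous_iff_continuousAt.2 fun y => ?_).aestronglyMeasurable
      refine ContinuousAt.comp (f := fun y : ℝ => (y : ℂ) + (π / 2 : ℝ) * I)
        (g := eulerKernel j r α z) (differentiableAt_eulerKernel j r α (himl y)
          fun μ hμ => (hne z (by linarith [hz.2.1]) y μ hμ).resolve_right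
            (by linarith [hz.2.2])).continuousAt (by fun_prop)
    · filter_upwards [hev] with z hz
      refine ae_of_all _ fun y => ?_
      have := hb z (y + (π / 2 : ℝ) * I) (himl y) hz.1 (by
        refine le_trans ?_ (abs_re_le_norm _)
        refine le_trans ?_ (neg_le_abs _)
        rw [exp_pi_div_two_line]
        simp only [sub_re, add_re, one_re, re_ofReal_mul, I_re]
        linarith [hz.2.1])
      simpa using this
    · exact ((hasDerivAt_eulerKernel_parameter j r α (himl y) fun μ hμ =>
        (hne x (by simpa using hx) y μ hμ).resolve_right (by simp)).continuousAt.tendsto).mono_left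
          nhdsWithin_le_nhds
  have hbot : (𝓝[{w : ℂ | w.im < 0}] (x : ℂ)).NeBot := by
    rw [← mem_closure_iff_nhdsWithin_neBot, closure_setOfPred_im_lt]
    simp
  have hT : Tendsto (hyp2F1Cut α (j + r) ((2 * j : ℕ) : ℂ)) (𝓝[{w : ℂ | w.im < 0}] (x : ℂ))
      (𝓝 ((betaFn (j - r) (j + r))⁻¹ *
        ∫ y : ℝ, eulerKernel j r α x (y + (π / 2 : ℝ) * I))) := by
    refine (hlim.const_mul _).congr' ?_
    filter_upwards [self_mem_nhdsWithin] with z hz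
    exact (hshift z hz).symm
  rw [hyp2F1, if_neg hx', hT.limUnder_eq, mul_inv_cancel_left₀ hB]


/-! ### Evaluation of the line integrals -/

/-- For t < 0 the point q is in the lower half-plane, so arg t + arg q = π + arg q already lies in
(0, π) and no multiple of 2π is lost. -/
lemma log_ofReal_mul_of_im_pos {t : ℝ} (ht : t ≠ 0) {q : ℂ} (h : 0 < (t * q).im) :
    log (t * q) = log t + log q := by
  rw [im_ofReal_mul] at h
  have hq : q ≠ 0 := by
    rintro rfl
    simp at h
  rcases ht.lt_or_gt with h1 | h1
  · have hqi : q.im < 0 := by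
      by_contra hcon
      nlinarith
    have e1 : (t : ℂ) * q = ((-t : ℝ) : ℂ) * (-q) := by push_cast; ring
    have e2 : log (-q) = log q + π * I := by
      rw [log, log, norm_neg, arg_neg_eq_arg_add_pi_of_im_neg hqi]
      push_cast
      ring
    have e3 : log (t : ℂ) = Real.log (-t) + π * I := by
      rw [log, arg_ofReal_of_neg h1, norm_real, Real.norm_of_nonpos h1.le]
    rw [e1, log_ofReal_mul (by linarith) (neg_ne_zero.2 hq), e2, e3]
    ring
  · rw [log_ofReal_mul h1 hq, ofReal_log h1.le]

lemma ofReal_mul_cpow_of_im_pos {t : ℝ} (ht : t ≠ 0) {q : ℂ} (h : 0 < (t * q).im) (j : ℕ) (s : ℂ) :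
    (t * q) ^ (-(j : ℂ) + s) = ((t : ℂ) ^ j)⁻¹ * exp (s * log t) * q ^ (-((j : ℂ) - s)) := by
  have ht' : (t : ℂ) ≠ 0 := by exact_mod_cast ht
  have hq : q ≠ 0 := by
    rintro rfl
    simp at h
  have e : (t : ℂ) ^ j = exp (j * log t) := by rw [exp_nat_mul, exp_log ht']
  rw [cpow_def_of_ne_zero (mul_ne_zero ht' hq), cpow_def_of_ne_zero hq,
    log_ofReal_mul_of_im_pos ht h, e, ← exp_neg, ← exp_add, ← exp_add]
  congr 1
  ring

/-- With e^w = (d/c) e^v the denominator is d (1 + e^v), and ad - bc = 1 makes the quotient (a/c) (1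
- 1/(ad (1 + e^v))). The power splits because the quotient lies in the upper half-plane. -/
lemma hypTerm_integrand_eq_right {a b c d : ℝ} (hdet : a * d - b * c = 1) (ha : a ≠ 0) (hc : c ≠ 0)
    (hd : d ≠ 0) (j : ℕ) (s r : ℂ) {w v δ : ℂ} (hδ : exp δ = (d / c : ℝ)) (hw : w = v + δ)
    (hv : 1 + exp v ≠ 0) (hM : 0 < ((a * exp w + b) / (c * exp w + d)).im) :
    exp (j * w) * ((c * exp w + d) ^ (2 * j))⁻¹ *
        ((a * exp w + b) / (c * exp w + d)) ^ (-(j : ℂ) + s) * exp (-r * w) =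
      exp (s * log ((a / c : ℝ) : ℂ) - r * δ) * (((a * d : ℝ) : ℂ) ^ j)⁻¹ *
        eulerKernel j r (j - s) ((1 / (a * d) : ℝ) : ℂ) v := by
  have ha' : (a : ℂ) ≠ 0 := by exact_mod_cast ha
  have hc' : (c : ℂ) ≠ 0 := by exact_mod_cast hc
  have hd' : (d : ℂ) ≠ 0 := by exact_mod_cast hd
  have hdet' : (a : ℂ) * d - b * c = 1 := by exact_mod_cast hdet
  have hz : exp w = (d / c) * exp v := by rw [hw, exp_add, hδ]; push_cast; ring
  have hD : c * exp w + d = d * (1 + exp v) := by rw [hz]; field_simp; ring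
  have hMq : (a * exp w + b) / (c * exp w + d) =
      ((a / c : ℝ) : ℂ) * (1 - ((1 / (a * d) : ℝ) : ℂ) / (1 + exp v)) := by
    rw [hD, hz]
    push_cast
    field_simp
    linear_combination (-1 : ℂ) * hdet'
  have hjw : exp (j * w) = (d / c) ^ j * exp (j * v) := by
    rw [exp_nat_mul, hz, mul_pow, ← exp_nat_mul]
  rw [hMq] at hM
  rw [hMq, ofReal_mul_cpow_of_im_pos (div_ne_zero ha hc) hM, hD, hjw, eulerKernel, betaKernel,
    sub_mul, exp_sub, exp_sub, hw, mul_add (-r), exp_add (-r * v), neg_mul, neg_mul, exp_neg,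
    exp_neg]
  have h1 : exp (r * v) ≠ 0 := exp_ne_zero _
  have h2 : exp (r * δ) ≠ 0 := exp_ne_zero _
  push_cast
  simp only [mul_pow, div_pow, pow_mul]
  have h3 : (1 + exp v) ^ 2 ≠ 0 := pow_ne_zero _ hv
  field_simp
  ring

/-- With e^w = (b/a) e^v the numerator is b (1 + e^v) and the quotient is (a/c) q⁻¹, with q = 1 +
1/(bc (1 + e^v)). The denominator contributes q^(-2j) and the quotient q^(j-s), so the first
parameter becomes j + s. -/
lemma hypTerm_integrand_eq_left {a b c d : ℝ} (hdet : a * d - b * c = 1) (ha : a ≠ 0) (hb : b ≠ 0)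
    (hc : c ≠ 0) (j : ℕ) (s r : ℂ) {w v δ : ℂ} (hδ : exp δ = (b / a : ℝ)) (hw : w = v + δ)
    (hv : 1 + exp v ≠ 0) (hM : 0 < ((a * exp w + b) / (c * exp w + d)).im) :
    exp (j * w) * ((c * exp w + d) ^ (2 * j))⁻¹ *
        ((a * exp w + b) / (c * exp w + d)) ^ (-(j : ℂ) + s) * exp (-r * w) =
      exp (s * log ((a / c : ℝ) : ℂ) - r * δ) * (((b * c : ℝ) : ℂ) ^ j)⁻¹ *
        eulerKernel j r (j + s) ((-1 / (b * c) : ℝ) : ℂ) v := by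
  have ha' : (a : ℂ) ≠ 0 := by exact_mod_cast ha
  have hc' : (c : ℂ) ≠ 0 := by exact_mod_cast hc
  have hb' : (b : ℂ) ≠ 0 := by exact_mod_cast hb
  have hdet' : (a : ℂ) * d - b * c = 1 := by exact_mod_cast hdet
  have hz : exp w = (b / a) * exp v := by rw [hw, exp_add, hδ]; push_cast; ring
  have hN : a * exp w + b = b * (1 + exp v) := by rw [hz]; field_simp; ring
  obtain ⟨q, hq⟩ : ∃ q : ℂ, q = 1 - ((-1 / (b * c) : ℝ) : ℂ) / (1 + exp v) := ⟨_, rfl⟩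
  have hD : c * exp w + d = (b * c / a) * (1 + exp v) * q := by
    rw [hq, hz]
    push_cast
    field_simp
    linear_combination hdet'
  have hD0 : c * exp w + d ≠ 0 := by
    intro h
    rw [h, div_zero] at hM
    simp at hM
  have hq0 : q ≠ 0 := right_ne_zero_of_mul (hD ▸ hD0)
  have hMq : (a * exp w + b) / (c * exp w + d) = ((a / c : ℝ) : ℂ) * q⁻¹ := by
    rw [hD, hN]
    push_cast
    field_simp
  have hjw : exp (j * w) = (b / a) ^ j * exp (j * v) := by
    rw [exp_nat_mul, hz, mul_pow, ← exp_nat_mul]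
  rw [hMq] at hM
  have harg : arg q ≠ π := by
    intro h
    have h1 := (arg_eq_pi_iff.1 h).2
    rw [im_ofReal_mul, inv_im, h1] at hM
    simp at hM
  have hpow : q⁻¹ ^ (-((j : ℂ) - s)) = q ^ (2 * j) * q ^ (-((j : ℂ) + s)) := by
    rw [inv_cpow _ _ harg, ← cpow_neg, ← cpow_natCast, ← cpow_add _ _ hq0]
    congr 1
    push_cast
    ring
  rw [hMq, ofReal_mul_cpow_of_im_pos (div_ne_zero ha hc) hM, hpow, hD, hjw, eulerKernel, ← hq,
    betaKernel, sub_mul, exp_sub, exp_sub, hw, mul_add (-r), exp_add (-r * v), neg_mul, neg_mul,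
    exp_neg, exp_neg]
  have h1 : exp (r * v) ≠ 0 := exp_ne_zero _
  have h2 : exp (r * δ) ≠ 0 := exp_ne_zero _
  push_cast
  simp only [mul_pow, div_pow, pow_mul]
  have h3 : (1 + exp v) ^ 2 ≠ 0 := pow_ne_zero _ hv
  have h4 : q ^ 2 ≠ 0 := pow_ne_zero _ hq0
  field_simp
  ring

/-- The real part of δ is absorbed by translation invariance on the line; its imaginary part moves
the line to im v = θ. -/
lemma lineIntegral_shift (j : ℕ) (s r : ℂ) (g : SL(2, ℝ)) {ρ θ : ℝ} {δ A : ℂ} {f : ℂ → ℂ}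
    (hδ : δ = ρ + (π / 2 - θ : ℝ) * I)
    (h : ∀ v w : ℂ, w ∈ piStrip → w = v + δ → v.im = θ →
      hypTerm j s g w * exp (-r * w) = A * f v) :
    lineIntegral j s r g = A * ∫ y : ℝ, f (y + θ * I) := by
  rw [lineIntegral, ← integral_const_mul,
    ← integral_add_right_eq_self (fun y : ℝ => hypTerm j s g (y + (π / 2 : ℝ) * I) * _) ρ]
  refine integral_congr_ae (ae_of_all _ fun y => ?_)
  refine h _ _ (pi_div_two_line _) ?_ (by simp)
  rw [hδ]
  push_cast
  ring

/-- Used with t = c/d: this is the logarithm of d/c whose translation brings out log(-c/d), as in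
the Kloosterman terms, at the cost of the factor e^(-πir). -/
lemma exp_pi_mul_I_sub_log {t : ℝ} (ht : t ≠ 0) :
    exp (π * I - log ((-t : ℝ) : ℂ)) = (1 / t : ℝ) := by
  have h : ((-t : ℝ) : ℂ) ≠ 0 := by exact_mod_cast neg_ne_zero.2 ht
  have ht' : (t : ℂ) ≠ 0 := by exact_mod_cast ht
  rw [exp_sub, exp_pi_mul_I, exp_log h]
  push_cast
  field_simp

/-- The principal logarithm of -t has imaginary part π for t > 0 and 0 for t < 0, so the translation
by 0 or π puts the new line at π/2 or -π/2. -/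
lemma pi_mul_I_sub_log_eq {t θ : ℝ} (h : 0 < t ∧ θ = π / 2 ∨ t < 0 ∧ θ = -(π / 2)) :
    π * I - log ((-t : ℝ) : ℂ) = (-Real.log t : ℝ) + (π / 2 - θ : ℝ) * I := by
  rcases h with ⟨ht, rfl⟩ | ⟨ht, rfl⟩
  · rw [log, arg_ofReal_of_neg (by linarith), norm_real, norm_neg, Real.norm_of_nonneg ht.le]
    push_cast
    ring
  · rw [← ofReal_log (by linarith), Real.log_neg_eq_log]
    push_cast
    ring

lemma lineIntegral_eq_euler (j : ℕ) (s r : ℂ) {g : SL(2, ℝ)} (hg : Nondeg g) {θ : ℝ}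
    (hθ : 0 < g 1 0 / g 1 1 ∧ θ = π / 2 ∨ g 1 0 / g 1 1 < 0 ∧ θ = -(π / 2)) :
    lineIntegral j s r g = exp (-(r * (π * I))) *
      exp (s * log ((g 0 0 / g 1 0 : ℝ) : ℂ) + r * log ((-g 1 0 / g 1 1 : ℝ) : ℂ)) *
      (((g 0 0 * g 1 1 : ℝ) : ℂ) ^ j)⁻¹ *
      ∫ y : ℝ, eulerKernel j r (j - s) ((1 / (g 0 0 * g 1 1) : ℝ) : ℂ) (y + θ * I) := by
  obtain ⟨ha, hb, hc, hd⟩ := hg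
  have hdet := det_entries g
  have hθ' : |θ| ≤ π / 2 := by
    have := Real.pi_pos
    rcases hθ with ⟨-, rfl⟩ | ⟨-, rfl⟩
    · exact (abs_of_pos (by positivity)).le
    · rw [abs_neg]; exact (abs_of_pos (by positivity)).le
  refine lineIntegral_shift j s r g (pi_mul_I_sub_log_eq hθ)
    (f := eulerKernel j r (j - s) ((1 / (g 0 0 * g 1 1) : ℝ) : ℂ)) fun v w hw hwv hv => ?_
  have hδ := exp_pi_mul_I_sub_log (div_ne_zero hc hd)
  rw [one_div_div] at hδ
  refine (hypTerm_integrand_eq_right hdet ha hc hd j s r hδ hwv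
    (one_add_ne_zero (exp_re_nonneg (hv ▸ hθ'))) (moebius_im_pos g hw)).trans ?_
  rw [← exp_add, neg_div]
  congr 3
  ring

/-- The value of the line integral when the argument of the hypergeometric function is `1 / (ad)`. -/
lemma lineIntegral_eq_right {j : ℕ} (hj : 1 ≤ j) (s : ℂ) {r : ℂ} (hr : r.re = 0) {g : SL(2, ℝ)}
    (hg : Nondeg g) (h : g 0 0 * g 1 1 ∉ Ioo 0 1 ∨ 0 < g 0 0 * g 1 0) :
    lineIntegral j s r g = exp (-(r * (π * I))) * betaFn (j - r) (j + r) *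
      (hyp2F1 (j - s) (j + r) ((2 * j : ℕ) : ℂ) (1 / ((g 0 0 * g 1 1 : ℝ) : ℂ)) *
      (exp (s * log ((g 0 0 / g 1 0 : ℝ) : ℂ) + r * log ((-g 1 0 / g 1 1 : ℝ) : ℂ)) /
        ((g 0 0 * g 1 1 : ℝ) : ℂ) ^ j)) := by
  have hpi := Real.pi_pos
  obtain ⟨ha, hb, hc, hd⟩ := id hg
  have hcast : (1 / ((g 0 0 * g 1 1 : ℝ) : ℂ)) = ((1 / (g 0 0 * g 1 1) : ℝ) : ℂ) := by push_cast; rfl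
  have key : ∃ θ : ℝ, (0 < g 1 0 / g 1 1 ∧ θ = π / 2 ∨ g 1 0 / g 1 1 < 0 ∧ θ = -(π / 2)) ∧
      betaFn (j - r) (j + r) * hyp2F1 (j - s) (j + r) ((2 * j : ℕ) : ℂ)
        ((1 / (g 0 0 * g 1 1) : ℝ) : ℂ) =
      ∫ y : ℝ, eulerKernel j r (j - s) ((1 / (g 0 0 * g 1 1) : ℝ) : ℂ) (y + θ * I) := by
    have hdet := det_entries g
    generalize g 0 0 = a at *
    generalize g 0 1 = b at *
    generalize g 1 0 = c at *
    generalize g 1 1 = d at *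
    have hne1 : a * d ≠ 1 := fun h1 => mul_ne_zero hb hc (by linarith)
    by_cases hC : a * d ∈ Ioo (0 : ℝ) 1
    -- For ad > 0 the signs of c/d and ac agree. Thus ac > 0 gives the upper line, the one that
    -- represents the principal value on the cut.
    · have hac : 0 < a * c := h.resolve_left (not_not.2 hC)
      refine ⟨π / 2, Or.inl ⟨?_, rfl⟩, betaFn_mul_hyp2F1_of_one_lt hj hr _ ?_⟩
      · have h1 : 0 < (a * c) / (a * d) := div_pos hac hC.1
        rwa [mul_div_mul_left _ _ ha] at h1
      · exact (one_lt_div hC.1).2 hC.2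
    -- Off the cut both lines represent the same value, and the sign of c/d does not matter.
    · have hx : 1 / (a * d) < 1 := by
        rcases lt_or_ge 0 (a * d) with h0 | h0
        · have : 1 ≤ a * d := not_lt.1 fun h1 => hC ⟨h0, h1⟩
          exact (div_lt_one h0).2 (lt_of_le_of_ne this hne1.symm)
        · exact (one_div_nonpos.2 h0).trans_lt one_pos
      rcases (div_ne_zero hc hd).lt_or_gt with h1 | h1
      · refine ⟨-(π / 2), Or.inr ⟨h1, rfl⟩, betaFn_mul_hyp2F1_of_lt_one hj hr _ hx ?_⟩
        rw [abs_neg]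
        exact (abs_of_pos (by positivity)).le
      · exact ⟨π / 2, Or.inl ⟨h1, rfl⟩, betaFn_mul_hyp2F1_of_lt_one hj hr _ hx
          (abs_of_pos (by positivity)).le⟩
  obtain ⟨θ, hθ, hval⟩ := key
  rw [lineIntegral_eq_euler j s r hg hθ, hcast, ← hval]
  ring

/-- The value of the line integral when the argument of the hypergeometric function is
`-1 / (ad - 1)`. -/
lemma lineIntegral_eq_left {j : ℕ} (hj : 1 ≤ j) (s : ℂ) {r : ℂ} (hr : r.re = 0) {g : SL(2, ℝ)}
    (hg : Nondeg g) (hC : g 0 0 * g 1 1 ∈ Ioo 0 1) (hac : g 0 0 * g 1 0 < 0) :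
    lineIntegral j s r g = exp (-(r * (π * I))) * betaFn (j - r) (j + r) *
      (((g 0 0 * g 1 1 / (g 0 0 * g 1 1 - 1) : ℝ) : ℂ) ^ r *
      hyp2F1 (j + s) (j + r) ((2 * j : ℕ) : ℂ) (-1 / (((g 0 0 * g 1 1 : ℝ) : ℂ) - 1)) *
      (exp (s * log ((g 0 0 / g 1 0 : ℝ) : ℂ) + r * log ((-g 1 0 / g 1 1 : ℝ) : ℂ)) /
        (((g 0 0 * g 1 1 : ℝ) : ℂ) - 1) ^ j)) := by
  have hpi := Real.pi_pos
  obtain ⟨ha, hb, hc, hd⟩ := id hg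
  have hmain : ∀ w v : ℂ, ∀ δ : ℂ, w ∈ piStrip → exp δ = (g 0 1 / g 0 0 : ℝ) → w = v + δ →
      1 + exp v ≠ 0 → hypTerm j s g w * exp (-r * w) =
      exp (s * log ((g 0 0 / g 1 0 : ℝ) : ℂ) - r * δ) * (((g 0 1 * g 1 0 : ℝ) : ℂ) ^ j)⁻¹ *
        eulerKernel j r (j + s) ((-1 / (g 0 1 * g 1 0) : ℝ) : ℂ) v := fun w v δ hw hδ hwv hv =>
    hypTerm_integrand_eq_left (det_entries g) ha hb hc j s r hδ hwv hv (moebius_im_pos g hw)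
  have hdet := det_entries g
  have hshift := lineIntegral_shift j s r g (ρ := Real.log (g 0 1 / g 0 0)) (θ := π / 2)
    (δ := (Real.log (g 0 1 / g 0 0) : ℝ))
    (A := exp (s * log ((g 0 0 / g 1 0 : ℝ) : ℂ) - r * (Real.log (g 0 1 / g 0 0) : ℝ)) *
      (((g 0 1 * g 1 0 : ℝ) : ℂ) ^ j)⁻¹)
    (f := eulerKernel j r (j + s) ((-1 / (g 0 1 * g 1 0) : ℝ) : ℂ)) (by simp)
  generalize hypTerm j s g = H at *
  generalize lineIntegral j s r g = W at *
  generalize g 0 0 = a at *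
  generalize g 0 1 = b at *
  generalize g 1 0 = c at *
  generalize g 1 1 = d at *
  have hbc : b * c = a * d - 1 := by linarith
  have hbc0 : b * c < 0 := by linarith [hC.2]
  -- From bc < 0 and ac < 0 follows b/a > 0: the translation by log(b/a) is real and keeps the upper
  -- line, as required by the argument -1/(bc) > 1.
  have hba : 0 < b / a := by
    have : 0 < (b * c) / (a * c) := div_pos_of_neg_of_neg hbc0 hac
    rwa [mul_div_mul_right _ _ hc] at this
  have hdc : 0 < -c / d := by
    have : 0 < -(a * c) / (a * d) := div_pos (by linarith) hC.1
    rwa [← mul_neg, mul_div_mul_left _ _ ha] at this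
  rw [hshift fun v w hw hwv hv => hmain w v _ hw
    (by rw [← ofReal_exp, Real.exp_log hba]) hwv
    (one_add_ne_zero (exp_re_nonneg (by rw [hv]; exact (abs_of_pos (by positivity)).le)))]
  have hx : 1 < -1 / (b * c) := by
    rw [lt_div_iff_of_neg hbc0]
    linarith [hC.1]
  have hc1 : (-1 / (((a * d : ℝ) : ℂ) - 1)) = ((-1 / (b * c) : ℝ) : ℂ) := by
    rw [hbc]; push_cast; rfl
  have hc2 : (((a * d : ℝ) : ℂ) - 1) = ((b * c : ℝ) : ℂ) := by rw [hbc]; push_cast; rfl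
  rw [← betaFn_mul_hyp2F1_of_one_lt hj hr _ hx, hc1, hc2]
  -- Here (ad/(1 - ad)) (-c/d) = a/b. Replacing log(b/a) by log(-c/d) leaves the real logarithm of
  -- ad/(1 - ad); the principal logarithm of the negative number ad/(ad - 1) has the extra πi,
  -- compensated by e^(-πir).
  have hpow : exp (s * log ((a / c : ℝ) : ℂ) - r * (Real.log (b / a) : ℝ)) =
      exp (-(r * (π * I))) * ((a * d / (a * d - 1) : ℝ) : ℂ) ^ r *
        exp (s * log ((a / c : ℝ) : ℂ) + r * log ((-c / d : ℝ) : ℂ)) := by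
    have hneg : a * d / (a * d - 1) < 0 := div_neg_of_pos_of_neg hC.1 (by linarith [hC.2])
    have hne : ((a * d / (a * d - 1) : ℝ) : ℂ) ≠ 0 := by exact_mod_cast hneg.ne
    have hlog : log ((a * d / (a * d - 1) : ℝ) : ℂ) =
        Real.log (-(a * d / (a * d - 1))) + π * I := by
      rw [log, arg_ofReal_of_neg hneg, norm_real, Real.norm_of_nonpos hneg.le]
    have hreal : Real.log (-(a * d / (a * d - 1))) + Real.log (-c / d) = -Real.log (b / a) := by
      rw [← Real.log_mul (neg_ne_zero.2 hneg.ne) hdc.ne', ← Real.log_inv, ← hbc]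
      congr 1
      field_simp
    have hreal' : (Real.log (-(a * d / (a * d - 1))) : ℂ) + (Real.log (-c / d) : ℂ) =
        -(Real.log (b / a) : ℂ) := by exact_mod_cast hreal
    rw [cpow_def_of_ne_zero hne, hlog, ← ofReal_log hdc.le, ← exp_add, ← exp_add]
    congr 1
    linear_combination (-r) * hreal'
  rw [hpow]
  ring


/-! ### The Poincaré series in logarithmic coordinates -/

section Poincare

variable {Γ : Subgroup SL(2, ℝ)} {η η' : OnePoint ℝ × OnePoint ℝ} {σ σ' : SL(2, ℝ)}

/-- The exponent `2 π i m / l`. -/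
def hypFreq (l : ℝ) (m : ℤ) : ℂ := 2 * π * I * m / l

lemma hypFreq_re (l : ℝ) (m : ℤ) : (hypFreq l m).re = 0 := by
  have : hypFreq l m = ((2 * π * m / l : ℝ) : ℂ) * I := by rw [hypFreq]; push_cast; ring
  rw [this]; simp

lemma slash_apply_of_SL (k : ℕ) (g : SL(2, ℝ)) (f : ℍ → ℂ) (z : ℍ) :
    SlashAction.map (k : ℤ) (g : GL (Fin 2) ℝ) f z =
      f (g • z) * ((g 1 0 * z + g 1 1 : ℂ) ^ k)⁻¹ := by
  rw [ModularForm.slash_apply]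
  have h1 : UpperHalfPlane.denom (g : GL (Fin 2) ℝ) z = g 1 0 * z + g 1 1 := rfl
  rw [h1, zpow_neg, zpow_natCast]
  simp [UpperHalfPlane.σ]
  exact Or.inl rfl

lemma exp_log_coe (z : ℍ) : exp (log (z : ℂ)) = z := exp_log z.ne_zero

lemma slash_hypMonomial (j : ℕ) (l : ℝ) (m : ℤ) (g : SL(2, ℝ)) (z : ℍ) :
    SlashAction.map ((2 * j : ℕ) : ℤ) (g : GL (Fin 2) ℝ) (hypMonomial (2 * j) l m) z *
      exp (j * log (z : ℂ)) = hypTerm j (hypFreq l m) g (log (z : ℂ)) := by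
  rw [slash_apply_of_SL, hypMonomial, UpperHalfPlane.coe_specialLinearGroup_apply, hypTerm, expNum,
    expDen, exp_log_coe]
  have : -((2 * j : ℕ) : ℂ) / 2 + 2 * π * I * m / l = -(j : ℂ) + hypFreq l m := by
    rw [hypFreq]; push_cast; ring
  rw [this]
  simp only [Algebra.algebraMap_self, RingHom.id_apply]
  ring

lemma hypMonomial_mul_exp (j : ℕ) (l : ℝ) (n : ℤ) (z : ℍ) :
    hypMonomial (2 * j) l n z * exp (j * log (z : ℂ)) = exp (2 * π * I * n / l * log (z : ℂ)) := by
  rw [hypMonomial, cpow_def_of_ne_zero z.ne_zero, ← exp_add]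
  congr 1
  push_cast
  ring

/-- The Poincaré series, transformed by `σ'`, in logarithmic coordinates. -/
def hypSum (Γ : Subgroup SL(2, ℝ)) (η : OnePoint ℝ × OnePoint ℝ) (σ σ' : SL(2, ℝ)) (j : ℕ) (s w : ℂ) :
    ℂ :=
  ∑' p : RightCosets Γ η, hypTerm j s (transMatrix σ σ' p.out) w

/-- A bound for the terms of the Poincaré series, up to the factor `rowProd g`. -/
def termBound (j : ℕ) (s w : ℂ) : ℝ :=
  Real.exp (π * |s.im|) * Real.exp (j * w.re) * stripBound w ^ j

lemma continuousOn_termBound (j : ℕ) (s : ℂ) : ContinuousOn (termBound j s) piStrip :=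
  (Continuous.continuousOn (by fun_prop)).mul (continuousOn_stripBound.pow j)

lemma slash_hypPoincare (j : ℕ) (m : ℤ) (z : ℍ) :
    SlashAction.map ((2 * j : ℕ) : ℤ) (σ' : GL (Fin 2) ℝ) (hypPoincare (2 * j) Γ η σ m) z *
      exp (j * log (z : ℂ)) = hypSum Γ η σ σ' j (hypFreq (pairLength Γ η) m) (log (z : ℂ)) := by
  rw [slash_apply_of_SL, hypPoincare, hypSum, ← tsum_mul_right, ← tsum_mul_right]
  refine tsum_congr fun p => ?_
  rw [← slash_hypMonomial, poincareTerm, ← slash_apply_of_SL, ← SlashAction.slash_mul, transMatrix,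
    ← map_mul]

lemma poincareTerm_mul_exp (j : ℕ) (m : ℤ) (z : ℍ) (p : RightCosets Γ η) :
    poincareTerm (2 * j) Γ η σ m z p * exp (j * log (z : ℂ)) =
      hypTerm j (hypFreq (pairLength Γ η) m) (transMatrix σ 1 p.out) (log (z : ℂ)) := by
  rw [poincareTerm, slash_hypMonomial, transMatrix, mul_one]

/-- The action of `h` on the right of `Γ_η \ Γ`. -/
def rightCosetsEquiv (Γ : Subgroup SL(2, ℝ)) (η : OnePoint ℝ × OnePoint ℝ) (h : Γ) :
    RightCosets Γ η ≃ RightCosets Γ η where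
  toFun p := rightMk Γ η (p.out * h)
  invFun p := rightMk Γ η (p.out * h⁻¹)
  left_inv p := by
    have h1 := rightMk_eq_iff.1 (rightMk_out (rightMk Γ η (p.out * h)))
    conv_rhs => rw [← rightMk_out p]
    rw [rightMk_eq_iff]
    convert h1 using 1
    group
  right_inv p := by
    have h1 := rightMk_eq_iff.1 (rightMk_out (rightMk Γ η (p.out * h⁻¹)))
    conv_rhs => rw [← rightMk_out p]
    rw [rightMk_eq_iff]
    convert h1 using 1
    group

/-- The logarithm is a bijection from the upper half-plane to the strip, and multiplication by z^j =
z^(k/2) turns the monomials into pure exponentials. -/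
lemma isHypExpansion_iff (j : ℕ) (m : ℤ) (L : ℝ) (c : ℤ → ℂ) :
    IsHypExpansion (2 * j) L σ' (hypPoincare (2 * j) Γ η σ m) c ↔ ∀ w ∈ piStrip,
      HasSum (fun n : ℤ => c n * exp (2 * π * I * n / L * w))
        (hypSum Γ η σ σ' j (hypFreq (pairLength Γ η) m) w) := by
  have key : ∀ z : ℍ, HasSum (fun n : ℤ => c n * hypMonomial (2 * j) L n z)
      (SlashAction.map ((2 * j : ℕ) : ℤ) (σ' : GL (Fin 2) ℝ) (hypPoincare (2 * j) Γ η σ m) z) ↔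
      HasSum (fun n : ℤ => c n * exp (2 * π * I * n / L * log (z : ℂ)))
        (hypSum Γ η σ σ' j (hypFreq (pairLength Γ η) m) (log (z : ℂ))) := by
    intro z
    rw [← hasSum_mul_right_iff (exp_ne_zero (j * log (z : ℂ))), slash_hypPoincare]
    simp only [mul_assoc (c _), hypMonomial_mul_exp]
  constructor
  · intro h w hw
    have := (key ⟨exp w, exp_im_pos hw⟩).1 (h _)
    rwa [show log ((⟨exp w, exp_im_pos hw⟩ : ℍ) : ℂ) = w from log_exp_piStrip hw] at this
  · intro h z
    exact (key z).2 (h _ (log_mem_piStrip z.im_pos))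

/-! ### Convergence, periodicity and termwise integration of the Poincaré series -/

variable [DiscreteTopology Γ]

lemma leftInvariant_hypTerm (hη : IsHyperbolicPair Γ η) (hσ : IsScaling η σ) (j : ℕ) (m : ℤ) {w : ℂ}
    (hw : w ∈ piStrip) :
    LeftInvariant (pairLength Γ η) fun g => hypTerm j (hypFreq (pairLength Γ η) m) g w where
  diag i g := hypTerm_left_diagExp (pairLength_pos hη hσ) j m i g hw
  neg g := hypTerm_neg _ _ g w

lemma leftInvariant_stripCoeff (hη : IsHyperbolicPair Γ η) (hσ : IsScaling η σ) (L : ℝ) (j : ℕ)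
    (m n : ℤ) : LeftInvariant (pairLength Γ η) fun g =>
      stripCoeff L (hypTerm j (hypFreq (pairLength Γ η) m) g) (π / 2) n where
  diag i g := by
    refine intervalIntegral.integral_congr fun x _ => ?_
    have hw : (L * x + (π / 2 : ℝ) * I : ℂ) ∈ piStrip := by
      have := pi_div_two_line (L * x)
      push_cast at this ⊢
      exact this
    exact congrArg (· * _) ((leftInvariant_hypTerm hη hσ j m hw).diag i g)
  neg g := by
    refine intervalIntegral.integral_congr fun x _ => ?_
    exact congrArg (· * _) (hypTerm_neg _ _ g _)

lemma summable_hypTerm (hη : IsHyperbolicPair Γ η) (hσ : IsScaling η σ) {j : ℕ} (hj : 2 ≤ j) {s : ℂ}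
    (hs : s.re = 0) {w : ℂ} (hw : w ∈ piStrip) :
    Summable fun p : RightCosets Γ η => hypTerm j s (transMatrix σ σ' p.out) w :=
  Summable.of_norm_bounded ((summable_inv_rowProd (σ' := σ') hη hσ).mul_left (termBound j s w))
    fun _ => norm_hypTerm_le_rowProd hj hs _ hw

lemma summable_poincareTerm (hη : IsHyperbolicPair Γ η) (hσ : IsScaling η σ) {j : ℕ} (hj : 2 ≤ j)
    (m : ℤ) (z : ℍ) : Summable (poincareTerm (2 * j) Γ η σ m z) := by
  have h := summable_hypTerm (σ' := 1) hη hσ hj (hypFreq_re (pairLength Γ η) m)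
    (log_mem_piStrip z.im_pos)
  refine (h.mul_right (exp (j * log (z : ℂ)))⁻¹).congr fun p => ?_
  rw [← poincareTerm_mul_exp, mul_inv_cancel_right₀ (exp_ne_zero _)]

lemma differentiableOn_hypSum (hη : IsHyperbolicPair Γ η) (hσ : IsScaling η σ) {j : ℕ} (hj : 2 ≤ j)
    {s : ℂ} (hs : s.re = 0) : DifferentiableOn ℂ (hypSum Γ η σ σ' j s) piStrip :=
  differentiableOn_tsum_of_le_mul isOpen_piStrip (fun _ => differentiableOn_hypTerm _ _ _)
    (summable_inv_rowProd hη hσ) (fun _ => inv_nonneg.2 (zero_le_one.trans (one_le_rowProd _)))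
    (continuousOn_termBound j s) fun _ _ hw => norm_hypTerm_le_rowProd hj hs _ hw

/-- Translation by ℓ_η' is right multiplication by a generator of Γ_η', up to sign, and this
permutes Γ_η \ Γ. -/
lemma hypSum_add_pairLength (hη : IsHyperbolicPair Γ η) (hσ : IsScaling η σ)
    (hη' : IsHyperbolicPair Γ η') (hσ' : IsScaling η' σ') (j : ℕ) (m : ℤ) {w : ℂ}
    (hw : w ∈ piStrip) :
    hypSum Γ η σ σ' j (hypFreq (pairLength Γ η) m) (w + pairLength Γ η') =
      hypSum Γ η σ σ' j (hypFreq (pairLength Γ η) m) w := by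
  obtain ⟨h, -, hh⟩ := exists_transMatrix_right (σ := σ) hη' hσ' 1
  refine Eq.trans ?_ ((rightCosetsEquiv Γ η h).tsum_eq _)
  refine tsum_congr fun p => ?_
  change _ = hypTerm j _ (transMatrix σ σ' (rightMk Γ η (p.out * h)).out) w
  have hG := leftInvariant_hypTerm hη hσ j m hw
  rw [hG.out_rightMk hη hσ, ← hypTerm_right_diagExp]
  rcases hh p.out with h1 | h1 <;> rw [h1]
  · rw [Int.cast_one, one_mul]
  · rw [hypTerm_neg, Int.cast_one, one_mul]

/-- A summable family of nonzero numbers has a countable index set. Dominated convergence for the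
series needs this. -/
lemma countable_rightCosets (hη : IsHyperbolicPair Γ η) (hσ : IsScaling η σ) :
    Countable (RightCosets Γ η) := by
  have h := (summable_inv_rowProd (σ' := (1 : SL(2, ℝ))) hη hσ).countable_support
  rw [show Function.support (fun p : RightCosets Γ η => (rowProd (transMatrix σ 1 p.out))⁻¹) = univ
    from eq_univ_of_forall fun p =>
      inv_ne_zero (one_pos.trans_le (one_le_rowProd (transMatrix σ 1 p.out))).ne'] at h
  exact countable_univ_iff.1 h

/-- The majorant is a summable constant depending on the coset times a function continuous on the
segment, so dominated convergence exchanges sum and integral. -/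
lemma hasSum_stripCoeff_hypTerm (hη : IsHyperbolicPair Γ η) (hσ : IsScaling η σ) {j : ℕ} (hj : 2 ≤ j)
    {s : ℂ} (hs : s.re = 0) (L : ℝ) (n : ℤ) :
    HasSum (fun p : RightCosets Γ η => stripCoeff L (hypTerm j s (transMatrix σ σ' p.out)) (π / 2) n)
      (stripCoeff L (hypSum Γ η σ σ' j s) (π / 2) n) := by
  have := countable_rightCosets hη hσ
  have hu := summable_inv_rowProd (σ' := σ') hη hσ
  have hline : ∀ x : ℝ, (L * x + (π / 2 : ℝ) * I : ℂ) ∈ piStrip := fun x => by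
    have := pi_div_two_line (L * x)
    push_cast at this ⊢
    exact this
  obtain ⟨E, hE⟩ : ∃ E : ℝ → ℂ, E = fun x : ℝ =>
    exp (-(2 * π * I * n / L) * (L * x + (π / 2 : ℝ) * I)) := ⟨_, rfl⟩
  have hEc : Continuous E := by rw [hE]; fun_prop
  have hcomp : ∀ {X : Type} [TopologicalSpace X] {f : ℂ → X}, ContinuousOn f piStrip →
      Continuous fun x : ℝ => f (L * x + (π / 2 : ℝ) * I) := fun hf =>
    hf.comp_continuous (by fun_prop) hline
  have hB := hcomp (continuousOn_termBound j s)
  have hmain := intervalIntegral.hasSum_integral_of_dominated_convergence (a := 0) (b := 1)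
    (μ := volume) (F := fun (p : RightCosets Γ η) (x : ℝ) =>
      hypTerm j s (transMatrix σ σ' p.out) (L * x + (π / 2 : ℝ) * I) * E x)
    (f := fun x : ℝ => hypSum Γ η σ σ' j s (L * x + (π / 2 : ℝ) * I) * E x)
    (fun p x => (rowProd (transMatrix σ σ' p.out))⁻¹ *
      (termBound j s (L * x + (π / 2 : ℝ) * I) * ‖E x‖)) ?_ ?_ ?_ ?_ ?_
  · rw [hE] at hmain
    exact hmain
  · intro p
    exact ((hcomp (differentiableOn_hypTerm j s _).continuousOn).mul hEc).aestronglyMeasurable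
  · refine fun p => ae_of_all _ fun x _ => ?_
    rw [norm_mul]
    refine (mul_le_mul_of_nonneg_right (norm_hypTerm_le_rowProd hj hs _ (hline x))
      (norm_nonneg _)).trans_eq ?_
    rw [termBound]
    ring
  · exact ae_of_all _ fun x _ => hu.mul_right _
  · simp only [tsum_mul_right]
    exact (continuous_const.mul (hB.mul hEc.norm)).intervalIntegrable _ _
  · exact ae_of_all _ fun x _ => (summable_hypTerm hη hσ hj hs (hline x)).hasSum.mul_right _

/-- Existence of the hyperbolic expansion of the Poincaré series. -/
theorem isHypExpansion_stripCoeff (hη : IsHyperbolicPair Γ η) (hσ : IsScaling η σ)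
    (hη' : IsHyperbolicPair Γ η') (hσ' : IsScaling η' σ') {j : ℕ} (hj : 2 ≤ j) (m : ℤ) :
    IsHypExpansion (2 * j) (pairLength Γ η') σ' (hypPoincare (2 * j) Γ η σ m)
      (stripCoeff (pairLength Γ η') (hypSum Γ η σ σ' j (hypFreq (pairLength Γ η) m)) (π / 2)) :=
  (isHypExpansion_iff j m _ _).2 fun _ hw => hasSum_stripCoeff (pairLength_pos hη' hσ')
    (differentiableOn_hypSum hη hσ hj (hypFreq_re _ m))
    (fun _ hw => hypSum_add_pairLength hη hσ hη' hσ' j m hw) hw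

/-- Uniqueness of the hyperbolic expansion of the Poincaré series. -/
theorem IsHypExpansion.eq_stripCoeff (hη' : IsHyperbolicPair Γ η') (hσ' : IsScaling η' σ') {j : ℕ}
    {m : ℤ} {c : ℤ → ℂ}
    (h : IsHypExpansion (2 * j) (pairLength Γ η') σ' (hypPoincare (2 * j) Γ η σ m) c) :
    c = stripCoeff (pairLength Γ η') (hypSum Γ η σ σ' j (hypFreq (pairLength Γ η) m)) (π / 2) :=
  stripCoeff_unique (pairLength_pos hη' hσ') ((isHypExpansion_iff j m _ _).1 h)

end Poincare


section Coefficients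

variable {Γ : Subgroup SL(2, ℝ)} {η η' : OnePoint ℝ × OnePoint ℝ} {σ σ' : SL(2, ℝ)}

/-! ### Lengths of equivalent pairs -/

lemma mem_pairStab {γ : Γ} : γ ∈ pairStab Γ η ↔ bdAct γ η.1 = η.1 ∧ bdAct γ η.2 = η.2 := Iff.rfl

lemma pairLength_swap : pairLength Γ η.swap = pairLength Γ η := by
  have h : pairStab Γ η.swap = pairStab Γ η := by
    ext γ
    rw [mem_pairStab, mem_pairStab]
    exact and_comm
  rw [pairLength, h, pairLength]

lemma PairEquiv.symm (h : PairEquiv Γ η' η) : PairEquiv Γ η η' := by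
  obtain ⟨γ, hγ, h1, h2⟩ := h
  exact ⟨γ⁻¹, inv_mem hγ, (bdAct_inv_eq_iff _ _ _).2 h1.symm, (bdAct_inv_eq_iff _ _ _).2 h2.symm⟩

lemma PairEquiv.exists_mem_pairStab (h : PairEquiv Γ η' η) {δ : Γ} (hδ : δ ∈ pairStab Γ η) :
    ∃ δ' ∈ pairStab Γ η', Matrix.trace ((δ' : SL(2, ℝ)) : Matrix (Fin 2) (Fin 2) ℝ) =
      Matrix.trace ((δ : SL(2, ℝ)) : Matrix (Fin 2) (Fin 2) ℝ) := by
  obtain ⟨γ, hγ, h1, h2⟩ := h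
  rw [mem_pairStab] at hδ
  refine ⟨⟨γ⁻¹, inv_mem hγ⟩ * δ * ⟨γ, hγ⟩, ?_, ?_⟩
  · rw [mem_pairStab]
    simp only [Subgroup.coe_mul, bdAct_mul, bdAct_inv_eq_iff, h1, h2, hδ.1, hδ.2, and_self]
  · rw [Subgroup.coe_mul, Subgroup.coe_mul, Matrix.SpecialLinearGroup.coe_mul, Matrix.trace_mul_comm,
      ← Matrix.SpecialLinearGroup.coe_mul]
    congr 2
    simp only [← mul_assoc]
    rw [mul_inv_cancel, one_mul]

/-- Lengths are read from traces, which conjugation preserves. The equality lets a degenerate term,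
of frequency 2πm/ℓ_η, be expanded with respect to ℓ_η'. -/
lemma PairEquiv.pairLength_eq (h : PairEquiv Γ η' η) : pairLength Γ η' = pairLength Γ η := by
  rw [pairLength, pairLength]
  congr 1
  ext l
  constructor
  · rintro ⟨hl, δ, hδ, ht⟩
    obtain ⟨δ', hδ', ht'⟩ := h.symm.exists_mem_pairStab hδ
    exact ⟨hl, δ', hδ', by rw [ht', ht]⟩
  · rintro ⟨hl, δ, hδ, ht⟩
    obtain ⟨δ', hδ', ht'⟩ := h.exists_mem_pairStab hδ
    exact ⟨hl, δ', hδ', by rw [ht', ht]⟩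

/-! ### The degenerate terms -/

/-- A single exponential is its own Fourier series, so uniqueness of the coefficients applies. -/
lemma stripCoeff_eq_ite {L : ℝ} (hL : 0 < L) {h : ℂ → ℂ} {A : ℂ} {i : ℤ}
    (hh : ∀ w ∈ piStrip, h w = A * exp (hypFreq L i * w)) (n : ℤ) :
    stripCoeff L h (π / 2) n = if n = i then A else 0 := by
  have hc : ∀ w ∈ piStrip, HasSum (fun n : ℤ => (if n = i then A else 0) *
      exp (2 * π * I * n / L * w)) (h w) := by
    intro w hw
    rw [hh w hw]
    convert hasSum_ite_eq i (A * exp (hypFreq L i * w)) using 1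
    ext n
    split_ifs with hn
    · rw [hn, hypFreq]
    · rw [zero_mul]
  rw [← stripCoeff_unique hL hc]

lemma hypTerm_diag (j : ℕ) (s : ℂ) {g : SL(2, ℝ)} {a : ℝ} (ha : a ≠ 0) (h00 : g 0 0 = a)
    (h01 : g 0 1 = 0) (h10 : g 1 0 = 0) (h11 : g 1 1 = 1 / a) {w : ℂ} (hw : w ∈ piStrip) :
    hypTerm j s g w = ((a ^ 2 : ℝ) : ℂ) ^ s * exp (s * w) := by
  have ha' : (a : ℂ) ≠ 0 := by exact_mod_cast ha
  have h2 : 0 < a ^ 2 := by positivity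
  have h2' : ((a ^ 2 : ℝ) : ℂ) ≠ 0 := by exact_mod_cast h2.ne'
  have hN : expNum g w = a * exp w := by rw [expNum, h00, h01]; simp
  have hD : expDen g w = 1 / a := by rw [expDen, h10, h11]; simp
  have hM : expNum g w / expDen g w = ((a ^ 2 : ℝ) : ℂ) * exp w := by
    rw [hN, hD]; push_cast; field_simp
  have hlog : log (((a ^ 2 : ℝ) : ℂ) * exp w) = log ((a ^ 2 : ℝ) : ℂ) + w := by
    rw [log_ofReal_mul h2 (exp_ne_zero _), log_exp_piStrip hw, ofReal_log h2.le]
  have e1 : exp (-(j * log ((a ^ 2 : ℝ) : ℂ))) = ((a : ℂ) ^ (2 * j))⁻¹ := by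
    rw [exp_neg, exp_nat_mul, exp_log h2', pow_mul]; push_cast; rfl
  rw [hypTerm, hM, hD, cpow_def_of_ne_zero (mul_ne_zero h2' (exp_ne_zero _)), hlog,
    cpow_def_of_ne_zero h2']
  have e2 : (log ((a ^ 2 : ℝ) : ℂ) + w) * (-(j : ℂ) + s) =
      -(j * log ((a ^ 2 : ℝ) : ℂ)) + -(j * w) + log ((a ^ 2 : ℝ) : ℂ) * s + s * w := by ring
  rw [e2, exp_add, exp_add, exp_add, e1, exp_neg]
  have e3 := exp_ne_zero (j * w)
  simp only [div_pow, one_pow]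
  field_simp

/-- The quotient is -b²/z = b² e^(πi - w), and πi - w is again in the strip, so its logarithm is
exact. Hence the frequency is reversed, and the factors (-1)^j and e^(πis) appear. -/
lemma hypTerm_antidiag (j : ℕ) (s : ℂ) {g : SL(2, ℝ)} {b : ℝ} (hb : b ≠ 0) (h00 : g 0 0 = 0)
    (h01 : g 0 1 = b) (h10 : g 1 0 = -1 / b) (h11 : g 1 1 = 0) {w : ℂ} (hw : w ∈ piStrip) :
    hypTerm j s g w = (-1) ^ j * exp (s * (π * I)) * ((b ^ 2 : ℝ) : ℂ) ^ s * exp (-s * w) := by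
  have hb' : (b : ℂ) ≠ 0 := by exact_mod_cast hb
  have h2 : 0 < b ^ 2 := by positivity
  have h2' : ((b ^ 2 : ℝ) : ℂ) ≠ 0 := by exact_mod_cast h2.ne'
  have hN : expNum g w = b := by rw [expNum, h00, h01]; simp
  have hD : expDen g w = -exp w / b := by rw [expDen, h10, h11]; push_cast; ring
  have hE := exp_ne_zero w
  have hM : expNum g w / expDen g w = ((b ^ 2 : ℝ) : ℂ) * exp (π * I - w) := by
    rw [hN, hD, exp_sub, exp_pi_mul_I]; push_cast; field_simp
  have hw' : (π * I - w : ℂ) ∈ piStrip := by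
    have := hw.1; have := hw.2
    constructor <;> simp <;> linarith
  have hlog : log (((b ^ 2 : ℝ) : ℂ) * exp (π * I - w)) = log ((b ^ 2 : ℝ) : ℂ) + (π * I - w) := by
    rw [log_ofReal_mul h2 (exp_ne_zero _), log_exp_piStrip hw', ofReal_log h2.le]
  have e1 : exp (-(j * log ((b ^ 2 : ℝ) : ℂ))) = ((b : ℂ) ^ (2 * j))⁻¹ := by
    rw [exp_neg, exp_nat_mul, exp_log h2', pow_mul]; push_cast; rfl
  rw [hypTerm, hM, hD, cpow_def_of_ne_zero (mul_ne_zero h2' (exp_ne_zero _)), hlog,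
    cpow_def_of_ne_zero h2']
  have e2 : (log ((b ^ 2 : ℝ) : ℂ) + (π * I - w)) * (-(j : ℂ) + s) =
      -(j * log ((b ^ 2 : ℝ) : ℂ)) + -(j * (π * I)) + j * w + s * (π * I) +
        log ((b ^ 2 : ℝ) : ℂ) * s + -s * w := by ring
  have e4 : exp (-(j * (π * I))) = (-1) ^ j := by
    rw [exp_neg, exp_nat_mul, exp_pi_mul_I, ← inv_pow]; norm_num
  have e5 : (-exp w / b) ^ (2 * j) = exp (j * w) ^ 2 / (b : ℂ) ^ (2 * j) := by
    rw [div_pow, Even.neg_pow (even_two_mul j), exp_nat_mul, ← pow_mul, mul_comm j 2]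
  rw [e2, exp_add, exp_add, exp_add, exp_add, exp_add, e1, e4, e5]
  have e3 := exp_ne_zero (j * w)
  field_simp

/-! ### Grouping the double cosets -/

lemma mem_cSet_of_nondeg {q : DblCosets Γ η η'} (hq : Nondeg (transMatrix σ σ' (dblOut q))) :
    transMatrix σ σ' (dblOut q) 0 0 * transMatrix σ σ' (dblOut q) 1 1 ∈ cSet Γ σ σ' := by
  rw [cSet_eq]
  exact ⟨_, hq, rfl⟩

lemma fiber_eq_union {C : ℝ} (hC : C ∈ cSet Γ σ σ') :
    {q : DblCosets Γ η η' | transMatrix σ σ' (dblOut q) 0 0 * transMatrix σ σ' (dblOut q) 1 1 = C} =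
      kloosterIndex Γ η η' σ σ' C 1 ∪ kloosterIndex Γ η η' σ σ' C (-1) := by
  ext q
  simp only [mem_ofPred_eq, mem_union, mem_kloosterIndex_iff, ← and_or_left]
  refine ⟨fun h => ⟨h, ?_⟩, fun h => h.1⟩
  obtain ⟨h1, -, h2, -⟩ := nondeg_of_mul_eq (cSet_ne hC).1 (cSet_ne hC).2 h
  rcases (mul_ne_zero h1 h2).lt_or_gt with h3 | h3
  · right; exact sign_neg h3
  · left; exact sign_pos h3

lemma disjoint_kloosterIndex (C : ℝ) :
    Disjoint (kloosterIndex Γ η η' σ σ' C 1) (kloosterIndex Γ η η' σ σ' C (-1)) := by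
  rw [Set.disjoint_left]
  intro q h1 h2
  rw [mem_kloosterIndex_iff] at h1 h2
  exact absurd (h1.2.symm.trans h2.2) (by decide)

lemma tsum_subtype_eq_finsum_mem {β : Type*} {S : Set β} (hS : S.Finite) (f : β → ℂ) :
    ∑' x : S, f x = ∑ᶠ x ∈ S, f x := by
  have := hS.to_subtype
  rw [← finsum_set_coe_eq_finsum_mem S, tsum_eq_finsum (Set.toFinite _)]

variable [DiscreteTopology Γ]

lemma tsum_diag_eq_extraDiag (hη : IsHyperbolicPair Γ η) (hσ : IsScaling η σ)
    (hη' : IsHyperbolicPair Γ η') (hσ' : IsScaling η' σ') (j : ℕ) (m n : ℤ) {a b : ℝ}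
    (hab : IsTransition Γ η η' σ σ' a b) :
    ∑' p : RightCosets Γ η, {p : RightCosets Γ η | transMatrix σ σ' p.out 0 1 = 0 ∧
        transMatrix σ σ' p.out 1 0 = 0}.indicator (fun p => stripCoeff (pairLength Γ η')
          (hypTerm j (hypFreq (pairLength Γ η) m) (transMatrix σ σ' p.out)) (π / 2) n) p =
      extraDiag Γ η η' a m n := by
  by_cases hP : PairEquiv Γ η' η
  · obtain ⟨γ, hγ, hm⟩ := hab.diag hP
    have hent : ∀ i k, transMatrix σ σ' (⟨γ, hγ⟩ : Γ) i k = !![a, 0; 0, 1 / a] i k := fun i k =>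
      congrFun (congrFun hm i) k
    rw [tsum_indicator_diag hη hσ (leftInvariant_stripCoeff hη hσ _ j m n) (γ := ⟨γ, hγ⟩) (hent 0 1)
      (hent 1 0)]
    rw [stripCoeff_eq_ite (pairLength_pos hη' hσ') (i := m)
      (A := ((a ^ 2 : ℝ) : ℂ) ^ hypFreq (pairLength Γ η') m) (fun w hw => by
        rw [hP.pairLength_eq]
        exact hypTerm_diag j _ hab.a_ne_zero (hent 0 0) (hent 0 1) (hent 1 0) (hent 1 1) hw)]
    rw [extraDiag]
    by_cases hn : n = m
    · rw [if_pos hn, if_pos ⟨hP, hn⟩, hn, hypFreq]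
    · rw [if_neg hn, if_neg fun h => hn h.2]
  · rw [extraDiag, if_neg fun h => hP h.1]
    refine (tsum_congr fun p => Set.indicator_of_notMem (fun hp => hP ?_) _).trans tsum_zero
    exact ⟨_, p.out.2, (bdAct_pair_iff hσ hσ' _).2 hp⟩

lemma tsum_antidiag_eq_extraAntidiag (hη : IsHyperbolicPair Γ η) (hσ : IsScaling η σ)
    (hη' : IsHyperbolicPair Γ η') (hσ' : IsScaling η' σ') (j : ℕ) (m n : ℤ) {a b : ℝ}
    (hab : IsTransition Γ η η' σ σ' a b) :
    ∑' p : RightCosets Γ η, {p : RightCosets Γ η | transMatrix σ σ' p.out 0 0 = 0 ∧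
        transMatrix σ σ' p.out 1 1 = 0}.indicator (fun p => stripCoeff (pairLength Γ η')
          (hypTerm j (hypFreq (pairLength Γ η) m) (transMatrix σ σ' p.out)) (π / 2) n) p =
      extraAntidiag (2 * j) Γ η η' b m n := by
  by_cases hP : PairEquiv Γ η' η.swap
  · obtain ⟨γ, hγ, hm⟩ := hab.antidiag hP
    have hent : ∀ i k, transMatrix σ σ' (⟨γ, hγ⟩ : Γ) i k = !![0, b; -1 / b, 0] i k := fun i k =>
      congrFun (congrFun hm i) k
    rw [tsum_indicator_antidiag hη hσ (leftInvariant_stripCoeff hη hσ _ j m n) (γ := ⟨γ, hγ⟩)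
      (hent 0 0) (hent 1 1)]
    have hlen : pairLength Γ η' = pairLength Γ η := hP.pairLength_eq.trans pairLength_swap
    have hneg : hypFreq (pairLength Γ η') (-m) = -hypFreq (pairLength Γ η') m := by
      rw [hypFreq, hypFreq]; push_cast; ring
    rw [stripCoeff_eq_ite (pairLength_pos hη' hσ') (i := -m)
      (A := (-1) ^ j * exp (hypFreq (pairLength Γ η') m * (π * I)) *
        ((b ^ 2 : ℝ) : ℂ) ^ hypFreq (pairLength Γ η') m) (fun w hw => by
        rw [hneg, hlen]
        exact hypTerm_antidiag j _ hab.b_ne_zero (hent 0 0) (hent 0 1) (hent 1 0) (hent 1 1) hw)]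
    rw [extraAntidiag]
    by_cases hn : n = -m
    -- At n = -m the factor e^(πis) with s = 2πim/ℓ equals e^(-2π²m/ℓ) = e^(2π²n/ℓ).
    · rw [if_pos hn, if_pos ⟨hP, hn⟩, hn, Nat.mul_div_cancel_left j two_pos]
      congr 2
      · congr 1
        rw [hypFreq]
        push_cast
        linear_combination (2 * π ^ 2 * m / pairLength Γ η' : ℂ) * I_mul_I
      · rw [hypFreq]; push_cast; ring
    · rw [if_neg hn, if_neg fun h => hn h.2]
  · rw [extraAntidiag, if_neg fun h => hP h.1]
    refine (tsum_congr fun p => Set.indicator_of_notMem (fun hp => hP ?_) _).trans tsum_zero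
    exact ⟨_, p.out.2, (bdAct_pair_swap_iff hσ hσ' _).2 hp.symm⟩

/-- Summation over the nondegenerate double cosets, grouped by the value of `ad`. -/
theorem tsum_nondegCosets (hη : IsHyperbolicPair Γ η) (hη' : IsHyperbolicPair Γ η')
    (hσ : IsScaling η σ) (hσ' : IsScaling η' σ') {f : DblCosets Γ η η' → ℂ}
    (hf : Summable fun q : NondegCosets Γ η η' σ σ' => f q) {U : ℝ → ℂ}
    (hU : ∀ C ∈ cSet Γ σ σ', U C = ∑ᶠ q ∈ kloosterIndex Γ η η' σ σ' C 1, f q +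
      ∑ᶠ q ∈ kloosterIndex Γ η η' σ σ' C (-1), f q) :
    (Summable fun C : ↥(cSet Γ σ σ' \ Ioo 0 1) => U C) ∧
    ∑' q : NondegCosets Γ η η' σ σ', f q = ∑' C : ↥(cSet Γ σ σ' \ Ioo 0 1), U C +
      ∑ᶠ C ∈ cSet Γ σ σ' ∩ Ioo 0 1, U C := by
  obtain ⟨φ, hφ⟩ : ∃ φ : NondegCosets Γ η η' σ σ' → ↥(cSet Γ σ σ'), ∀ q, (φ q : ℝ) =
      transMatrix σ σ' (dblOut q.1) 0 0 * transMatrix σ σ' (dblOut q.1) 1 1 :=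
    ⟨fun q => ⟨_, mem_cSet_of_nondeg q.2⟩, fun q => rfl⟩
  have hs : Summable fun x : Σ C, {q // φ q = C} => f x.2.1 :=
    (Equiv.sigmaFiberEquiv φ).summable_iff.2 hf
  -- As C is neither 0 nor 1, every double coset with ad = C has nonzero entries, so the fibre is
  -- the disjoint union of the index sets for the two signs of ac.
  have hfib : ∀ C : ↥(cSet Γ σ σ'), ∑' q : {q // φ q = C}, f q.1 = U C := by
    intro C
    have hfin := fun α => kloosterIndex_finite hη hη' hσ hσ' C.2 α
    rw [hU C C.2, ← finsum_mem_union (disjoint_kloosterIndex (C : ℝ)) (hfin 1) (hfin (-1)),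
      ← tsum_subtype_eq_finsum_mem ((hfin 1).union (hfin (-1))), ← fiber_eq_union C.2]
    obtain ⟨h0, h1⟩ := cSet_ne C.2
    let e : {q // φ q = C} ≃ {q : DblCosets Γ η η' |
        transMatrix σ σ' (dblOut q) 0 0 * transMatrix σ σ' (dblOut q) 1 1 = C} :=
      { toFun := fun q => ⟨q.1.1, by rw [mem_ofPred_eq, ← hφ, q.2]⟩
        invFun := fun q => ⟨⟨q.1, nondeg_of_mul_eq h0 h1 q.2⟩, Subtype.ext ((hφ _).trans q.2)⟩
        left_inv := fun q => rfl
        right_inv := fun q => rfl }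
    exact e.tsum_eq (fun q => f q)
  have h1 : Summable fun C : ↥(cSet Γ σ σ') => U C := hs.sigma.congr hfib
  have h2 : ∑' q : NondegCosets Γ η η' σ σ', f q = ∑' C : ↥(cSet Γ σ σ'), U C := by
    rw [← (Equiv.sigmaFiberEquiv φ).tsum_eq, ← tsum_congr hfib]
    exact hs.tsum_sigma
  have hd : Summable fun C : ↥(cSet Γ σ σ' \ Ioo 0 1) => U C :=
    h1.comp_injective (Set.inclusion_injective sdiff_subset)
  have hfin := cSet_inter_finite hη hη' hσ hσ'
  refine ⟨hd, ?_⟩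
  rw [h2, ← tsum_subtype_eq_finsum_mem hfin, ← Summable.tsum_union_disjoint _ hd]
  · exact tsum_congr_set_coe U (sdiff_union_inter _ _).symm
  · have := hfin.to_subtype
    exact Summable.of_finite
  · exact disjoint_sdiff_inter

end Coefficients


section Formula

variable {Γ : Subgroup SL(2, ℝ)} {η η' : OnePoint ℝ × OnePoint ℝ} {σ σ' : SL(2, ℝ)}

/-! ### The formula for the coefficients -/

/-- The summand of the Kloosterman sum for the matrix `g`. -/
def kloosterTerm (s r : ℂ) (g : SL(2, ℝ)) : ℂ :=
  exp (s * log ((g 0 0 / g 1 0 : ℝ) : ℂ) + r * log ((-g 1 0 / g 1 1 : ℝ) : ℂ))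

lemma kloosterman_eq (m n : ℤ) (C : ℝ) (α : SignType) :
    kloosterman Γ η η' σ σ' m n C α = ∑ᶠ q ∈ kloosterIndex Γ η η' σ σ' C α,
      kloosterTerm (hypFreq (pairLength Γ η) m) (hypFreq (pairLength Γ η') n)
        (transMatrix σ σ' (dblOut q)) := by
  refine finsum_mem_congr rfl fun q _ => ?_
  rw [kloosterTerm, hypFreq, hypFreq]
  congr 1
  change 2 * π * I * (m / pairLength Γ η * log ((transMatrix σ σ' (dblOut q) 0 0 /
      transMatrix σ σ' (dblOut q) 1 0 : ℝ) : ℂ) + n / pairLength Γ η' *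
        log ((-transMatrix σ σ' (dblOut q) 1 0 / transMatrix σ σ' (dblOut q) 1 1 : ℝ) : ℂ)) = _
  ring

lemma finsum_eq_mul_kloosterman {m n : ℤ} {C : ℝ} {α : SignType} {f : DblCosets Γ η η' → ℂ} {X Y : ℂ}
    (h : ∀ q ∈ kloosterIndex Γ η η' σ σ' C α,
      f q = X * (kloosterTerm (hypFreq (pairLength Γ η) m) (hypFreq (pairLength Γ η') n)
        (transMatrix σ σ' (dblOut q)) / Y)) :
    ∑ᶠ q ∈ kloosterIndex Γ η η' σ σ' C α, f q = X * (kloosterman Γ η η' σ σ' m n C α / Y) := by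
  rw [kloosterman_eq, div_eq_mul_inv, finsum_mem_mul, mul_finsum_mem]
  refine finsum_mem_congr rfl fun q hq => ?_
  rw [h q hq, div_eq_mul_inv]

lemma term₁_eq (j : ℕ) (m n : ℤ) (C : ℝ) : term₁ (2 * j) Γ η η' σ σ' m n C =
    hyp2F1 (j - hypFreq (pairLength Γ η) m) (j + hypFreq (pairLength Γ η') n) ((2 * j : ℕ) : ℂ)
      (1 / (C : ℂ)) *
    ((kloosterman Γ η η' σ σ' m n C 1 + kloosterman Γ η η' σ σ' m n C (-1)) / (C : ℂ) ^ j) := by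
  have h : ((2 * j : ℕ) : ℂ) / 2 = j := by push_cast; ring
  rw [term₁, h, Nat.mul_div_cancel_left j two_pos, hypFreq, hypFreq]

lemma term₂_eq (j : ℕ) (m n : ℤ) (C : ℝ) : term₂ (2 * j) Γ η η' σ σ' m n C =
    hyp2F1 (j - hypFreq (pairLength Γ η) m) (j + hypFreq (pairLength Γ η') n) ((2 * j : ℕ) : ℂ)
      (1 / (C : ℂ)) * (kloosterman Γ η η' σ σ' m n C 1 / (C : ℂ) ^ j) := by
  have h : ((2 * j : ℕ) : ℂ) / 2 = j := by push_cast; ring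
  rw [term₂, h, Nat.mul_div_cancel_left j two_pos, hypFreq, hypFreq]

lemma term₃_eq (j : ℕ) (m n : ℤ) (C : ℝ) : term₃ (2 * j) Γ η η' σ σ' m n C =
    ((C / (C - 1) : ℝ) : ℂ) ^ hypFreq (pairLength Γ η') n *
    hyp2F1 (j + hypFreq (pairLength Γ η) m) (j + hypFreq (pairLength Γ η') n) ((2 * j : ℕ) : ℂ)
      (-1 / ((C : ℂ) - 1)) * (kloosterman Γ η η' σ σ' m n C (-1) / ((C : ℂ) - 1) ^ j) := by
  have h : ((2 * j : ℕ) : ℂ) / 2 = j := by push_cast; ring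
  rw [term₃, h, Nat.mul_div_cancel_left j two_pos, hypFreq, hypFreq]

/-- The factor in front of the hypergeometric function in the line integrals. -/
def lineFactor (j : ℕ) (r : ℂ) : ℂ := exp (-(r * (π * I))) * betaFn (j - r) (j + r)

lemma lineFactor_ne_zero {j : ℕ} (hj : 1 ≤ j) {r : ℂ} (hr : r.re = 0) : lineFactor j r ≠ 0 :=
  mul_ne_zero (exp_ne_zero _) (betaFn_ne_zero (by simpa [hr] using (by omega : 0 < j))
    (by simpa [hr] using (by omega : 0 < j)))

open Classical in
/-- The contribution of the double cosets with `ad = C`. -/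
def fiberTerm (k : ℕ) (Γ : Subgroup SL(2, ℝ)) (η η' : OnePoint ℝ × OnePoint ℝ) (σ σ' : SL(2, ℝ))
    (m n : ℤ) (C : ℝ) : ℂ :=
  if C ∈ Ioo (0 : ℝ) 1 then term₂ k Γ η η' σ σ' m n C + term₃ k Γ η η' σ σ' m n C
  else term₁ k Γ η η' σ σ' m n C

/-- Outside (0, 1) both signs of ac share one hypergeometric value. Inside, the sign selects between
the evaluations of the line integral, so the Kloosterman sums cannot be added. -/
lemma fiberTerm_eq {j : ℕ} (hj : 1 ≤ j) (m n : ℤ) {C : ℝ} (hC : C ∈ cSet Γ σ σ')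
    {f : DblCosets Γ η η' → ℂ}
    (hf : ∀ q, f q = (lineFactor j (hypFreq (pairLength Γ η') n))⁻¹ *
      lineIntegral j (hypFreq (pairLength Γ η) m) (hypFreq (pairLength Γ η') n)
        (transMatrix σ σ' (dblOut q))) :
    fiberTerm (2 * j) Γ η η' σ σ' m n C = ∑ᶠ q ∈ kloosterIndex Γ η η' σ σ' C 1, f q +
      ∑ᶠ q ∈ kloosterIndex Γ η η' σ σ' C (-1), f q := by
  have hr := hypFreq_re (pairLength Γ η') n
  have hA := lineFactor_ne_zero hj hr
  obtain ⟨h0, h1⟩ := cSet_ne hC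
  have hright : ∀ q : DblCosets Γ η η',
      transMatrix σ σ' (dblOut q) 0 0 * transMatrix σ σ' (dblOut q) 1 1 = C →
      (C ∉ Ioo 0 1 ∨ 0 < transMatrix σ σ' (dblOut q) 0 0 * transMatrix σ σ' (dblOut q) 1 0) →
      f q = hyp2F1 (j - hypFreq (pairLength Γ η) m) (j + hypFreq (pairLength Γ η') n)
        ((2 * j : ℕ) : ℂ) (1 / (C : ℂ)) *
        (kloosterTerm (hypFreq (pairLength Γ η) m) (hypFreq (pairLength Γ η') n)
          (transMatrix σ σ' (dblOut q)) / (C : ℂ) ^ j) := by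
    intro q hq hq'
    rw [hf, lineIntegral_eq_right hj _ hr (nondeg_of_mul_eq h0 h1 hq) (by rwa [hq]), hq,
      ← lineFactor, inv_mul_cancel_left₀ hA, kloosterTerm]
  by_cases hI : C ∈ Ioo (0 : ℝ) 1
  · rw [fiberTerm, if_pos hI, term₂_eq, term₃_eq]
    congr 1
    · refine (finsum_eq_mul_kloosterman fun q hq => ?_).symm
      rw [mem_kloosterIndex_iff] at hq
      exact hright q hq.1 (Or.inr (sign_eq_one_iff.1 hq.2))
    · refine (finsum_eq_mul_kloosterman fun q hq => ?_).symm
      rw [mem_kloosterIndex_iff] at hq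
      rw [hf, lineIntegral_eq_left hj _ hr (nondeg_of_mul_eq h0 h1 hq.1) (by rwa [hq.1])
        (sign_eq_neg_one_iff.1 hq.2), hq.1, ← lineFactor, inv_mul_cancel_left₀ hA, kloosterTerm]
  · rw [fiberTerm, if_neg hI, term₁_eq, add_div, mul_add]
    congr 1
    all_goals
      refine (finsum_eq_mul_kloosterman fun q hq => ?_).symm
      exact hright q hq.1 (Or.inl hI)

variable [DiscreteTopology Γ]

theorem summable_term₁_and_stripCoeff_hypSum (hη : IsHyperbolicPair Γ η) (hσ : IsScaling η σ)
    (hη' : IsHyperbolicPair Γ η') (hσ' : IsScaling η' σ') {j : ℕ} (hj : 2 ≤ j) (m n : ℤ) {a b : ℝ}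
    (hab : IsTransition Γ η η' σ σ' a b) :
    (Summable fun C : ↥(cSet Γ σ σ' \ Ioo 0 1) => term₁ (2 * j) Γ η η' σ σ' m n C) ∧
    stripCoeff (pairLength Γ η') (hypSum Γ η σ σ' j (hypFreq (pairLength Γ η) m)) (π / 2) n =
      (pairLength Γ η' : ℂ)⁻¹ * lineFactor j (hypFreq (pairLength Γ η') n) *
        (sum₁ (2 * j) Γ η η' σ σ' m n + sum₂ (2 * j) Γ η η' σ σ' m n +
          sum₃ (2 * j) Γ η η' σ σ' m n) +
      extraDiag Γ η η' a m n + extraAntidiag (2 * j) Γ η η' b m n := by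
  have hL := pairLength_pos hη' hσ'
  have hL' : (pairLength Γ η' : ℂ) ≠ 0 := by exact_mod_cast hL.ne'
  have hs := hypFreq_re (pairLength Γ η) m
  have hr := hypFreq_re (pairLength Γ η') n
  have hj1 : 1 ≤ j := by omega
  have hA := lineFactor_ne_zero hj1 hr
  have hsum := hasSum_stripCoeff_hypTerm (σ' := σ') hη hσ hj hs (pairLength Γ η') n
  obtain ⟨hprod, hsplit⟩ := tsum_rightCosets hη hη' hσ hσ'
    (leftInvariant_stripCoeff hη hσ (pairLength Γ η') j m n) hsum.summable
  have hinner : ∀ q : NondegCosets Γ η η' σ σ', ∑' i : ℤ, stripCoeff (pairLength Γ η')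
      (hypTerm j (hypFreq (pairLength Γ η) m)
        (transMatrix σ σ' (dblOut q.1) * diagExp (i * pairLength Γ η'))) (π / 2) n =
      (pairLength Γ η' : ℂ)⁻¹ * lineIntegral j (hypFreq (pairLength Γ η) m)
        (hypFreq (pairLength Γ η') n) (transMatrix σ σ' (dblOut q.1)) := fun q =>
    tsum_stripCoeff_right hL hj1 hs n q.2
  obtain ⟨f, hf⟩ : ∃ f : DblCosets Γ η η' → ℂ, ∀ q, f q =
      (lineFactor j (hypFreq (pairLength Γ η') n))⁻¹ * lineIntegral j (hypFreq (pairLength Γ η) m)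
        (hypFreq (pairLength Γ η') n) (transMatrix σ σ' (dblOut q)) := ⟨_, fun q => rfl⟩
  have hif : ∀ q : NondegCosets Γ η η' σ σ', (pairLength Γ η' : ℂ)⁻¹ *
      lineIntegral j (hypFreq (pairLength Γ η) m) (hypFreq (pairLength Γ η') n)
        (transMatrix σ σ' (dblOut q.1)) =
      (pairLength Γ η' : ℂ)⁻¹ * lineFactor j (hypFreq (pairLength Γ η') n) * f q := by
    intro q
    rw [hf, mul_assoc, mul_inv_cancel_left₀ hA]
  -- The outer family of an absolutely convergent double series is summable, and removing the
  -- nonzero constant does no harm. The convergence of Σ₁ comes from here.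
  have hsf : Summable fun q : NondegCosets Γ η η' σ σ' => f q := by
    refine (summable_mul_left_iff (mul_ne_zero (inv_ne_zero hL') hA)).1 (hprod.prod.congr fun q => ?_)
    exact (hinner q).trans (hif q)
  obtain ⟨hU, hgroup⟩ := tsum_nondegCosets hη hη' hσ hσ' hsf
    (U := fiberTerm (2 * j) Γ η η' σ σ' m n) fun C hC => fiberTerm_eq hj1 m n hC hf
  have hout : ∀ C : ↥(cSet Γ σ σ' \ Ioo 0 1), fiberTerm (2 * j) Γ η η' σ σ' m n C =
      term₁ (2 * j) Γ η η' σ σ' m n C := fun C => if_neg C.2.2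
  have hin : ∑ᶠ C ∈ cSet Γ σ σ' ∩ Ioo 0 1, fiberTerm (2 * j) Γ η η' σ σ' m n C =
      sum₂ (2 * j) Γ η η' σ σ' m n + sum₃ (2 * j) Γ η η' σ σ' m n := by
    rw [sum₂, sum₃, ← finsum_mem_add_distrib (cSet_inter_finite hη hη' hσ hσ')]
    exact finsum_mem_congr rfl fun C hC => if_pos hC.2
  refine ⟨hU.congr hout, ?_⟩
  rw [← hsum.tsum_eq, hsplit, tsum_diag_eq_extraDiag hη hσ hη' hσ' j m n hab,
    tsum_antidiag_eq_extraAntidiag hη hσ hη' hσ' j m n hab]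
  congr 2
  rw [hprod.tsum_prod]
  rw [tsum_congr fun q => (hinner q).trans (hif q), tsum_mul_left, hgroup, hin, tsum_congr hout,
    ← sum₁, add_assoc]

end Formula

end HypFourier

end

/-! ### The theorem -/

theorem theorem1p4 (Γ : Subgroup SL(2, ℝ)) (hΓ : HypFourier.IsFuchsianFirstKind Γ)
    (η η' : OnePoint ℝ × OnePoint ℝ)
    (hη : HypFourier.IsHyperbolicPair Γ η) (hη' : HypFourier.IsHyperbolicPair Γ η')
    (σ σ' : SL(2, ℝ)) (hσ : HypFourier.IsScaling η σ) (hσ' : HypFourier.IsScaling η' σ') :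
    -- the numbers `a`, `b` exist, depending only on the group, the pairs and the scaling matrices
    (∃ a b : ℝ, HypFourier.IsTransition Γ η η' σ σ' a b) ∧
    -- the Kloosterman sums, the second sum and the third sum are finite
    (∀ C ∈ HypFourier.cSet Γ σ σ', ∀ α : SignType,
      (HypFourier.kloosterIndex Γ η η' σ σ' C α).Finite) ∧
    (HypFourier.cSet Γ σ σ' ∩ Set.Ioo 0 1).Finite ∧
    ∀ k : ℕ, Even k → 4 ≤ k → ∀ m : ℤ,
      -- the Poincaré series and the first sum converge absolutely
      (∀ z : UpperHalfPlane, Summable (HypFourier.poincareTerm k Γ η σ m z)) ∧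
      (∀ n : ℤ, Summable fun C : ↥(HypFourier.cSet Γ σ σ' \ Set.Ioo 0 1) =>
        HypFourier.term₁ k Γ η η' σ σ' m n C) ∧
      -- the hyperbolic expansion at `η'` exists, is unique, and has the stated coefficients
      ∃ c : ℤ → ℂ,
        HypFourier.IsHypExpansion k (HypFourier.pairLength Γ η') σ'
          (HypFourier.hypPoincare k Γ η σ m) c ∧
        (∀ c' : ℤ → ℂ, HypFourier.IsHypExpansion k (HypFourier.pairLength Γ η') σ'
          (HypFourier.hypPoincare k Γ η σ m) c' → c' = c) ∧
        ∀ (a b : ℝ), HypFourier.IsTransition Γ η η' σ σ' a b → ∀ n : ℤ,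
          c n = Complex.exp (2 * π ^ 2 * n / HypFourier.pairLength Γ η') /
                HypFourier.pairLength Γ η' *
              HypFourier.betaFn ((k : ℂ) / 2 - 2 * π * Complex.I * n / HypFourier.pairLength Γ η')
                ((k : ℂ) / 2 + 2 * π * Complex.I * n / HypFourier.pairLength Γ η') *
              (HypFourier.sum₁ k Γ η η' σ σ' m n + HypFourier.sum₂ k Γ η η' σ σ' m n +
                HypFourier.sum₃ k Γ η η' σ σ' m n) +
            HypFourier.extraDiag Γ η η' a m n + HypFourier.extraAntidiag k Γ η η' b m n := by
  have := hΓ.discrete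
  obtain ⟨a₀, b₀, hab₀⟩ := HypFourier.exists_isTransition (Γ := Γ) hσ hσ'
  refine ⟨⟨a₀, b₀, hab₀⟩, fun C hC α => HypFourier.kloosterIndex_finite hη hη' hσ hσ' hC α,
    HypFourier.cSet_inter_finite hη hη' hσ hσ', fun k hk hk4 m => ?_⟩
  obtain ⟨j, rfl⟩ := hk.two_dvd
  have hj : 2 ≤ j := by omega
  refine ⟨fun z => HypFourier.summable_poincareTerm hη hσ hj m z, fun n =>
    (HypFourier.summable_term₁_and_stripCoeff_hypSum hη hσ hη' hσ' hj m n hab₀).1, _,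
    HypFourier.isHypExpansion_stripCoeff hη hσ hη' hσ' hj m,
    fun c' hc' => HypFourier.IsHypExpansion.eq_stripCoeff hη' hσ' hc', fun a b hab n => ?_⟩
  rw [(HypFourier.summable_term₁_and_stripCoeff_hypSum hη hσ hη' hσ' hj m n hab).2]
  have h1 : ((2 * j : ℕ) : ℂ) / 2 = j := by push_cast; ring
  -- The factor e^(-πir) with r = 2πin/ℓ_η' is the exponential e^(2π²n/ℓ_η') of the statement.
  have h2 : Complex.exp (-(HypFourier.hypFreq (HypFourier.pairLength Γ η') n * (π * Complex.I))) =
      Complex.exp (2 * π ^ 2 * n / HypFourier.pairLength Γ η') := by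
    congr 1
    rw [HypFourier.hypFreq]
    linear_combination (-2 * π ^ 2 * n / HypFourier.pairLength Γ η' : ℂ) * Complex.I_mul_I
  rw [HypFourier.lineFactor, h1, h2, HypFourier.hypFreq]
  ring
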